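/- Let $m\in(0,1)$. For $f\in L^2(\mathbb R)$ with Fourier transform $\widehat f(\xi)=\int e^{-ix\xi}f(x)\,dx$ put \[ e^{it(-\Delta)^{m/2}}f(x)=\lim_{R\to\infty}\frac1{2\pi}\int_{-R}^{R}e^{i(x\xi+t|\xi|^m)}\widehat f(\xi)\,d\xi , \qquad f(x)=\lim_{r\to0^+}\frac1{2r}\int_{x-r}^{x+r}f(y)\,dy \] wherever the limits exist, and let $\|f\|_{H^s}^2=\|(1-\Delta)^{s/2}f\|_{L^2}^2=\frac1{2\pi}\int(1+\xi^2)^s|\widehat f(\xi)|^2\,d\xi$. Let the divergence set $\mathfrak D(f)$ be the set of all $x\in\mathbb R$ at which it is not true that $f(x)$ exists, $e^{it(-\Delta)^{m/2}}f(x)$ exists for all $t\ne0$ near $0$, and $\lim_{t\to0}e^{it(-\Delta)^{m/2}}f(x)=f(x)$. (i) For every $s\in(\frac m4,\frac12)$, \[ \sup_{f\in H^s(\mathbb R)}\dim_H\mathfrak D(f)\le\max\Big\{1-2s,\ \frac12+\frac{1-4s}{2(1-m)}\Big\}. \] For $\alpha\in(0,1]$, $q\in[2,\infty)$ write $s(\alpha,q)=\max\{\frac12-\frac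 m4-\frac{(1-m)\alpha}{q},\ \frac12-\frac\alpha q\}$, and call a Borel measure $\mu$ on $\mathbb R$ supported in $[-1,1]$ $\alpha$-dimensional with constant $A$ if $\mu((x-r,x+r))\le Ar^\alpha$ for all $x\in\mathbb R$, $r>0$. Consider the maximal estimate \[ \Big(\int_{(0,1)}\sup_{0<t<1}|e^{it(-\Delta)^{m/2}}f(x)|^q\,d\mu(x)\Big)^{1/q}\le C\|f\|_{H^s}, \tag{M} \] where $|e^{it(-\Delta)^{m/2}}f(x)|$ is read as the upper limit of the moduli of the truncated integrals as $R\to\infty$ (its value wherever the limit exists). (ii) If $s>s(\alpha,q)$, then for every $A$ there is $C$, depending only on $m,\alpha,q,s,A$, such that for every $\alpha$-dimensional $\mu$ with constant $A$ and every $f\in H^s(\mathbb R)$ the value $e^{it(-\Delta)^{m/2}}f(x)$ exists for all $t\in(0,1)$ at $\mu$-almost every $x\in(0,1)$, and (M) holds. (iii) For all $\alpha\in(0,1]$ and $q\in[2,\infty)$ there is an $\alpha$-dimensional measure $\mu$ such that for every $s<s(\alpha,q)$ there is no constant $C$ with which (M) holds for all Schwartz functions $f$. -/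

import Mathlib

open MeasureTheory Filter Topology Set
open scoped ENNReal NNReal FourierTransform SchwartzMap

noncomputable section

namespace FractionalSchrodinger

/-- The Fourier transform `f̂(ξ) = ∫ e^{-ixξ} f(x) dx` of `f ∈ L²(ℝ)` (Plancherel transform), in the
angular frequency normalization: Mathlib's `𝓕` has the kernel `e^{-2πixξ}`. -/
def fhat (f : Lp ℂ 2 (volume : Measure ℝ)) (ξ : ℝ) : ℂ :=
  (𝓕 f : Lp ℂ 2 (volume : Measure ℝ)) (ξ / (2 * Real.pi))

/-- The truncated integral `(2π)⁻¹ ∫_{|ξ| ≤ R} e^{i(xξ + t|ξ|^m)} f̂(ξ) dξ`. It converges absolutely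
for every `f ∈ L²(ℝ)`, because `f̂` is square integrable. -/
def truncatedEvolution (m : ℝ) (f : Lp ℂ 2 (volume : Measure ℝ)) (R x t : ℝ) : ℂ :=
  (2 * Real.pi : ℂ)⁻¹ *
    ∫ ξ in (-R)..R, Complex.exp (Complex.I * ((x * ξ + t * |ξ| ^ m : ℝ) : ℂ)) * fhat f ξ

/-- `v` is the value at `(x, t)` of
`e^{it(-Δ)^{m/2}} f(x) = (2π)⁻¹ ∫ e^{i(xξ + t|ξ|^m)} f̂(ξ) dξ`, as an improper integral
(the integral need not converge absolutely when `f ∈ H^s(ℝ)` with `s ≤ 1/2`). -/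
def HasEvolutionValue (m : ℝ) (f : Lp ℂ 2 (volume : Measure ℝ)) (x t : ℝ) (v : ℂ) : Prop :=
  Tendsto (fun R : ℝ => truncatedEvolution m f R x t) atTop (𝓝 v)

/-- `v` is the value `f(x)` of the precise representative of `f`: the limit of the means of `f`
over the intervals centred at `x`. It depends only on the almost everywhere class of `f`. -/
def HasPreciseValue (f : Lp ℂ 2 (volume : Measure ℝ)) (x : ℝ) (v : ℂ) : Prop :=
  Tendsto (fun r : ℝ => ((2 * r : ℝ) : ℂ)⁻¹ * ∫ y in (x - r)..(x + r), f y) (𝓝[>] 0) (𝓝 v)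

/-- `lim_{t → 0} e^{it(-Δ)^{m/2}} f(x) = f(x)`, where it is part of the assertion that
`f(x)` exists and that `e^{it(-Δ)^{m/2}} f(x)` exists for all `t ≠ 0` close to `0`. -/
def ConvergesAt (m : ℝ) (f : Lp ℂ 2 (volume : Measure ℝ)) (x : ℝ) : Prop :=
  ∃ (u : ℝ → ℂ) (v : ℂ), (∀ᶠ t in 𝓝[≠] (0 : ℝ), HasEvolutionValue m f x t (u t)) ∧
    HasPreciseValue f x v ∧ Tendsto u (𝓝[≠] 0) (𝓝 v)

/-- The divergence set of `f`. -/
def divergenceSet (m : ℝ) (f : Lp ℂ 2 (volume : Measure ℝ)) : Set ℝ :=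
  {x | ¬ ConvergesAt m f x}

/-- `f ∈ L²(ℝ)` belongs to `H^s(ℝ)`. For `s ≥ 0` every element of `H^s(ℝ)` is in `L²(ℝ)`. -/
def InHs (s : ℝ) (f : Lp ℂ 2 (volume : Measure ℝ)) : Prop :=
  TemperedDistribution.MemSobolev s 2 (f : 𝓢'(ℝ, ℂ))

/-- The norm `‖f‖_{H^s} = ‖(1 - Δ)^{s/2} f‖_{L²} = ((2π)⁻¹ ∫ (1 + ξ²)^s |f̂(ξ)|² dξ)^{1/2}`. -/
def hsNorm (s : ℝ) (f : Lp ℂ 2 (volume : Measure ℝ)) : ℝ≥0∞ :=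
  (ENNReal.ofReal (2 * Real.pi)⁻¹ *
    ∫⁻ ξ : ℝ, ENNReal.ofReal ((1 + ξ ^ 2) ^ s) * ‖fhat f ξ‖ₑ ^ 2) ^ (1 / 2 : ℝ)

/-- The maximal function `sup_{0 < t < 1} |e^{it(-Δ)^{m/2}} f(x)|`. The upper limit is
`|e^{it(-Δ)^{m/2}} f(x)|` wherever the improper integral converges. -/
def maximalFunction (m : ℝ) (f : Lp ℂ 2 (volume : Measure ℝ)) (x : ℝ) : ℝ≥0∞ :=
  ⨆ t ∈ Ioo (0 : ℝ) 1, limsup (fun R : ℝ => ‖truncatedEvolution m f R x t‖ₑ) atTop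

/-- The norm of `e^{it(-Δ)^{m/2}} f` in `L^q_x((0,1), dμ) L^∞_t((0,1))`. -/
def maximalNorm (m q : ℝ) (μ : Measure ℝ) (f : Lp ℂ 2 (volume : Measure ℝ)) : ℝ≥0∞ :=
  (∫⁻ x in Ioo (0 : ℝ) 1, maximalFunction m f x ^ q ∂μ) ^ (1 / q)

/-- `μ` is an `α`-dimensional measure supported in the unit ball, with constant `A`:
`μ(B(x,r)) ≤ A r^α` for all `x` and all `r > 0`. -/
def IsDimensional (α : ℝ) (A : ℝ≥0) (μ : Measure ℝ) : Prop :=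
  μ (Metric.closedBall (0 : ℝ) 1)ᶜ = 0 ∧
    ∀ x r : ℝ, 0 < r → μ (Metric.ball x r) ≤ A * ENNReal.ofReal (r ^ α)

/-- The critical regularity `max {1/2 - m/4 - (1-m)α/q, 1/2 - α/q}`. -/
def criticalIndex (m α q : ℝ) : ℝ :=
  max (1 / 2 - m / 4 - (1 - m) * α / q) (1 / 2 - α / q)

end FractionalSchrodinger

end

/-! Frequencies are split into the shells `N ≤ |ξ| ≤ 2N`, `N = 2ᵏ`. On each half shell the maximal
function is taken over the times `|t| ≤ 1` and over the truncations `R ∈ [N, 2N]` at once, so that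
it also controls the convergence of the improper integrals. Everything rests on a bound for the
kernel `∫_N^b e^{i(uξ + tξ^m)} dξ` with `|t| ≤ 2`, `b ≤ 2N`: by van der Corput's tests it is at most
a constant times `N^{growth m a} max(|u|, 1/N)^{-a}` (`norm_integral_cexp_rpow_le`). For an
`α`-dimensional measure and `0 < a < α` the potential of `max(|u|, 1/N)^{-a}` is bounded, and
linearization, `TT*` and Schur's test yield an `L²(μ)` bound with constant `N^{growth m a}` for the
squares (`lintegral_shellMax_sq_le`). Only the scales down to `1/N` of the measure matter.

The `L^q` bound follows from the `L²` bound applied to the measure `M^{q-2} dμ`, where `M` is the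
maximal function itself: by Hölder it is `2α/q`-dimensional, with a constant containing a power of
`∫ M^q dμ`, which can be absorbed (`lintegral_shellMax_rpow_le`). Since `growth m (2α/q)` is twice
the critical index, the shell bounds form a convergent geometric series when `s` exceeds that index;
this is (ii). Where the sum of the shell maxima is finite, the truncated integrals converge
uniformly in `|t| ≤ 1` to a continuous function of `t`, whose value at `t = 0` is the limit of the
interval means (`convergesAt_of_tsum_ne_top`).

For (i), the points where the maximal function of the `k`-th shell exceeds `2^{-δk}` form a set
whose Hausdorff content in a unit interval decays geometrically in `k`: a finite Frostman
construction gives a measure on this set which is `β`-dimensional down to the scale `2⁻ᵏ`, and its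
mass is bounded by the maximal estimate (`hausdorffContent_le_of_lt_twoSidedMax`). Borel–Cantelli
for the content, an outer measure, bounds the dimension of the divergence set by every `β` for which
some `a < β` has `growth m a < 2s`. No measurability of the divergence set enters.

For (iii), the measure has density `αx^{α-1}` on `(0, 1)`, and `f̂` is a bump near `-N`. A bump of
width `N` has no oscillation for `x ≲ 1/N`, which gives `1/2 - α/q`. A bump of width `N^{1-m/2}`
travels with its group velocity: for each `x ≲ N^{m-1}` some `t ∈ (0, 1)` cancels the linear part of
the phase, which gives the other term. -/

noncomputable section
namespace FractionalSchrodinger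

/-! ### Van der Corput's tests and the kernel estimate -/

/-- The first derivative test of van der Corput. -/
theorem norm_integral_cexp_le_of_le_abs_deriv {φ φ' φ'' : ℝ → ℝ} {c d l : ℝ} (hcd : c ≤ d)
    (hl : 0 < l) (h1 : ∀ ξ ∈ Icc c d, HasDerivAt φ (φ' ξ) ξ)
    (h2 : ∀ ξ ∈ Icc c d, HasDerivAt φ' (φ'' ξ) ξ) (hc : ContinuousOn φ'' (Icc c d))
    (hpos : ∀ ξ ∈ Icc c d, 0 ≤ φ'' ξ) (hl' : ∀ ξ ∈ Icc c d, l ≤ |φ' ξ|) :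
    ‖∫ ξ in c..d, Complex.exp (Complex.I * (φ ξ : ℂ))‖ ≤ 4 / l := by
  have hne : ∀ ξ ∈ Icc c d, φ' ξ ≠ 0 := fun ξ hξ => abs_pos.1 (hl.trans_le (hl' ξ hξ))
  have hcφ : ContinuousOn φ (Icc c d) := fun ξ hξ => (h1 ξ hξ).continuousAt.continuousWithinAt
  have hcφ' : ContinuousOn φ' (Icc c d) := fun ξ hξ => (h2 ξ hξ).continuousAt.continuousWithinAt
  have hu : uIcc c d = Icc c d := uIcc_of_le hcd
  have hcv : ContinuousOn (fun ξ => Complex.exp (Complex.I * (φ ξ : ℂ))) (Icc c d) :=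
    Complex.continuous_exp.comp_continuousOn
      (continuousOn_const.mul (Complex.continuous_ofReal.comp_continuousOn hcφ))
  have hcq : ContinuousOn (fun ξ => φ'' ξ / φ' ξ ^ 2) (Icc c d) :=
    hc.div (hcφ'.pow 2) fun ξ hξ => pow_ne_zero 2 (hne ξ hξ)
  have hq : ∀ ξ ∈ Icc c d, HasDerivAt (fun ξ => -(φ' ξ)⁻¹) (φ'' ξ / φ' ξ ^ 2) ξ := fun ξ hξ => by
    refine ((h2 ξ hξ).inv (hne ξ hξ)).neg.congr_deriv ?_
    rw [neg_div, neg_neg]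
  -- Integration by parts: `e^{iφ}` is the derivative of `-i e^{iφ}/φ'` up to a term with the factor
  -- `φ''/φ'²`.
  have hF : ∀ ξ ∈ uIcc c d, HasDerivAt
      (fun ξ => Complex.I * ((-(φ' ξ)⁻¹ : ℝ) : ℂ) * Complex.exp (Complex.I * (φ ξ : ℂ)))
      (Complex.I * ((φ'' ξ / φ' ξ ^ 2 : ℝ) : ℂ) * Complex.exp (Complex.I * (φ ξ : ℂ)) +
        Complex.exp (Complex.I * (φ ξ : ℂ))) ξ := fun ξ hξ => by
    rw [hu] at hξ
    have e1 := ((hq ξ hξ).ofReal_comp).const_mul Complex.I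
    have e2 := (((h1 ξ hξ).ofReal_comp).const_mul Complex.I).cexp
    refine (e1.mul e2).congr_deriv ?_
    have : (φ' ξ : ℂ) ≠ 0 := Complex.ofReal_ne_zero.2 (hne ξ hξ)
    congr 1
    push_cast
    field_simp
    rw [Complex.I_sq]
    ring
  have i1 : IntervalIntegrable (fun ξ => Complex.I * ((φ'' ξ / φ' ξ ^ 2 : ℝ) : ℂ) *
      Complex.exp (Complex.I * (φ ξ : ℂ))) volume c d := by
    apply ContinuousOn.intervalIntegrable
    rw [hu]
    exact (continuousOn_const.mul (Complex.continuous_ofReal.comp_continuousOn hcq)).mul hcv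
  have i2 : IntervalIntegrable (fun ξ => Complex.exp (Complex.I * (φ ξ : ℂ))) volume c d := by
    apply ContinuousOn.intervalIntegrable
    rwa [hu]
  have key := intervalIntegral.integral_eq_sub_of_hasDerivAt hF (i1.add i2)
  rw [intervalIntegral.integral_add i1 i2] at key
  have hnorm : ∀ ξ : ℝ, ‖Complex.exp (Complex.I * (φ ξ : ℂ))‖ = 1 := fun ξ => by
    rw [mul_comm]; exact Complex.norm_exp_ofReal_mul_I _
  have hinv : ∀ ξ ∈ Icc c d, |(φ' ξ)⁻¹| ≤ 1 / l := fun ξ hξ => by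
    rw [abs_inv, ← one_div]
    exact one_div_le_one_div_of_le hl (hl' ξ hξ)
  -- As `φ'' ≥ 0`, the weight `φ''/φ'² = (-1/φ')'` has a constant sign and its integral telescopes;
  -- no bound on `φ''` is needed.
  have b1 : ‖∫ ξ in c..d, Complex.I * ((φ'' ξ / φ' ξ ^ 2 : ℝ) : ℂ) *
      Complex.exp (Complex.I * (φ ξ : ℂ))‖ ≤ 2 / l := by
    calc _ ≤ ∫ ξ in c..d, φ'' ξ / φ' ξ ^ 2 := by
          apply intervalIntegral.norm_integral_le_of_norm_le hcd
          · refine Eventually.of_forall fun ξ hξ => ?_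
            rw [norm_mul, norm_mul, hnorm, Complex.norm_I, one_mul, mul_one, Complex.norm_real,
              Real.norm_of_nonneg]
            exact div_nonneg (hpos ξ (Ioc_subset_Icc_self hξ)) (sq_nonneg _)
          · exact (hu ▸ hcq : ContinuousOn _ (uIcc c d)).intervalIntegrable
      _ = -(φ' d)⁻¹ - -(φ' c)⁻¹ := intervalIntegral.integral_eq_sub_of_hasDerivAt
          (fun ξ hξ => hq ξ (hu ▸ hξ)) (hu ▸ hcq : ContinuousOn _ (uIcc c d)).intervalIntegrable
      _ ≤ 2 / l := by
          have := hinv c ⟨le_rfl, hcd⟩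
          have := hinv d ⟨hcd, le_rfl⟩
          rw [abs_le] at *
          have : 2 / l = 1 / l + 1 / l := by ring
          linarith
  have b2 : ∀ ξ ∈ Icc c d,
      ‖Complex.I * ((-(φ' ξ)⁻¹ : ℝ) : ℂ) * Complex.exp (Complex.I * (φ ξ : ℂ))‖ ≤ 1 / l :=
    fun ξ hξ => by
      rw [norm_mul, norm_mul, hnorm, Complex.norm_I, one_mul, mul_one, Complex.norm_real,
        Real.norm_eq_abs, abs_neg]
      exact hinv ξ hξ
  rw [eq_sub_of_add_eq' key]
  refine (norm_sub_le _ _).trans ?_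
  have b3 := norm_sub_le (Complex.I * ((-(φ' d)⁻¹ : ℝ) : ℂ) * Complex.exp (Complex.I * (φ d : ℂ)))
    (Complex.I * ((-(φ' c)⁻¹ : ℝ) : ℂ) * Complex.exp (Complex.I * (φ c : ℂ)))
  have b4 := b2 c ⟨le_rfl, hcd⟩
  have b5 := b2 d ⟨hcd, le_rfl⟩
  have : 4 / l = 2 / l + (1 / l + 1 / l) := by ring
  linarith

/-- The second derivative test of van der Corput. -/
theorem norm_integral_cexp_le_of_le_deriv2 {φ φ' φ'' : ℝ → ℝ} {c d l : ℝ} (hcd : c ≤ d)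
    (hl : 0 < l) (h1 : ∀ ξ ∈ Icc c d, HasDerivAt φ (φ' ξ) ξ)
    (h2 : ∀ ξ ∈ Icc c d, HasDerivAt φ' (φ'' ξ) ξ) (hc : ContinuousOn φ'' (Icc c d))
    (hpos : ∀ ξ ∈ Icc c d, l ^ 2 ≤ φ'' ξ) :
    ‖∫ ξ in c..d, Complex.exp (Complex.I * (φ ξ : ℂ))‖ ≤ 10 / l := by
  have hcφ : ContinuousOn φ (Icc c d) := fun ξ hξ => (h1 ξ hξ).continuousAt.continuousWithinAt
  have hcφ' : ContinuousOn φ' (Icc c d) := fun ξ hξ => (h2 ξ hξ).continuousAt.continuousWithinAt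
  have hgrow : ∀ x ∈ Icc c d, ∀ y ∈ Icc c d, x ≤ y → l ^ 2 * (y - x) ≤ φ' y - φ' x := by
    intro x hx y hy hxy
    have hsub : Icc x y ⊆ Icc c d := Icc_subset_Icc hx.1 hy.2
    apply (convex_Icc c d).mul_sub_le_image_sub_of_le_deriv hcφ'
      (fun ξ hξ => (h2 ξ (interior_subset hξ)).differentiableAt.differentiableWithinAt)
      (fun ξ hξ => ?_) x hx y hy hxy
    rw [(h2 ξ (interior_subset hξ)).deriv]
    exact hpos ξ (interior_subset hξ)
  -- `p` is the zero of the increasing function `φ'` or, if its sign does not change, the end point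
  -- where `|φ'|` is least. Outside `|ξ - p| < 1/l` one has `|φ'| ≥ l`, so the three pieces
  -- contribute `4/l + 2/l + 4/l`.
  obtain ⟨p, hp, hpl, hpr⟩ : ∃ p ∈ Icc c d, (∀ ξ ∈ Icc c d, ξ < p → φ' ξ ≤ -(l ^ 2 * (p - ξ))) ∧
      ∀ ξ ∈ Icc c d, p < ξ → l ^ 2 * (ξ - p) ≤ φ' ξ := by
    have hcm : c ∈ Icc c d := ⟨le_rfl, hcd⟩
    have hdm : d ∈ Icc c d := ⟨hcd, le_rfl⟩
    by_cases hc0 : 0 ≤ φ' c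
    · refine ⟨c, hcm, fun ξ hξ h => absurd hξ.1 (not_le.2 h), fun ξ hξ h => ?_⟩
      have := hgrow c hcm ξ hξ h.le
      linarith
    by_cases hd0 : φ' d ≤ 0
    · refine ⟨d, hdm, fun ξ hξ h => ?_, fun ξ hξ h => absurd hξ.2 (not_le.2 h)⟩
      have := hgrow ξ hξ d hdm h.le
      linarith
    obtain ⟨p, hp, hp0⟩ := intermediate_value_Icc hcd hcφ' (show (0 : ℝ) ∈ Icc (φ' c) (φ' d) from
      ⟨(not_le.1 hc0).le, (not_le.1 hd0).le⟩)
    refine ⟨p, hp, fun ξ hξ h => ?_, fun ξ hξ h => ?_⟩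
    · have := hgrow ξ hξ p hp h.le
      linarith
    · have := hgrow p hp ξ hξ h.le
      linarith
  have hli : 0 < 1 / l := by positivity
  set p1 := max c (p - 1 / l) with hp1
  set p2 := min d (p + 1 / l) with hp2
  have e1 : c ≤ p1 := le_max_left _ _
  have e2 : p1 ≤ p := max_le hp.1 (by linarith)
  have e3 : p ≤ p2 := le_min hp.2 (by linarith)
  have e4 : p2 ≤ d := min_le_left _ _
  have hnorm : ∀ ξ : ℝ, ‖Complex.exp (Complex.I * (φ ξ : ℂ))‖ = 1 := fun ξ => by
    rw [mul_comm]; exact Complex.norm_exp_ofReal_mul_I _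
  have hcv : ContinuousOn (fun ξ => Complex.exp (Complex.I * (φ ξ : ℂ))) (Icc c d) :=
    Complex.continuous_exp.comp_continuousOn
      (continuousOn_const.mul (Complex.continuous_ofReal.comp_continuousOn hcφ))
  have hint : ∀ x ∈ Icc c d, ∀ y ∈ Icc c d,
      IntervalIntegrable (fun ξ => Complex.exp (Complex.I * (φ ξ : ℂ))) volume x y :=
    fun x hx y hy => (hcv.mono (ordConnected_Icc.uIcc_subset hx hy)).intervalIntegrable
  have m1 : p1 ∈ Icc c d := ⟨e1, e2.trans hp.2⟩
  have m2 : p2 ∈ Icc c d := ⟨hp.1.trans e3, e4⟩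
  have hll : l ^ 2 * (1 / l) = l := by field_simp
  have a1 : ‖∫ ξ in c..p1, Complex.exp (Complex.I * (φ ξ : ℂ))‖ ≤ 4 / l := by
    rcases le_total (p - 1 / l) c with h | h
    · have : p1 = c := max_eq_left h
      rw [this]; simp; positivity
    · have hsub : Icc c p1 ⊆ Icc c d := Icc_subset_Icc le_rfl m1.2
      refine norm_integral_cexp_le_of_le_abs_deriv e1 hl (fun ξ hξ => h1 ξ (hsub hξ))
        (fun ξ hξ => h2 ξ (hsub hξ)) (hc.mono hsub)
        (fun ξ hξ => (sq_nonneg l).trans (hpos ξ (hsub hξ))) fun ξ hξ => ?_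
      have h3 : ξ ≤ p - 1 / l := by rw [← max_eq_right h]; exact hξ.2
      have h4 := hpl ξ (hsub hξ) (by linarith)
      have h5 : l ^ 2 * (1 / l) ≤ l ^ 2 * (p - ξ) := by gcongr; linarith
      refine le_trans ?_ (neg_le_abs _)
      linarith
  have a3 : ‖∫ ξ in p2..d, Complex.exp (Complex.I * (φ ξ : ℂ))‖ ≤ 4 / l := by
    rcases le_total d (p + 1 / l) with h | h
    · have : p2 = d := min_eq_left h
      rw [this]; simp; positivity
    · have hsub : Icc p2 d ⊆ Icc c d := Icc_subset_Icc m2.1 le_rfl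
      refine norm_integral_cexp_le_of_le_abs_deriv e4 hl (fun ξ hξ => h1 ξ (hsub hξ))
        (fun ξ hξ => h2 ξ (hsub hξ)) (hc.mono hsub)
        (fun ξ hξ => (sq_nonneg l).trans (hpos ξ (hsub hξ))) fun ξ hξ => ?_
      have h3 : p + 1 / l ≤ ξ := by rw [← min_eq_right h]; exact hξ.1
      have h4 := hpr ξ (hsub hξ) (by linarith)
      have h5 : l ^ 2 * (1 / l) ≤ l ^ 2 * (ξ - p) := by gcongr; linarith
      refine le_trans ?_ (le_abs_self _)
      linarith
  have a2 : ‖∫ ξ in p1..p2, Complex.exp (Complex.I * (φ ξ : ℂ))‖ ≤ 2 / l := by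
    have := intervalIntegral.norm_integral_le_of_norm_le_const (a := p1) (b := p2) (C := 1)
      (f := fun ξ => Complex.exp (Complex.I * (φ ξ : ℂ))) fun ξ _ => (hnorm ξ).le
    refine this.trans ?_
    rw [abs_of_nonneg (by linarith)]
    have g1 : p - 1 / l ≤ p1 := le_max_right _ _
    have g2 : p2 ≤ p + 1 / l := min_le_right _ _
    have : 2 / l = 1 / l + 1 / l := by ring
    linarith
  have mc : c ∈ Icc c d := ⟨le_rfl, hcd⟩
  have md : d ∈ Icc c d := ⟨hcd, le_rfl⟩
  rw [← intervalIntegral.integral_add_adjacent_intervals (hint c mc p2 m2) (hint p2 m2 d md),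
    ← intervalIntegral.integral_add_adjacent_intervals (hint c mc p1 m1) (hint p1 m1 p2 m2)]
  refine (norm_add₃_le).trans ?_
  have : 10 / l = 4 / l + 2 / l + 4 / l := by ring
  linarith

/-- By complex conjugation. It reduces positive times to negative ones, for which the phase `uξ +
tξ^m` is convex. -/
theorem norm_integral_cexp_neg (φ : ℝ → ℝ) (c d : ℝ) :
    ‖∫ ξ in c..d, Complex.exp (Complex.I * ((-φ ξ : ℝ) : ℂ))‖ =
      ‖∫ ξ in c..d, Complex.exp (Complex.I * (φ ξ : ℂ))‖ := by
  have : ∀ ξ, Complex.exp (Complex.I * ((-φ ξ : ℝ) : ℂ)) =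
      (starRingEnd ℂ) (Complex.exp (Complex.I * (φ ξ : ℂ))) := fun ξ => by
    rw [← Complex.exp_conj]
    simp
  simp_rw [this]
  rw [intervalIntegral.intervalIntegral_eq_integral_uIoc,
    intervalIntegral.intervalIntegral_eq_integral_uIoc, integral_conj, norm_smul, norm_smul,
    RCLike.norm_conj]

/-- The exponent of the frequency in the kernel estimate for `a`-dimensional measures; it is twice
the critical regularity for `q = 2`. -/
def growth (m a : ℝ) : ℝ := max (1 - m / 2 - (1 - m) * a) (1 - a)

/-- Three regimes: the trivial bound `N` for `|u| ≤ 1/N`; the first derivative test, giving `1/|u|`,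
if `u` dominates the derivative of `tξ^m`; otherwise `|u| ≲ N^{m-1}` and the second derivative test
gives `(N/|u|)^{1/2}`. -/
theorem norm_integral_cexp_rpow_le_of_nonpos {m : ℝ} (hm0 : 0 < m) (hm1 : m < 1) {a N t b u : ℝ}
    (ha1 : a ≤ 1) (hN : 1 ≤ N) (ht : -2 ≤ t) (ht0 : t ≤ 0) (hb : N ≤ b)
    (hb2 : b ≤ 2 * N) :
    ‖∫ ξ in N..b, Complex.exp (Complex.I * ((u * ξ + t * ξ ^ m : ℝ) : ℂ))‖ ≤
      (8 + 40 * √(8 / (1 - m))) * N ^ growth m a * (max |u| N⁻¹) ^ (-a) := by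
  have hN0 : 0 < N := by linarith
  have hm1' : 0 < 1 - m := by linarith
  have hsq : 0 ≤ √(8 / (1 - m)) := Real.sqrt_nonneg _
  rcases le_or_gt |u| N⁻¹ with hu | hu
  · rw [max_eq_right hu]
    have h1 : ‖∫ ξ in N..b, Complex.exp (Complex.I * ((u * ξ + t * ξ ^ m : ℝ) : ℂ))‖ ≤ N := by
      refine (intervalIntegral.norm_integral_le_of_norm_le_const (C := 1) fun ξ _ => ?_).trans ?_
      · rw [mul_comm]; exact (Complex.norm_exp_ofReal_mul_I _).le
      · rw [abs_of_nonneg (by linarith)]; linarith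
    have h2 : N ≤ N ^ growth m a * N⁻¹ ^ (-a) := by
      rw [Real.inv_rpow hN0.le, ← Real.rpow_neg hN0.le, neg_neg, ← Real.rpow_add hN0]
      nth_rw 1 [← Real.rpow_one N]
      apply Real.rpow_le_rpow_of_exponent_le hN
      have : 1 - a ≤ growth m a := le_max_right _ _
      linarith
    have h3 : 0 ≤ N ^ growth m a * N⁻¹ ^ (-a) := by positivity
    rw [mul_assoc]
    nlinarith
  rw [max_eq_left hu.le]
  have hu0 : 0 < |u| := (inv_pos.2 hN0).trans hu
  have hpos : ∀ ξ ∈ Icc N b, 0 < ξ := fun ξ hξ => hN0.trans_le hξ.1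
  have h1 : ∀ ξ ∈ Icc N b,
      HasDerivAt (fun ξ : ℝ => u * ξ + t * ξ ^ m) (u + t * (m * ξ ^ (m - 1))) ξ := fun ξ hξ => by
    have := ((hasDerivAt_id ξ).const_mul u).add
      ((Real.hasDerivAt_rpow_const (p := m) (Or.inl (hpos ξ hξ).ne')).const_mul t)
    refine this.congr_deriv ?_
    ring
  have h2 : ∀ ξ ∈ Icc N b, HasDerivAt (fun ξ : ℝ => u + t * (m * ξ ^ (m - 1)))
      (-t * (m * ((1 - m) * ξ ^ (m - 2)))) ξ := fun ξ hξ => by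
    have := (((Real.hasDerivAt_rpow_const (p := m - 1)
      (Or.inl (hpos ξ hξ).ne')).const_mul m).const_mul t).const_add u
    refine this.congr_deriv ?_
    rw [show m - 1 - 1 = m - 2 by ring]
    ring
  have hc : ContinuousOn (fun ξ : ℝ => -t * (m * ((1 - m) * ξ ^ (m - 2)))) (Icc N b) := by
    refine continuousOn_const.mul (continuousOn_const.mul (continuousOn_const.mul ?_))
    exact continuousOn_id.rpow_const fun ξ hξ => Or.inl (hpos ξ hξ).ne'
  have hua : |u| ^ (-a) * |u| ^ a = 1 := by rw [← Real.rpow_add hu0]; simp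
  -- As `m < 1`, the derivative of `tξ^m` is largest in modulus at `ξ = N`. In the first case `|φ'|
  -- ≥ |u|/2` on the whole shell.
  rcases le_or_gt (-t * m * N ^ (m - 1)) (|u| / 2) with hA | hB
  · have hV := norm_integral_cexp_le_of_le_abs_deriv hb (half_pos hu0) h1 h2 hc
      (fun ξ hξ => by
        have := hpos ξ hξ
        have := neg_nonneg.2 ht0
        positivity)
      (fun ξ hξ => by
        have e1 : ξ ^ (m - 1) ≤ N ^ (m - 1) :=
          Real.rpow_le_rpow_of_nonpos hN0 hξ.1 (by linarith)
        have e2 : -t * m * ξ ^ (m - 1) ≤ -t * m * N ^ (m - 1) := by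
          have := neg_nonneg.2 ht0
          gcongr
        have e3 : |u| - |-(t * (m * ξ ^ (m - 1)))| ≤ |u - -(t * (m * ξ ^ (m - 1)))| :=
          abs_sub_abs_le_abs_sub _ _
        rw [sub_neg_eq_add, abs_of_nonneg (a := -(t * (m * ξ ^ (m - 1))))] at e3
        · linarith
        · have := hpos ξ hξ
          have : 0 ≤ m * ξ ^ (m - 1) := by positivity
          nlinarith)
    refine hV.trans ?_
    have e4 : 1 / |u| ≤ N ^ growth m a * |u| ^ (-a) := by
      have e5 : 1 / |u| = |u| ^ (-(1 - a)) * |u| ^ (-a) := by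
        rw [← Real.rpow_add hu0, show -(1 - a) + -a = -1 by ring, Real.rpow_neg_one, one_div]
      rw [e5]
      gcongr
      calc |u| ^ (-(1 - a)) ≤ N⁻¹ ^ (-(1 - a)) :=
            Real.rpow_le_rpow_of_nonpos (inv_pos.2 hN0) hu.le (by linarith)
        _ = N ^ (1 - a) := by
            rw [Real.inv_rpow hN0.le, ← Real.rpow_neg hN0.le, neg_neg]
        _ ≤ N ^ growth m a := Real.rpow_le_rpow_of_exponent_le hN (le_max_right _ _)
    have e6 : 4 / (|u| / 2) = 8 * (1 / |u|) := by field_simp; norm_num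
    have e7 : 0 ≤ N ^ growth m a * |u| ^ (-a) := by positivity
    rw [e6, mul_assoc]
    nlinarith
  -- `l²` is a lower bound for `φ''`: the `8` consists of the `2` in the case hypothesis and of `4 ≥
  -- 2^{2-m}`, which accounts for `ξ ≤ 2N`.
  · set l := √(|u| * (1 - m) / (8 * N)) with hl
    have hl0 : 0 < l := Real.sqrt_pos.2 (by positivity)
    have hu4 : |u| ≤ 4 * N ^ (m - 1) := by
      have : 0 < N ^ (m - 1) := by positivity
      have : -t * m ≤ 2 := by nlinarith
      nlinarith
    have hV := norm_integral_cexp_le_of_le_deriv2 hb hl0 h1 h2 hc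
      (fun ξ hξ => by
        have hξ0 := hpos ξ hξ
        rw [hl, Real.sq_sqrt (by positivity)]
        have e1 : (2 * N) ^ (m - 2) ≤ ξ ^ (m - 2) :=
          Real.rpow_le_rpow_of_nonpos hξ0 (hξ.2.trans hb2) (by linarith)
        have e2 : (1 / 4 : ℝ) * (N ^ (m - 1) / N) ≤ (2 * N) ^ (m - 2) := by
          rw [Real.mul_rpow (by norm_num) hN0.le, ← Real.rpow_sub_one hN0.ne',
            show m - 1 - 1 = m - 2 by ring]
          gcongr
          calc (1 / 4 : ℝ) = 2 ^ (-2 : ℝ) := by norm_num [Real.rpow_neg]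
            _ ≤ 2 ^ (m - 2) := Real.rpow_le_rpow_of_exponent_le (by norm_num) (by linarith)
        have e3 := neg_nonneg.2 ht0
        calc |u| * (1 - m) / (8 * N) = (|u| / 2) * (1 - m) * (1 / 4) / N := by field_simp; ring
          _ ≤ (-t * m * N ^ (m - 1)) * (1 - m) * (1 / 4) / N := by gcongr
          _ = -t * (m * ((1 - m) * (1 / 4 * (N ^ (m - 1) / N)))) := by ring
          _ ≤ _ := by gcongr; exact e2.trans e1)
    refine hV.trans ?_
    have e4 : 10 / l = 10 * √(8 / (1 - m)) * (N ^ (1 / 2 : ℝ) * |u| ^ (-(1 / 2) : ℝ)) := by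
      rw [← Real.sqrt_eq_rpow, Real.rpow_neg hu0.le, ← Real.sqrt_eq_rpow, ← Real.sqrt_inv,
        ← Real.sqrt_mul hN0.le, mul_assoc, ← Real.sqrt_mul (by positivity), div_eq_mul_inv, hl,
        ← Real.sqrt_inv]
      congr 2
      field_simp
    have e5 : N ^ (1 / 2 : ℝ) * |u| ^ (-(1 / 2) : ℝ) ≤ 4 * (N ^ growth m a * |u| ^ (-a)) := by
      have e6 : |u| ^ (-(1 / 2) : ℝ) = |u| ^ (a - 1 / 2) * |u| ^ (-a) := by
        rw [← Real.rpow_add hu0]; congr 1; ring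
      rw [e6, ← mul_assoc, ← mul_assoc]
      refine mul_le_mul_of_nonneg_right ?_ (by positivity)
      -- The power `|u|^{a-1/2}` is largest at the least `|u| = 1/N` if `a ≤ 1/2`, and at the
      -- greatest `|u| = 4N^{m-1}` if `a ≥ 1/2`. These are the two terms of `growth`.
      rcases le_total a (1 / 2) with h | h
      · calc N ^ (1 / 2 : ℝ) * |u| ^ (a - 1 / 2) ≤ N ^ (1 / 2 : ℝ) * N⁻¹ ^ (a - 1 / 2) := by
              gcongr ?_ * ?_
              exact Real.rpow_le_rpow_of_nonpos (inv_pos.2 hN0) hu.le (by linarith)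
          _ = N ^ (1 - a) := by
              rw [Real.inv_rpow hN0.le, ← Real.rpow_neg hN0.le, ← Real.rpow_add hN0]
              congr 1; ring
          _ ≤ N ^ growth m a := Real.rpow_le_rpow_of_exponent_le hN (le_max_right _ _)
          _ ≤ 4 * N ^ growth m a := by
              have : 0 < N ^ growth m a := by positivity
              linarith
      · calc N ^ (1 / 2 : ℝ) * |u| ^ (a - 1 / 2)
            ≤ N ^ (1 / 2 : ℝ) * (4 * N ^ (m - 1)) ^ (a - 1 / 2) := by
              gcongr
          _ = 4 ^ (a - 1 / 2) * N ^ (1 - m / 2 - (1 - m) * a) := by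
              rw [Real.mul_rpow (by norm_num) (by positivity), ← Real.rpow_mul hN0.le,
                mul_left_comm, ← Real.rpow_add hN0]
              congr 2; ring
          _ ≤ 4 * N ^ growth m a := by
              gcongr
              · calc (4 : ℝ) ^ (a - 1 / 2) ≤ 4 ^ (1 : ℝ) :=
                    Real.rpow_le_rpow_of_exponent_le (by norm_num) (by linarith)
                  _ = 4 := Real.rpow_one _
              · exact le_max_left _ _
    have e7 : 0 ≤ N ^ growth m a * |u| ^ (-a) := by positivity
    rw [e4, mul_assoc _ (N ^ growth m a)]
    nlinarith [mul_le_mul_of_nonneg_left e5 hsq]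

/-- The kernel estimate: truncated oscillatory integrals over a dyadic shell, uniformly in the
truncation and in the time. -/
theorem norm_integral_cexp_rpow_le {m : ℝ} (hm0 : 0 < m) (hm1 : m < 1) {a N t b u : ℝ}
    (ha1 : a ≤ 1) (hN : 1 ≤ N) (ht : |t| ≤ 2) (hb : N ≤ b) (hb2 : b ≤ 2 * N) :
    ‖∫ ξ in N..b, Complex.exp (Complex.I * ((u * ξ + t * ξ ^ m : ℝ) : ℂ))‖ ≤
      (8 + 40 * √(8 / (1 - m))) * N ^ growth m a * (max |u| N⁻¹) ^ (-a) := by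
  rw [abs_le] at ht
  rcases le_total t 0 with h | h
  · exact norm_integral_cexp_rpow_le_of_nonpos hm0 hm1 ha1 hN ht.1 h hb hb2
  · have := norm_integral_cexp_rpow_le_of_nonpos (u := -u) (t := -t) hm0 hm1 ha1 hN
      (by linarith) (by linarith) hb hb2
    rw [abs_neg, ← norm_integral_cexp_neg] at this
    convert this using 7
    ring

/-! ### The `TT*` argument with Schur's test -/

theorem lintegral_enorm_sq_eq_enorm_integral {W : Type*} [MeasurableSpace W] (ρ : Measure W)
    [IsFiniteMeasure ρ] {f : W → ℂ} {c : ℝ} (hf : StronglyMeasurable f) (hc : ∀ w, ‖f w‖ ≤ c) :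
    ∫⁻ w, ‖f w‖ₑ ^ 2 ∂ρ = ‖∫ w, f w * (starRingEnd ℂ) (f w) ∂ρ‖ₑ := by
  have hsq : ∀ z : ℂ, ‖z‖ₑ ^ 2 = ENNReal.ofReal (‖z‖ ^ 2) := fun z => by
    rw [← ofReal_norm, ← ENNReal.ofReal_pow (norm_nonneg _)]
  have hmc : ∀ z : ℂ, z * (starRingEnd ℂ) z = ((‖z‖ ^ 2 : ℝ) : ℂ) := fun z => by
    rw [Complex.mul_conj, Complex.normSq_eq_norm_sq]
  have hi : Integrable (fun w => ‖f w‖ ^ 2) ρ := by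
    refine Integrable.of_bound (hf.norm.pow 2).aestronglyMeasurable (c ^ 2)
      (Eventually.of_forall fun w => ?_)
    rw [Real.norm_of_nonneg (by positivity)]
    gcongr
    exact hc w
  simp_rw [hmc, hsq]
  rw [integral_complex_ofReal, ← ofReal_integral_eq_lintegral_ofReal hi
    (Eventually.of_forall fun w => by positivity), ← ofReal_norm, Complex.norm_real,
    Real.norm_of_nonneg (integral_nonneg fun _ => by positivity)]

/-- The `TT*` argument with the Schur test: an `L²` bound for an integral operator with bounded
kernel `e`, from a bound `Φ` for the kernel of `TT*`. -/
theorem lintegral_enorm_sq_integral_le {X Y : Type*} [MeasurableSpace X] [MeasurableSpace Y]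
    (μ : Measure X) (ν : Measure Y) [IsFiniteMeasure μ] [IsFiniteMeasure ν] {e : X → Y → ℂ}
    (he : Measurable (Function.uncurry e)) (he1 : ∀ x ξ, ‖e x ξ‖ ≤ 1) {g : Y → ℂ}
    (hg : MemLp g 2 ν) {Φ : X → X → ℝ≥0∞} (hΦm : Measurable (Function.uncurry Φ))
    (hΦ : ∀ x y, ‖∫ ξ, e x ξ * (starRingEnd ℂ) (e y ξ) ∂ν‖ₑ ≤ Φ x y) {S : ℝ≥0∞}
    (hS1 : ∀ x, ∫⁻ y, Φ x y ∂μ ≤ S) (hS2 : ∀ y, ∫⁻ x, Φ x y ∂μ ≤ S) :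
    ∫⁻ x, ‖∫ ξ, e x ξ * g ξ ∂ν‖ₑ ^ 2 ∂μ ≤ 2 * S * ∫⁻ ξ, ‖g ξ‖ₑ ^ 2 ∂ν := by
  have hgi : Integrable g ν := hg.integrable (by norm_num)
  set F : X → ℂ := fun x => ∫ ξ, e x ξ * g ξ ∂ν with hF
  obtain ⟨g', hg'm, hgg'⟩ := hgi.aestronglyMeasurable
  have hFm : StronglyMeasurable F := by
    have : F = fun x => ∫ ξ, e x ξ * g' ξ ∂ν := by
      ext x
      exact integral_congr_ae (hgg'.mono fun ξ h => by simp only [h])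
    rw [this]
    exact (he.stronglyMeasurable.mul (hg'm.comp_measurable measurable_snd)).integral_prod_right
  set G : ℝ := ∫ ξ, ‖g ξ‖ ∂ν with hG
  have hFG : ∀ x, ‖F x‖ ≤ G := fun x => by
    refine norm_integral_le_of_norm_le hgi.norm (Eventually.of_forall fun ξ => ?_)
    rw [norm_mul]
    exact mul_le_of_le_one_left (norm_nonneg _) (he1 x ξ)
  have hG0 : 0 ≤ G := integral_nonneg fun _ => norm_nonneg _
  have hcF : StronglyMeasurable fun x => (starRingEnd ℂ) (F x) :=
    RCLike.continuous_conj.comp_stronglyMeasurable hFm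
  set H : Y → ℂ := fun ξ => ∫ x, e x ξ * (starRingEnd ℂ) (F x) ∂μ with hH
  have hHm : StronglyMeasurable H := by
    have : StronglyMeasurable (Function.uncurry fun (ξ : Y) (x : X) =>
        e x ξ * (starRingEnd ℂ) (F x)) :=
      (he.comp measurable_swap).stronglyMeasurable.mul (hcF.comp_measurable measurable_snd)
    exact this.integral_prod_right
  have hHG : ∀ ξ, ‖H ξ‖ ≤ G * μ.real univ := fun ξ => by
    refine norm_integral_le_of_norm_le_const (Eventually.of_forall fun x => ?_)
    rw [norm_mul, RCLike.norm_conj]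
    exact (mul_le_of_le_one_left (norm_nonneg _) (he1 x ξ)).trans (hFG x)
  set Z : ℝ≥0∞ := ∫⁻ x, ‖F x‖ₑ ^ 2 ∂μ with hZ
  -- Needed to divide by `Z` at the end.
  have hZfin : Z ≠ ∞ := by
    refine ((lintegral_mono fun x => ?_).trans_lt
      (lintegral_const_lt_top (c := ENNReal.ofReal (G ^ 2)) (μ := μ) ENNReal.ofReal_ne_top)).ne
    rw [← ofReal_norm, ← ENNReal.ofReal_pow (norm_nonneg _)]
    gcongr
    exact hFG x
  -- Duality: with `F = Tg`, the function `H` is the transpose of `T` applied to the conjugate of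
  -- `F`.
  have s1 : Z ≤ ∫⁻ ξ, ‖g ξ‖ₑ * ‖H ξ‖ₑ ∂ν := by
    rw [hZ, lintegral_enorm_sq_eq_enorm_integral μ hFm hFG]
    have : ∫ x, F x * (starRingEnd ℂ) (F x) ∂μ = ∫ ξ, g ξ * H ξ ∂ν := by
      calc _ = ∫ x, ∫ ξ, e x ξ * g ξ * (starRingEnd ℂ) (F x) ∂ν ∂μ := by
            simp_rw [integral_mul_const]; rfl
        _ = ∫ ξ, ∫ x, e x ξ * g ξ * (starRingEnd ℂ) (F x) ∂μ ∂ν := by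
            refine integral_integral_swap ?_
            refine Integrable.mono' (g := fun p : X × Y => G * ‖g p.2‖)
              ((hgi.norm.comp_snd μ).const_mul G) ?_ (Eventually.of_forall fun p => ?_)
            · exact (he.aestronglyMeasurable.mul hgi.aestronglyMeasurable.comp_snd).mul
                hcF.aestronglyMeasurable.comp_fst
            · simp only [Function.uncurry, norm_mul, RCLike.norm_conj]
              calc ‖e p.1 p.2‖ * ‖g p.2‖ * ‖F p.1‖ ≤ 1 * ‖g p.2‖ * G := by
                    gcongr
                    · exact he1 _ _
                    · exact hFG _
                _ = _ := by ring
        _ = _ := by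
            refine integral_congr_ae (Eventually.of_forall fun ξ => ?_)
            simp only [hH]
            rw [← integral_const_mul]
            exact integral_congr_ae (Eventually.of_forall fun x => by ring)
    rw [this]
    refine (enorm_integral_le_lintegral_enorm _).trans (le_of_eq ?_)
    simp_rw [enorm_mul]
  have s2 : ∫⁻ ξ, ‖H ξ‖ₑ ^ 2 ∂ν ≤ 2 * S * Z := by
    rw [lintegral_enorm_sq_eq_enorm_integral ν hHm hHG]
    have hcH : StronglyMeasurable fun ξ => (starRingEnd ℂ) (H ξ) :=
      RCLike.continuous_conj.comp_stronglyMeasurable hHm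
    have e1 : ∫ ξ, H ξ * (starRingEnd ℂ) (H ξ) ∂ν =
        ∫ x, (starRingEnd ℂ) (F x) * ∫ ξ, e x ξ * (starRingEnd ℂ) (H ξ) ∂ν ∂μ := by
      calc _ = ∫ ξ, ∫ x, e x ξ * (starRingEnd ℂ) (F x) * (starRingEnd ℂ) (H ξ) ∂μ ∂ν := by
            simp_rw [integral_mul_const]; rfl
        _ = ∫ x, ∫ ξ, e x ξ * (starRingEnd ℂ) (F x) * (starRingEnd ℂ) (H ξ) ∂ν ∂μ := by
            refine integral_integral_swap ?_
            refine Integrable.of_bound (((he.comp measurable_swap).aestronglyMeasurable.mul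
              hcF.aestronglyMeasurable.comp_snd).mul hcH.aestronglyMeasurable.comp_fst)
              (1 * G * (G * μ.real univ)) (Eventually.of_forall fun p => ?_)
            simp only [Function.uncurry, norm_mul, RCLike.norm_conj]
            gcongr
            · exact he1 _ _
            · exact hFG _
            · exact hHG _
        _ = _ := by
            refine integral_congr_ae (Eventually.of_forall fun x => ?_)
            simp only
            rw [← integral_const_mul]
            exact integral_congr_ae (Eventually.of_forall fun ξ => by ring)
    have e2 : ∀ x, ∫ ξ, e x ξ * (starRingEnd ℂ) (H ξ) ∂ν =
        ∫ y, F y * ∫ ξ, e x ξ * (starRingEnd ℂ) (e y ξ) ∂ν ∂μ := by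
      intro x
      have hex : Measurable (e x) := he.comp measurable_prodMk_left
      calc _ = ∫ ξ, ∫ y, e x ξ * ((starRingEnd ℂ) (e y ξ) * F y) ∂μ ∂ν := by
            refine integral_congr_ae (Eventually.of_forall fun ξ => ?_)
            simp only [hH]
            rw [← integral_conj, integral_const_mul]
            simp only [map_mul, Complex.conj_conj]
        _ = ∫ y, ∫ ξ, e x ξ * ((starRingEnd ℂ) (e y ξ) * F y) ∂ν ∂μ := by
            refine integral_integral_swap ?_
            refine Integrable.of_bound ((hex.comp measurable_fst).aestronglyMeasurable.mul
              ((RCLike.continuous_conj.comp_stronglyMeasurable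
                (he.comp measurable_swap).stronglyMeasurable).aestronglyMeasurable.mul
              hFm.aestronglyMeasurable.comp_snd))
              (1 * (1 * G)) (Eventually.of_forall fun p => ?_)
            simp only [Function.uncurry, norm_mul, RCLike.norm_conj]
            gcongr
            · exact he1 _ _
            · exact he1 _ _
            · exact hFG _
        _ = _ := by
            refine integral_congr_ae (Eventually.of_forall fun y => ?_)
            simp only
            rw [← integral_const_mul]
            exact integral_congr_ae (Eventually.of_forall fun ξ => by ring)
    rw [e1]
    have hFe : Measurable fun x => ‖F x‖ₑ := hFm.enorm
    have hΦ1 : ∀ x, Measurable fun y => Φ x y := fun x => hΦm.comp measurable_prodMk_left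
    have hΦ2 : ∀ y, Measurable fun x => Φ x y := fun y => hΦm.comp measurable_prodMk_right
    calc _ ≤ ∫⁻ x, ‖F x‖ₑ * ∫⁻ y, ‖F y‖ₑ * Φ x y ∂μ ∂μ := by
          refine (enorm_integral_le_lintegral_enorm _).trans (lintegral_mono fun x => ?_)
          rw [enorm_mul, RCLike.enorm_conj, e2]
          gcongr
          refine (enorm_integral_le_lintegral_enorm _).trans (lintegral_mono fun y => ?_)
          rw [enorm_mul]
          gcongr
          exact hΦ x y
      -- The inequality `ab ≤ a² + b²`, without the factor `1/2`, is the origin of the `2` in the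
      -- bound.
      _ ≤ ∫⁻ x, ∫⁻ y, ‖F x‖ₑ ^ 2 * Φ x y + ‖F y‖ₑ ^ 2 * Φ x y ∂μ ∂μ := by
          refine lintegral_mono fun x => ?_
          have hm : Measurable fun y => ‖F y‖ₑ * Φ x y := hFe.mul (hΦ1 x)
          rw [← lintegral_const_mul _ hm]
          refine lintegral_mono fun y => ?_
          rw [← mul_assoc, ← add_mul]
          gcongr
          rcases le_total ‖F x‖ₑ ‖F y‖ₑ with h | h
          · calc _ ≤ ‖F y‖ₑ * ‖F y‖ₑ := by gcongr
              _ ≤ _ := by rw [← sq]; exact le_add_self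
          · calc _ ≤ ‖F x‖ₑ * ‖F x‖ₑ := by gcongr
              _ ≤ _ := by rw [← sq]; exact le_self_add
      _ = ∫⁻ x, ∫⁻ y, ‖F x‖ₑ ^ 2 * Φ x y ∂μ ∂μ + ∫⁻ y, ∫⁻ x, ‖F y‖ₑ ^ 2 * Φ x y ∂μ ∂μ := by
          have m1 : Measurable (Function.uncurry fun x y => ‖F x‖ₑ ^ 2 * Φ x y) :=
            ((hFe.comp measurable_fst).pow_const 2).mul hΦm
          have m2 : Measurable (Function.uncurry fun x y => ‖F y‖ₑ ^ 2 * Φ x y) :=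
            ((hFe.comp measurable_snd).pow_const 2).mul hΦm
          have m3 : Measurable fun x => ∫⁻ y, ‖F x‖ₑ ^ 2 * Φ x y ∂μ := m1.lintegral_prod_right'
          rw [← lintegral_lintegral_swap m2.aemeasurable, ← lintegral_add_left m3]
          refine lintegral_congr fun x => ?_
          exact lintegral_add_left ((hΦ1 x).const_mul _) _
      _ ≤ ∫⁻ x, ‖F x‖ₑ ^ 2 * S ∂μ + ∫⁻ y, ‖F y‖ₑ ^ 2 * S ∂μ := by
          gcongr with x y
          · rw [lintegral_const_mul _ (hΦ1 x)]
            gcongr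
            exact hS1 x
          · rw [lintegral_const_mul _ (hΦ2 y)]
            gcongr
            exact hS2 y
      _ = 2 * S * Z := by
          rw [lintegral_mul_const _ (hFe.pow_const 2), ← two_mul, hZ]
          ring
  -- Cauchy–Schwarz in `s1`, with `s2` for the norm of `H`; one factor `Z` then cancels.
  have s3 : Z ^ 2 ≤ (∫⁻ ξ, ‖g ξ‖ₑ ^ 2 ∂ν) * (2 * S * Z) := by
    have h := ENNReal.lintegral_mul_le_Lp_mul_Lq ν Real.HolderConjugate.two_two
      hgi.aestronglyMeasurable.enorm hHm.enorm.aemeasurable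
    have h2 := s1.trans h
    simp only [ENNReal.rpow_two] at h2
    calc Z ^ 2 ≤ ((∫⁻ ξ, ‖g ξ‖ₑ ^ 2 ∂ν) ^ (1 / 2 : ℝ) *
          (∫⁻ ξ, ‖H ξ‖ₑ ^ 2 ∂ν) ^ (1 / 2 : ℝ)) ^ 2 := by
          gcongr
      _ = (∫⁻ ξ, ‖g ξ‖ₑ ^ 2 ∂ν) * ∫⁻ ξ, ‖H ξ‖ₑ ^ 2 ∂ν := by
          rw [mul_pow, ← ENNReal.rpow_natCast, ← ENNReal.rpow_natCast, ← ENNReal.rpow_mul,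
            ← ENNReal.rpow_mul]
          norm_num
      _ ≤ _ := by gcongr
  by_cases hZ0 : Z = 0
  · rw [hZ0]; exact zero_le
  rw [sq, show (∫⁻ ξ, ‖g ξ‖ₑ ^ 2 ∂ν) * (2 * S * Z) = (2 * S * ∫⁻ ξ, ‖g ξ‖ₑ ^ 2 ∂ν) * Z by ring]
    at s3
  exact (ENNReal.mul_le_mul_iff_left hZ0 hZfin).1 s3

/-! ### Maximal functions over one shell and the `L²` estimate -/

/-- The oscillating factor `e^{i(xξ + t|ξ|^m)}`. -/
def osc (m x t ξ : ℝ) : ℂ := Complex.exp (Complex.I * ((x * ξ + t * |ξ| ^ m : ℝ) : ℂ))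

/-- The integral of `e^{i(xξ + t|ξ|^m)} g(ξ)` over `N ≤ ξ ≤ R`. -/
def shellIntegral (m : ℝ) (g : ℝ → ℂ) (N x t R : ℝ) : ℂ := ∫ ξ in N..R, osc m x t ξ * g ξ

/-- The maximal function of the integrals of `e^{i(xξ + t|ξ|^m)} g(ξ)` over `N ≤ ξ ≤ R` with
`R ≤ 2N`, `|t| ≤ 1`. -/
def shellMax (m : ℝ) (g : ℝ → ℂ) (N x : ℝ) : ℝ≥0∞ :=
  ⨆ t ∈ Icc (-1 : ℝ) 1, ⨆ R ∈ Icc N (2 * N), ‖shellIntegral m g N x t R‖ₑ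

theorem norm_osc (m x t ξ : ℝ) : ‖osc m x t ξ‖ = 1 := by
  rw [osc, mul_comm]; exact Complex.norm_exp_ofReal_mul_I _

/-- The kernel of `TT*` depends only on differences. Differences of times in `[-1, 1]` explain the
range `|t| ≤ 2` in the kernel estimate. -/
theorem osc_mul_conj (m x y t s ξ : ℝ) :
    osc m x t ξ * (starRingEnd ℂ) (osc m y s ξ) = osc m (x - y) (t - s) ξ := by
  simp only [osc]
  rw [← Complex.exp_conj, ← Complex.exp_add]
  congr 1
  simp only [map_mul, Complex.conj_I, Complex.conj_ofReal]
  push_cast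
  ring

theorem osc_neg (m x t ξ : ℝ) : osc m x t (-ξ) = osc m (-x) t ξ := by
  simp only [osc, abs_neg, mul_neg, neg_mul]

theorem continuous_osc {m : ℝ} (hm : 0 < m) :
    Continuous fun p : ℝ × ℝ × ℝ => osc m p.1 p.2.1 p.2.2 := by
  unfold osc
  have : Continuous fun p : ℝ × ℝ × ℝ => |p.2.2| ^ m :=
    (continuous_abs.comp (continuous_snd.comp continuous_snd)).rpow_const fun _ => Or.inr hm.le
  fun_prop

theorem continuous_osc_right {m : ℝ} (hm : 0 < m) (x t : ℝ) : Continuous (osc m x t) :=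
  (continuous_osc hm).comp (f := fun ξ => (x, t, ξ)) (by fun_prop)

section

variable {m : ℝ} {g : ℝ → ℂ}

theorem intervalIntegrable_of_memLp (hg : MemLp g 2) (a b : ℝ) :
    IntervalIntegrable g volume a b :=
  ((hg.locallyIntegrable (by norm_num)).integrableOn_isCompact isCompact_uIcc).intervalIntegrable

theorem intervalIntegrable_osc_mul (hm : 0 < m) (hg : MemLp g 2) (x t a b : ℝ) :
    IntervalIntegrable (fun ξ => osc m x t ξ * g ξ) volume a b :=
  (intervalIntegrable_of_memLp hg a b).continuousOn_mul (continuous_osc_right hm x t).continuousOn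

theorem continuous_shellIntegral_time (hm : 0 < m) (hg : MemLp g 2) (N x R : ℝ) :
    Continuous fun t => shellIntegral m g N x t R := by
  refine intervalIntegral.continuous_of_dominated_interval (bound := fun ξ => ‖g ξ‖)
    (fun t => (intervalIntegrable_iff.1 (intervalIntegrable_osc_mul hm hg x t N R)).aestronglyMeasurable) ?_
    (intervalIntegrable_of_memLp hg N R).norm ?_
  · exact fun t => Eventually.of_forall fun ξ _ => by rw [norm_mul, norm_osc, one_mul]
  · exact Eventually.of_forall fun ξ _ =>
      ((continuous_osc hm).comp (f := fun t => (x, t, ξ)) (by fun_prop)).mul continuous_const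

theorem continuous_shellIntegral_space (hm : 0 < m) (hg : MemLp g 2) (N t R : ℝ) :
    Continuous fun x => shellIntegral m g N x t R := by
  refine intervalIntegral.continuous_of_dominated_interval (bound := fun ξ => ‖g ξ‖)
    (fun x => (intervalIntegrable_iff.1 (intervalIntegrable_osc_mul hm hg x t N R)).aestronglyMeasurable) ?_
    (intervalIntegrable_of_memLp hg N R).norm ?_
  · exact fun t => Eventually.of_forall fun ξ _ => by rw [norm_mul, norm_osc, one_mul]
  · exact Eventually.of_forall fun ξ _ =>
      ((continuous_osc hm).comp (f := fun x => (x, t, ξ)) (by fun_prop)).mul continuous_const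

theorem continuous_shellIntegral_trunc (hm : 0 < m) (hg : MemLp g 2) (N x t : ℝ) :
    Continuous fun R => shellIntegral m g N x t R :=
  intervalIntegral.continuous_primitive (intervalIntegrable_osc_mul hm hg x t) N

theorem enorm_shellIntegral_le_shellMax {N x t R : ℝ} (ht : t ∈ Icc (-1 : ℝ) 1)
    (hR : R ∈ Icc N (2 * N)) : ‖shellIntegral m g N x t R‖ₑ ≤ shellMax m g N x :=
  le_iSup₂_of_le t ht (le_iSup₂_of_le R hR le_rfl)

/-- The shell integrals are continuous in the time and in the truncation, so dense sequences
suffice. This gives measurability and reduces the supremum to finite maxima. -/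
theorem exists_shellMax_eq_iSup_nat (hm : 0 < m) (hg : MemLp g 2) {N : ℝ} (hN : 0 ≤ N) :
    ∃ p : ℕ → ℝ × ℝ, (∀ n, (p n).1 ∈ Icc (-1 : ℝ) 1 ∧ (p n).2 ∈ Icc N (2 * N)) ∧
      ∀ x, shellMax m g N x = ⨆ n, ‖shellIntegral m g N x (p n).1 (p n).2‖ₑ := by
  have : Nonempty (Icc (-1 : ℝ) 1) := ⟨⟨0, by norm_num⟩⟩
  have : Nonempty (Icc N (2 * N)) := ⟨⟨N, le_rfl, by linarith⟩⟩
  let d := TopologicalSpace.denseSeq (Icc (-1 : ℝ) 1)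
  let e := TopologicalSpace.denseSeq (Icc N (2 * N))
  refine ⟨fun n => ((d n.unpair.1 : ℝ), (e n.unpair.2 : ℝ)), fun n => ⟨(d _).2, (e _).2⟩,
    fun x => le_antisymm ?_ (iSup_le fun n => enorm_shellIntegral_le_shellMax (d _).2 (e _).2)⟩
  set M := ⨆ n : ℕ, ‖shellIntegral m g N x (d n.unpair.1) (e n.unpair.2)‖ₑ with hM
  have h1 : ∀ i j, ‖shellIntegral m g N x (d i) (e j)‖ₑ ≤ M := fun i j => by
    have := le_iSup (fun n : ℕ => ‖shellIntegral m g N x (d n.unpair.1) (e n.unpair.2)‖ₑ)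
      (Nat.pair i j)
    simpa using this
  have h2 : ∀ i (R : Icc N (2 * N)), ‖shellIntegral m g N x (d i) R‖ₑ ≤ M := fun i R =>
    (TopologicalSpace.denseRange_denseSeq (Icc N (2 * N))).induction_on
      (p := fun R : Icc N (2 * N) => ‖shellIntegral m g N x (d i) R‖ₑ ≤ M) R
      (isClosed_le ((continuous_shellIntegral_trunc hm hg N x _).comp
        continuous_subtype_val).enorm continuous_const) (h1 i)
  have h3 : ∀ (t : Icc (-1 : ℝ) 1) (R : Icc N (2 * N)),
      ‖shellIntegral m g N x t R‖ₑ ≤ M := fun t R =>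
    (TopologicalSpace.denseRange_denseSeq (Icc (-1 : ℝ) 1)).induction_on
      (p := fun t : Icc (-1 : ℝ) 1 => ‖shellIntegral m g N x t R‖ₑ ≤ M) t
      (isClosed_le ((continuous_shellIntegral_time hm hg N x _).comp
        continuous_subtype_val).enorm continuous_const) fun i => h2 i R
  exact iSup₂_le fun t ht => iSup₂_le fun R hR => h3 ⟨t, ht⟩ ⟨R, hR⟩

theorem measurable_shellMax (hm : 0 < m) (hg : MemLp g 2) {N : ℝ} (hN : 0 ≤ N) :
    Measurable (shellMax m g N) := by
  obtain ⟨p, -, hp⟩ := exists_shellMax_eq_iSup_nat hm hg hN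
  rw [funext hp]
  exact Measurable.iSup fun n => (continuous_shellIntegral_space hm hg N _ _).enorm.measurable

theorem shellMax_le (N x : ℝ) :
    shellMax m g N x ≤ ∫⁻ ξ in Ioc N (2 * N), ‖g ξ‖ₑ := by
  refine iSup₂_le fun t _ => iSup₂_le fun R hR => ?_
  rw [shellIntegral, intervalIntegral.integral_of_le hR.1]
  refine (enorm_integral_le_lintegral_enorm _).trans ?_
  refine (lintegral_mono_set (Ioc_subset_Ioc_right hR.2)).trans
    (lintegral_mono fun ξ => ?_)
  rw [enorm_mul, ← ofReal_norm (osc m x t ξ), norm_osc, ENNReal.ofReal_one, one_mul]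

theorem shellMax_lt_top (hg : MemLp g 2) (N x : ℝ) : shellMax m g N x < ∞ := by
  refine (shellMax_le N x).trans_lt ?_
  exact ((hg.locallyIntegrable (by norm_num)).integrableOn_isCompact
    (isCompact_Icc (a := N) (b := 2 * N))).mono_set Ioc_subset_Icc_self |>.2

/-- A measurable choice of the index of a finite maximum; it turns time and truncation into
measurable functions of the point. -/
theorem exists_measurable_maximizer {β : Type*} [MeasurableSpace β] (f : ℕ → β → ℝ≥0∞)
    (hf : ∀ n, Measurable (f n)) (n : ℕ) :
    ∃ j : β → ℕ, Measurable j ∧ ∀ x, ∀ i ≤ n, f i x ≤ f (j x) x := by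
  induction n with
  | zero =>
    refine ⟨fun _ => 0, measurable_const, fun x i hi => ?_⟩
    rw [Nat.le_zero.1 hi]
  | succ n ih =>
    obtain ⟨j, hj, h⟩ := ih
    have hjm : Measurable fun x => f (j x) x := by
      have : Measurable fun p : ℕ × β => f p.1 p.2 := measurable_from_prod_countable_right hf
      exact this.comp (hj.prodMk measurable_id)
    classical
    refine ⟨fun x => if f (j x) x < f (n + 1) x then n + 1 else j x,
      Measurable.ite (measurableSet_lt hjm (hf _)) measurable_const hj, fun x i hi => ?_⟩
    simp only
    split_ifs with hlt
    · rcases Nat.le_succ_iff.1 hi with hi | rfl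
      · exact (h x i hi).trans hlt.le
      · exact le_rfl
    · rcases Nat.le_succ_iff.1 hi with hi | rfl
      · exact h x i hi
      · exact not_lt.1 hlt

/-- With `t = τ(x)`, `R = ρ(x)` the operator is linear with kernel `1_{ξ ≤ ρ(x)} e^{i(xξ +
τ(x)|ξ|^m)}`. The kernel of `TT*` at `(x, y)` is the oscillatory integral over `[N, min(ρ(x),
ρ(y))]` with time `τ(x) - τ(y)`; hence the kernel estimate has to be uniform in `b` and `t`. -/
theorem lintegral_linearized_sq_le (hm0 : 0 < m) (hm1 : m < 1) {a N : ℝ} (ha1 : a ≤ 1)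
    (hN : 1 ≤ N) (hg : MemLp g 2) {μ : Measure ℝ} [IsFiniteMeasure μ] {B : ℝ≥0}
    (hB : ∀ x, ∫⁻ y, ENNReal.ofReal ((max |x - y| N⁻¹) ^ (-a)) ∂μ ≤ B) {τ ρ : ℝ → ℝ}
    (hτ : Measurable τ) (hρ : Measurable ρ) (hτ1 : ∀ x, τ x ∈ Icc (-1 : ℝ) 1)
    (hρ1 : ∀ x, ρ x ∈ Icc N (2 * N)) :
    ∫⁻ x, ‖shellIntegral m g N x (τ x) (ρ x)‖ₑ ^ 2 ∂μ ≤
      2 * (ENNReal.ofReal ((8 + 40 * √(8 / (1 - m))) * N ^ growth m a) * B) *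
        ∫⁻ ξ in Ioc N (2 * N), ‖g ξ‖ₑ ^ 2 := by
  set e : ℝ → ℝ → ℂ := fun x => (Iic (ρ x)).indicator (osc m x (τ x)) with he
  have hS : ∀ x, shellIntegral m g N x (τ x) (ρ x) = ∫ ξ in Ioc N (2 * N), e x ξ * g ξ := by
    intro x
    have : ∀ ξ, e x ξ * g ξ = (Iic (ρ x)).indicator (fun ξ => osc m x (τ x) ξ * g ξ) ξ := fun ξ => by
      simp only [he, indicator_apply]; split_ifs <;> simp
    simp_rw [this]
    rw [shellIntegral, intervalIntegral.integral_of_le (hρ1 x).1, setIntegral_indicator measurableSet_Iic,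
      Ioc_inter_Iic, min_eq_right (hρ1 x).2]
  simp_rw [hS]
  have hNN : 0 ≤ (8 + 40 * √(8 / (1 - m))) * N ^ growth m a := by positivity
  have hmax : Measurable fun p : ℝ × ℝ => (max |p.1 - p.2| N⁻¹) ^ (-a) := by fun_prop
  have hmax2 : ∀ x, Measurable fun y : ℝ => ENNReal.ofReal ((max |x - y| N⁻¹) ^ (-a)) :=
    fun x => (hmax.comp measurable_prodMk_left).ennreal_ofReal
  have hsch : ∀ x, ∫⁻ y, ENNReal.ofReal ((8 + 40 * √(8 / (1 - m))) * N ^ growth m a) *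
      ENNReal.ofReal ((max |x - y| N⁻¹) ^ (-a)) ∂μ ≤
      ((((8 + 40 * √(8 / (1 - m))) * N ^ growth m a).toNNReal * B : ℝ≥0) : ℝ≥0∞) := fun x => by
    rw [lintegral_const_mul _ (hmax2 x), ENNReal.coe_mul]
    gcongr
    · exact le_rfl
    · exact hB x
  have key := lintegral_enorm_sq_integral_le μ (volume.restrict (Ioc N (2 * N))) (e := e) (g := g)
    (Φ := fun x y => ENNReal.ofReal ((8 + 40 * √(8 / (1 - m))) * N ^ growth m a) *
      ENNReal.ofReal ((max |x - y| N⁻¹) ^ (-a)))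
    (S := ((8 + 40 * √(8 / (1 - m))) * N ^ growth m a).toNNReal * B) ?_ ?_ (hg.restrict _) ?_ ?_ hsch ?_
  · exact key
  · have h1 : Measurable fun p : ℝ × ℝ => osc m p.1 (τ p.1) p.2 :=
      (continuous_osc hm0).measurable.comp (f := fun p : ℝ × ℝ => (p.1, τ p.1, p.2)) (by fun_prop)
    have h2 : MeasurableSet {p : ℝ × ℝ | p.2 ≤ ρ p.1} :=
      measurableSet_le measurable_snd (hρ.comp measurable_fst)
    convert h1.indicator h2 using 1
    ext p
    simp [Function.uncurry, he, indicator_apply]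
  · intro x ξ
    refine (norm_indicator_le_norm_self _ _).trans (norm_osc _ _ _ _).le
  · exact (measurable_const.mul hmax.ennreal_ofReal)
  · intro x y
    have h1 : ∀ ξ, e x ξ * (starRingEnd ℂ) (e y ξ) =
        (Iic (min (ρ x) (ρ y))).indicator (osc m (x - y) (τ x - τ y)) ξ := fun ξ => by
      simp only [he, indicator_apply, mem_Iic, le_min_iff]
      by_cases h1 : ξ ≤ ρ x <;> by_cases h2 : ξ ≤ ρ y <;> simp [h1, h2, osc_mul_conj]
    simp_rw [h1]
    have hb : N ≤ min (ρ x) (ρ y) := le_min (hρ1 x).1 (hρ1 y).1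
    have hb2 : min (ρ x) (ρ y) ≤ 2 * N := (min_le_left _ _).trans (hρ1 x).2
    rw [setIntegral_indicator measurableSet_Iic, Ioc_inter_Iic, min_eq_right hb2,
      ← intervalIntegral.integral_of_le hb, ← ENNReal.ofReal_mul hNN, ← ofReal_norm]
    apply ENNReal.ofReal_le_ofReal
    have ht : |τ x - τ y| ≤ 2 := by
      have := hτ1 x; have := hτ1 y
      simp only [mem_Icc] at *
      rw [abs_le]; constructor <;> linarith
    refine le_trans (le_of_eq ?_)
      (norm_integral_cexp_rpow_le hm0 hm1 ha1 hN ht hb hb2 (u := x - y))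
    congr 1
    refine intervalIntegral.integral_congr fun ξ hξ => ?_
    rw [uIcc_of_le hb] at hξ
    simp only [osc]
    rw [abs_of_nonneg (a := ξ) (by linarith [hξ.1])]
  · intro y
    simp_rw [abs_sub_comm _ y]
    exact hsch y

/-- The `L²` maximal estimate over one dyadic shell, for measures with bounded `a`-potential. -/
theorem lintegral_shellMax_sq_le (hm0 : 0 < m) (hm1 : m < 1) {a N : ℝ} (ha1 : a ≤ 1)
    (hN : 1 ≤ N) (hg : MemLp g 2) {μ : Measure ℝ} [IsFiniteMeasure μ] {B : ℝ≥0}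
    (hB : ∀ x, ∫⁻ y, ENNReal.ofReal ((max |x - y| N⁻¹) ^ (-a)) ∂μ ≤ B) :
    ∫⁻ x, shellMax m g N x ^ 2 ∂μ ≤
      2 * (ENNReal.ofReal ((8 + 40 * √(8 / (1 - m))) * N ^ growth m a) * B) *
        ∫⁻ ξ in Ioc N (2 * N), ‖g ξ‖ₑ ^ 2 := by
  obtain ⟨p, hp, hps⟩ := exists_shellMax_eq_iSup_nat hm0 hg (by linarith : 0 ≤ N)
  set f : ℕ → ℝ → ℝ≥0∞ := fun n x => ‖shellIntegral m g N x (p n).1 (p n).2‖ₑ with hf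
  have hfm : ∀ n, Measurable (f n) := fun n =>
    (continuous_shellIntegral_space hm0 hg N _ _).enorm.measurable
  have hmono : ∀ x, Monotone fun n => (⨆ i ≤ n, f i x) ^ 2 := fun x n n' h => by
    have : ⨆ i ≤ n, f i x ≤ ⨆ i ≤ n', f i x := biSup_mono fun i hi => hi.trans h
    simp only
    gcongr
  have hsup : ∀ x, shellMax m g N x ^ 2 = ⨆ n, (⨆ i ≤ n, f i x) ^ 2 := fun x => by
    rw [hps, ← ENNReal.iSup_pow_of_ne_zero two_ne_zero]
    congr 1
    refine le_antisymm (iSup_le fun n => le_iSup_of_le n (le_iSup₂_of_le n le_rfl le_rfl))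
      (iSup_le fun n => iSup₂_le fun i _ => le_iSup (fun i => f i x) i)
  simp_rw [hsup]
  rw [lintegral_iSup (fun n => (Measurable.iSup fun i =>
    Measurable.iSup fun _ => hfm i).pow_const 2) fun n n' h x => hmono x h]
  refine iSup_le fun n => ?_
  -- By monotone convergence only the first `n` pairs of time and truncation have to be considered.
  obtain ⟨j, hj, hjm⟩ := exists_measurable_maximizer f hfm n
  have hpm : Measurable p := measurable_from_nat
  refine le_trans (lintegral_mono fun x => ?_) (lintegral_linearized_sq_le hm0 hm1 ha1 hN hg hB
    (τ := fun x => (p (j x)).1) (ρ := fun x => (p (j x)).2) (measurable_fst.comp (hpm.comp hj))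
    (measurable_snd.comp (hpm.comp hj)) (fun x => (hp _).1) fun x => (hp _).2)
  gcongr
  exact iSup₂_le fun i hi => hjm x i hi

end

/-! ### Potentials of `α`-dimensional measures and the `L^q` estimate over one shell -/

/-- `2⁻ʲ` is comparable with `v`, after values below `2⁻ᵏ` are rounded up to the finest scale `2⁻ᵏ`.
-/
theorem exists_dyadic_scale {v : ℝ} (hv : v < 1) (k : ℕ) :
    ∃ j ≤ k, v < (1 / 2) ^ j ∧ (1 / 2 : ℝ) ^ (j + 1) ≤ max v ((1 / 2) ^ k) := by
  induction k with
  | zero => exact ⟨0, le_rfl, by simpa using hv, le_max_of_le_right (by norm_num)⟩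
  | succ k ih =>
    rcases lt_or_ge v ((1 / 2) ^ (k + 1)) with h | h
    · refine ⟨k + 1, le_rfl, h, le_max_of_le_right ?_⟩
      exact pow_le_pow_of_le_one (by norm_num) (by norm_num) (Nat.le_succ _)
    · obtain ⟨j, hj, h1, h2⟩ := ih
      rcases lt_or_ge v ((1 / 2) ^ k) with h3 | h3
      · exact ⟨k, Nat.le_succ k, h3, le_max_of_le_left h⟩
      · rw [max_eq_left h3] at h2
        exact ⟨j, hj.trans (Nat.le_succ k), h1, le_max_of_le_left h2⟩

/-- A measure which is `α`-dimensional at the scales `1, 1/2, …, 2⁻ᵏ`, with constant `A`. -/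
structure IsDimensionalUpTo (α : ℝ) (A : ℝ≥0) (k : ℕ) (μ : Measure ℝ) : Prop where
  measure_univ_le : μ univ ≤ A
  measure_ball_le : ∀ x, ∀ j ≤ k, μ (Metric.ball x ((1 / 2) ^ j)) ≤
    A * ENNReal.ofReal (((1 / 2) ^ j) ^ α)

/-- The constant in the bound of the `a`-potential of an `α`-dimensional measure. -/
def potentialConst (a α : ℝ) : ℝ≥0 :=
  ∑' j : ℕ, (((1 / 2 : ℝ) ^ (α - a)).toNNReal) ^ j * (2 ^ a : ℝ).toNNReal + 1

/-- At distance about `2⁻ʲ` the kernel is at most `2^{(j+1)a}` and the mass at most `A 2^{-jα}`: a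
geometric series of ratio `2^{-(α-a)}`. As the kernel is cut off at `2⁻ᵏ`, finer scales do not
enter. Points at distance at least `1` account for the `1` in `potentialConst`. -/
theorem lintegral_potential_le {a α : ℝ} (ha : 0 < a) (haα : a < α) {A : ℝ≥0} {k : ℕ}
    {μ : Measure ℝ} (hμ : IsDimensionalUpTo α A k μ) (x : ℝ) :
    ∫⁻ y, ENNReal.ofReal ((max |x - y| ((2 : ℝ) ^ k)⁻¹) ^ (-a)) ∂μ ≤
      ((potentialConst a α * A : ℝ≥0) : ℝ≥0∞) := by
  have hpt : ∀ y, ENNReal.ofReal ((max |x - y| ((2 : ℝ) ^ k)⁻¹) ^ (-a)) ≤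
      (∑ j ∈ Finset.range (k + 1), (Metric.ball x ((1 / 2 : ℝ) ^ j)).indicator
        (fun _ => ENNReal.ofReal (((1 / 2 : ℝ) ^ (j + 1)) ^ (-a))) y) + 1 := by
    intro y
    rw [show ((2 : ℝ) ^ k)⁻¹ = (1 / 2) ^ k by simp]
    rcases lt_or_ge |x - y| 1 with h | h
    · obtain ⟨j, hj, h1, h2⟩ := exists_dyadic_scale h k
      refine le_add_right ?_
      refine le_trans ?_ (Finset.single_le_sum (fun _ _ => zero_le)
        (Finset.mem_range.2 (Nat.lt_succ_of_le hj)))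
      rw [indicator_of_mem]
      · apply ENNReal.ofReal_le_ofReal
        exact Real.rpow_le_rpow_of_nonpos (by positivity) h2 (by linarith)
      · rw [Metric.mem_ball, dist_comm, Real.dist_eq]
        exact h1
    · refine le_add_left ?_
      rw [← ENNReal.ofReal_one]
      apply ENNReal.ofReal_le_ofReal
      exact Real.rpow_le_one_of_one_le_of_nonpos (le_max_of_le_left h) (by linarith)
  set r : ℝ≥0 := ((1 / 2 : ℝ) ^ (α - a)).toNNReal with hr
  have hr1 : r < 1 := by
    rw [hr, Real.toNNReal_lt_one]
    exact Real.rpow_lt_one (by norm_num) (by norm_num) (by linarith)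
  have hsum : Summable fun j : ℕ => r ^ j * (2 ^ a : ℝ).toNNReal :=
    (NNReal.summable_geometric hr1).mul_right _
  have hterm : ∀ j : ℕ, ENNReal.ofReal (((1 / 2 : ℝ) ^ (j + 1)) ^ (-a)) *
      ENNReal.ofReal (((1 / 2 : ℝ) ^ j) ^ α) = ((r ^ j * (2 ^ a : ℝ).toNNReal : ℝ≥0) : ℝ≥0∞) := by
    intro j
    rw [← ENNReal.ofReal_mul (by positivity), hr, ← Real.toNNReal_pow (by positivity),
      ← Real.toNNReal_mul (by positivity), ENNReal.ofReal]
    congr 2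
    rw [pow_succ, Real.mul_rpow (by positivity) (by norm_num), mul_right_comm,
      ← Real.rpow_add (by positivity), ← Real.rpow_natCast, ← Real.rpow_mul (by norm_num),
      ← Real.rpow_natCast, ← Real.rpow_mul (by norm_num)]
    congr 1
    · congr 1; ring
    · rw [one_div, Real.inv_rpow (by norm_num), Real.rpow_neg (by norm_num), inv_inv]
  calc ∫⁻ y, ENNReal.ofReal ((max |x - y| ((2 : ℝ) ^ k)⁻¹) ^ (-a)) ∂μ
      ≤ ∫⁻ y, (∑ j ∈ Finset.range (k + 1), (Metric.ball x ((1 / 2 : ℝ) ^ j)).indicator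
        (fun _ => ENNReal.ofReal (((1 / 2 : ℝ) ^ (j + 1)) ^ (-a))) y) + 1 ∂μ := lintegral_mono hpt
    _ = (∑ j ∈ Finset.range (k + 1), ENNReal.ofReal (((1 / 2 : ℝ) ^ (j + 1)) ^ (-a)) *
          μ (Metric.ball x ((1 / 2 : ℝ) ^ j))) + μ univ := by
        rw [lintegral_add_right _ measurable_const, lintegral_one, lintegral_finsetSum]
        · congr 1
          refine Finset.sum_congr rfl fun j _ => ?_
          rw [lintegral_indicator_const Metric.isOpen_ball.measurableSet]
        · exact fun j _ => measurable_const.indicator Metric.isOpen_ball.measurableSet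
    _ ≤ (∑ j ∈ Finset.range (k + 1), ((r ^ j * (2 ^ a : ℝ).toNNReal : ℝ≥0) : ℝ≥0∞) * A) + A := by
        refine add_le_add (Finset.sum_le_sum fun j hj => ?_) hμ.measure_univ_le
        refine (mul_le_mul_right (hμ.measure_ball_le x j
          (Nat.lt_succ_iff.1 (Finset.mem_range.1 hj))) _).trans (le_of_eq ?_)
        rw [← hterm]
        ring
    _ = ((((∑ j ∈ Finset.range (k + 1), r ^ j * (2 ^ a : ℝ).toNNReal) + 1) * A : ℝ≥0) : ℝ≥0∞) := by
        push_cast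
        rw [add_mul, Finset.sum_mul, one_mul]
    _ ≤ _ := by
        rw [ENNReal.coe_le_coe, potentialConst]
        gcongr
        exact hsum.sum_le_tsum _ fun _ _ => zero_le

section

variable {m : ℝ} {g : ℝ → ℂ}

/-- The constant in the maximal estimates over a dyadic shell. -/
def shellConst (m a α : ℝ) : ℝ≥0 :=
  2 * (8 + 40 * √(8 / (1 - m))).toNNReal * potentialConst a α

theorem lintegral_shellMax_sq_le_of_isDimensionalUpTo (hm0 : 0 < m) (hm1 : m < 1) {a α : ℝ}
    (ha : 0 < a) (haα : a < α) (hα : α ≤ 1) (hg : MemLp g 2) {A : ℝ≥0} {k : ℕ} {μ : Measure ℝ}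
    (hμ : IsDimensionalUpTo α A k μ) :
    ∫⁻ x, shellMax m g (2 ^ k) x ^ 2 ∂μ ≤
      shellConst m a α * A * ENNReal.ofReal (((2 : ℝ) ^ k) ^ growth m a) *
        ∫⁻ ξ in Ioc ((2 : ℝ) ^ k) (2 * 2 ^ k), ‖g ξ‖ₑ ^ 2 := by
  have : IsFiniteMeasure μ := ⟨hμ.measure_univ_le.trans_lt ENNReal.coe_lt_top⟩
  refine (lintegral_shellMax_sq_le hm0 hm1 (haα.le.trans hα)
    (one_le_pow₀ (by norm_num : (1 : ℝ) ≤ 2)) hg (lintegral_potential_le ha haα hμ)).trans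
    (le_of_eq ?_)
  rw [shellConst, ENNReal.ofReal_mul (by positivity)]
  push_cast
  rw [← ENNReal.ofReal]
  ring

/-- The `L^q` maximal estimate over one dyadic shell: a measure with density the power `q - 2` of
the maximal function reduces it to the `L²` estimate. -/
theorem lintegral_shellMax_rpow_le (hm0 : 0 < m) (hm1 : m < 1) {a α q : ℝ} (ha : 0 < a)
    (hq : 2 ≤ q) (haα : a < 2 * α / q) (hα : α ≤ 1) (hg : MemLp g 2) {A : ℝ≥0} {k : ℕ}
    {μ : Measure ℝ} (hμ : IsDimensionalUpTo α A k μ) :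
    ∫⁻ x, shellMax m g (2 ^ k) x ^ q ∂μ ≤
      (shellConst m a (2 * α / q) * (A : ℝ≥0∞) ^ (2 / q) *
        ENNReal.ofReal (((2 : ℝ) ^ k) ^ growth m a) *
        ∫⁻ ξ in Ioc ((2 : ℝ) ^ k) (2 * 2 ^ k), ‖g ξ‖ₑ ^ 2) ^ (q / 2) := by
  have : IsFiniteMeasure μ := ⟨hμ.measure_univ_le.trans_lt ENNReal.coe_lt_top⟩
  have hq0 : 0 < q := by linarith
  set M := shellMax m g (2 ^ k) with hM
  have hMm : Measurable M := measurable_shellMax hm0 hg (by positivity)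
  have hMtop : ∀ x, M x ≠ ∞ := fun x => (shellMax_lt_top hg _ x).ne
  set Z := ∫⁻ x, M x ^ q ∂μ with hZ
  -- Finiteness of `Z` is what permits its absorption below.
  have hZtop : Z ≠ ∞ := by
    set c := ∫⁻ ξ in Ioc ((2 : ℝ) ^ k) (2 * 2 ^ k), ‖g ξ‖ₑ with hc
    have hctop : c ≠ ∞ := (((hg.locallyIntegrable (by norm_num)).integrableOn_isCompact
      (isCompact_Icc (a := (2 : ℝ) ^ k) (b := 2 * 2 ^ k))).mono_set Ioc_subset_Icc_self).2.ne
    refine ((lintegral_mono fun x => ?_).trans_lt (lintegral_const_lt_top (c := c ^ q) (μ := μ)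
      (ENNReal.rpow_ne_top_of_nonneg hq0.le hctop))).ne
    exact ENNReal.rpow_le_rpow (shellMax_le _ x) hq0.le
  rcases eq_or_ne Z 0 with h0 | h0
  · rw [h0]; exact zero_le
  set ν := μ.withDensity fun x => M x ^ (q - 2) with hν
  have hMq : Measurable fun x => M x ^ (q - 2) := hMm.pow_const _
  -- Hölder with the exponents `q/(q-2)` and `q/2`; for `q = 2` the density is `1`.
  have hold : ∀ E, MeasurableSet E → ν E ≤ Z ^ (1 - 2 / q) * μ E ^ (2 / q) := by
    intro E hE
    rw [hν, withDensity_apply _ hE]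
    rcases eq_or_lt_of_le hq with h2 | h2
    · rw [← h2]; simp
    · have hconj : (q / (q - 2)).HolderConjugate (q / 2) := by
        rw [Real.holderConjugate_iff]
        refine ⟨(one_lt_div (by linarith)).2 (by linarith), ?_⟩
        have : q - 2 ≠ 0 := by linarith
        field_simp
        ring
      have h := ENNReal.lintegral_mul_le_Lp_mul_Lq (μ.restrict E) hconj
        (f := fun x => M x ^ (q - 2)) (g := fun _ => 1) hMq.aemeasurable aemeasurable_const
      have hne : q - 2 ≠ 0 := by linarith
      simp only [Pi.mul_apply, mul_one, ENNReal.one_rpow, lintegral_const, one_mul,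
        Measure.restrict_apply_univ, ← ENNReal.rpow_mul] at h
      rw [show (q - 2) * (q / (q - 2)) = q by field_simp,
        show 1 / (q / (q - 2)) = 1 - 2 / q by field_simp, show 1 / (q / 2) = 2 / q by field_simp] at h
      refine h.trans ?_
      gcongr
      · rw [sub_nonneg]; exact (div_le_one hq0).2 hq
      · exact setLIntegral_le_lintegral _ _
  have he0 : 0 ≤ 1 - 2 / q := by rw [sub_nonneg]; exact (div_le_one hq0).2 hq
  have hZr : Z ^ (1 - 2 / q) ≠ ∞ := ENNReal.rpow_ne_top_of_nonneg he0 hZtop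
  have h2q : 0 ≤ 2 / q := by positivity
  set A' : ℝ≥0 := (Z ^ (1 - 2 / q)).toNNReal * A ^ (2 / q) with hA'
  have hA'c : (A' : ℝ≥0∞) = Z ^ (1 - 2 / q) * (A : ℝ≥0∞) ^ (2 / q) := by
    rw [hA', ENNReal.coe_mul, ENNReal.coe_toNNReal hZr, ENNReal.coe_rpow_of_nonneg _ h2q]
  have hνd : IsDimensionalUpTo (2 * α / q) A' k ν := by
    refine ⟨?_, fun x j hj => ?_⟩
    · rw [hA'c]
      refine (hold _ MeasurableSet.univ).trans ?_
      gcongr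
      exact hμ.measure_univ_le
    · refine (hold _ Metric.isOpen_ball.measurableSet).trans ?_
      rw [hA'c, mul_assoc]
      gcongr
      refine (ENNReal.rpow_le_rpow (hμ.measure_ball_le x j hj) h2q).trans (le_of_eq ?_)
      rw [ENNReal.mul_rpow_of_nonneg _ _ h2q, ENNReal.ofReal_rpow_of_nonneg (by positivity) h2q,
        ← Real.rpow_mul (by positivity)]
      congr 3
      ring
  have hα1 : 2 * α / q ≤ 1 := by rw [div_le_one hq0]; linarith
  have key := lintegral_shellMax_sq_le_of_isDimensionalUpTo hm0 hm1 ha haα hα1 hg hνd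
  have hZν : ∫⁻ x, M x ^ 2 ∂ν = Z := by
    rw [hν, lintegral_withDensity_eq_lintegral_mul _ hMq (hMm.pow_const 2)]
    refine lintegral_congr fun x => ?_
    rw [Pi.mul_apply, ← ENNReal.rpow_two, ← ENNReal.rpow_add_of_nonneg _ _ (by linarith) (by norm_num)]
    congr 1
    ring
  rw [hZν, hA'c] at key
  set G := ∫⁻ ξ in Ioc ((2 : ℝ) ^ k) (2 * 2 ^ k), ‖g ξ‖ₑ ^ 2 with hG
  set T := shellConst m a (2 * α / q) * (A : ℝ≥0∞) ^ (2 / q) *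
        ENNReal.ofReal (((2 : ℝ) ^ k) ^ growth m a) * G with hT
  -- The `L²` estimate for `ν` reads `Z ≤ Z^{1-2/q} T`, because `∫ M² dν = ∫ M^q dμ = Z`.
  have h1 : Z ^ (1 - 2 / q) * Z ^ (2 / q) ≤ Z ^ (1 - 2 / q) * T := by
    rw [← ENNReal.rpow_add _ _ h0 hZtop, sub_add_cancel, ENNReal.rpow_one]
    refine key.trans (le_of_eq ?_)
    rw [hT]
    ring
  have h2 : Z ^ (2 / q) ≤ T := by
    refine (ENNReal.mul_le_mul_iff_right ?_ hZr).1 h1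
    exact (ENNReal.rpow_pos (pos_iff_ne_zero.2 h0) hZtop).ne'
  calc Z = (Z ^ (2 / q)) ^ (q / 2) := by
        rw [← ENNReal.rpow_mul, show 2 / q * (q / 2) = 1 by field_simp, ENNReal.rpow_one]
    _ ≤ T ^ (q / 2) := by gcongr

end

/-! ### Summation of the shells: convergence and continuity in time -/

section

variable {m : ℝ} {g : ℝ → ℂ}

/-- The maximal function over the two-sided dyadic shell `2ᵏ ≤ |ξ| ≤ 2ᵏ⁺¹`. -/
def twoSidedMax (m : ℝ) (g : ℝ → ℂ) (k : ℕ) (x : ℝ) : ℝ≥0∞ :=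
  shellMax m g (2 ^ k) x + shellMax m (fun ξ => g (-ξ)) (2 ^ k) (-x)

/-- The integral of `e^{i(xξ + t|ξ|^m)} g(ξ)` over `|ξ| ≤ R`. -/
def symmetricIntegral (m : ℝ) (g : ℝ → ℂ) (R x t : ℝ) : ℂ := ∫ ξ in (-R)..R, osc m x t ξ * g ξ

/-- The integral of `e^{i(xξ + t|ξ|^m)} g(ξ)` over `2ᵏ ≤ |ξ| ≤ R`. -/
def twoSidedIntegral (m : ℝ) (g : ℝ → ℂ) (k : ℕ) (x t R : ℝ) : ℂ :=
  shellIntegral m g (2 ^ k) x t R + shellIntegral m (fun ξ => g (-ξ)) (2 ^ k) (-x) t R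

/-- The sum of the shell integrals. -/
def evolutionSum (m : ℝ) (g : ℝ → ℂ) (x t : ℝ) : ℂ :=
  symmetricIntegral m g 1 x t + ∑' k : ℕ, twoSidedIntegral m g k x t (2 ^ (k + 1))

theorem memLp_comp_neg (hg : MemLp g 2) : MemLp (fun ξ => g (-ξ)) 2 :=
  hg.comp_measurePreserving (Measure.measurePreserving_neg volume)

theorem integral_symm_eq_add {h : ℝ → ℂ} (hh : ∀ a b, IntervalIntegrable h volume a b)
    (N R : ℝ) : ∫ ξ in (-R)..R, h ξ =
      (∫ ξ in (-N)..N, h ξ) + ((∫ ξ in N..R, h ξ) + ∫ ξ in N..R, h (-ξ)) := by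
  rw [intervalIntegral.integral_comp_neg,
    ← intervalIntegral.integral_add_adjacent_intervals (hh (-R) (-N)) (hh (-N) R),
    ← intervalIntegral.integral_add_adjacent_intervals (hh (-N) N) (hh N R)]
  ring

theorem symmetricIntegral_eq_add (hm : 0 < m) (hg : MemLp g 2) (k : ℕ) (x t R : ℝ) :
    symmetricIntegral m g R x t =
      symmetricIntegral m g (2 ^ k) x t + twoSidedIntegral m g k x t R := by
  rw [symmetricIntegral, integral_symm_eq_add (intervalIntegrable_osc_mul hm hg x t) (2 ^ k) R]
  simp only [osc_neg]
  rfl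

theorem enorm_twoSidedIntegral_le {k : ℕ} {x t R : ℝ} (ht : t ∈ Icc (-1 : ℝ) 1)
    (hR : R ∈ Icc ((2 : ℝ) ^ k) (2 ^ (k + 1))) :
    ‖twoSidedIntegral m g k x t R‖ₑ ≤ twoSidedMax m g k x := by
  have hR' : R ∈ Icc ((2 : ℝ) ^ k) (2 * 2 ^ k) := by rwa [← pow_succ']
  exact (enorm_add_le _ _).trans (add_le_add (enorm_shellIntegral_le_shellMax ht hR')
    (enorm_shellIntegral_le_shellMax ht hR'))

theorem two_pow_succ_mem (k : ℕ) : (2 : ℝ) ^ (k + 1) ∈ Icc ((2 : ℝ) ^ k) (2 ^ (k + 1)) :=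
  ⟨pow_le_pow_right₀ (by norm_num) (Nat.le_succ k), le_rfl⟩

theorem symmetricIntegral_two_pow (hm : 0 < m) (hg : MemLp g 2) (k : ℕ) (x t : ℝ) :
    symmetricIntegral m g (2 ^ k) x t = symmetricIntegral m g 1 x t +
      ∑ j ∈ Finset.range k, twoSidedIntegral m g j x t (2 ^ (j + 1)) := by
  induction k with
  | zero => simp
  | succ k ih =>
    rw [symmetricIntegral_eq_add hm hg k, ih, Finset.sum_range_succ, add_assoc]

theorem enorm_symmetricIntegral_le (hm : 0 < m) (hg : MemLp g 2) {x t R : ℝ}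
    (ht : t ∈ Icc (-1 : ℝ) 1) (hR : 1 ≤ R) :
    ‖symmetricIntegral m g R x t‖ₑ ≤
      (∫⁻ ξ in Ioc (-1 : ℝ) 1, ‖g ξ‖ₑ) + ∑' k, twoSidedMax m g k x := by
  obtain ⟨k, hk, hk'⟩ := exists_nat_pow_near hR (one_lt_two (α := ℝ))
  rw [symmetricIntegral_eq_add hm hg k, symmetricIntegral_two_pow hm hg, add_assoc]
  refine (enorm_add_le _ _).trans (add_le_add ?_ ?_)
  · rw [symmetricIntegral, intervalIntegral.integral_of_le (by norm_num)]
    refine (enorm_integral_le_lintegral_enorm _).trans (lintegral_mono fun ξ => ?_)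
    rw [enorm_mul, ← ofReal_norm (osc m x t ξ), norm_osc, ENNReal.ofReal_one, one_mul]
  · calc _ ≤ (∑ j ∈ Finset.range k, twoSidedMax m g j x) + twoSidedMax m g k x := by
          refine (enorm_add_le _ _).trans (add_le_add ((enorm_sum_le _ _).trans
            (Finset.sum_le_sum fun j _ => enorm_twoSidedIntegral_le ht (two_pow_succ_mem j)))
            (enorm_twoSidedIntegral_le ht ⟨hk, hk'.le⟩))
      _ = ∑ j ∈ Finset.range (k + 1), twoSidedMax m g j x := (Finset.sum_range_succ _ _).symm
      _ ≤ _ := ENNReal.sum_le_tsum _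

theorem norm_le_toReal_of_enorm_le {z : ℂ} {c : ℝ≥0∞} (hc : c ≠ ∞) (h : ‖z‖ₑ ≤ c) :
    ‖z‖ ≤ c.toReal := by
  rw [← toReal_enorm]
  exact ENNReal.toReal_mono hc h

theorem twoSidedMax_ne_top {x : ℝ} (hx : ∑' k, twoSidedMax m g k x ≠ ∞) (k : ℕ) :
    twoSidedMax m g k x ≠ ∞ := ENNReal.ne_top_of_tsum_ne_top hx k

/-- Along `R = 2ᵏ` the integrals are partial sums of an absolutely convergent series. For `2ᵏ ≤ R ≤
2ᵏ⁺¹` the error is a truncated shell integral, bounded by `twoSidedMax`, which tends to zero. -/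
theorem tendsto_symmetricIntegral (hm : 0 < m) (hg : MemLp g 2) {x t : ℝ}
    (hx : ∑' k, twoSidedMax m g k x ≠ ∞) (ht : t ∈ Icc (-1 : ℝ) 1) :
    Tendsto (fun R => symmetricIntegral m g R x t) atTop (𝓝 (evolutionSum m g x t)) := by
  have hs : Summable fun k => (twoSidedMax m g k x).toReal := ENNReal.summable_toReal hx
  have hb : ∀ k R, R ∈ Icc ((2 : ℝ) ^ k) (2 ^ (k + 1)) →
      ‖twoSidedIntegral m g k x t R‖ ≤ (twoSidedMax m g k x).toReal := fun k R hR =>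
    norm_le_toReal_of_enorm_le (twoSidedMax_ne_top hx k) (enorm_twoSidedIntegral_le ht hR)
  have hsum : Summable fun k : ℕ => twoSidedIntegral m g k x t (2 ^ (k + 1)) :=
    Summable.of_norm_bounded hs fun k => hb k _ (two_pow_succ_mem k)
  have hlim : Tendsto (fun k : ℕ => symmetricIntegral m g (2 ^ k) x t) atTop
      (𝓝 (evolutionSum m g x t)) := by
    simp_rw [symmetricIntegral_two_pow hm hg]
    exact hsum.hasSum.tendsto_sum_nat.const_add _
  rw [Metric.tendsto_atTop] at hlim ⊢
  intro ε hε
  obtain ⟨K, hK⟩ := hlim (ε / 2) (half_pos hε)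
  obtain ⟨K', hK'⟩ := Metric.tendsto_atTop.1 hs.tendsto_atTop_zero (ε / 2) (half_pos hε)
  refine ⟨2 ^ max K K', fun R hR => ?_⟩
  obtain ⟨k, hk, hk'⟩ := exists_nat_pow_near
    ((one_le_pow₀ (one_le_two (α := ℝ))).trans hR) (one_lt_two (α := ℝ))
  have hkk : max K K' ≤ k := by
    have : (2 : ℝ) ^ max K K' < 2 ^ (k + 1) := hR.trans_lt hk'
    exact Nat.lt_succ_iff.1 ((pow_lt_pow_iff_right₀ (one_lt_two (α := ℝ))).1 this)
  have h1 := hK k ((le_max_left _ _).trans hkk)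
  have h2 := hK' k ((le_max_right _ _).trans hkk)
  have h3 := hb k R ⟨hk, hk'.le⟩
  rw [Real.dist_0_eq_abs, abs_of_nonneg ENNReal.toReal_nonneg] at h2
  rw [symmetricIntegral_eq_add hm hg k]
  calc _ ≤ dist (symmetricIntegral m g (2 ^ k) x t + twoSidedIntegral m g k x t R)
        (symmetricIntegral m g (2 ^ k) x t) +
        dist (symmetricIntegral m g (2 ^ k) x t) (evolutionSum m g x t) := dist_triangle _ _ _
    _ < ε / 2 + ε / 2 := by
        rw [dist_self_add_left]
        exact add_lt_add (h3.trans_lt h2) h1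
    _ = ε := add_halves ε

/-- Weierstrass' test, with the shell maxima as majorants independent of `t`. -/
theorem continuousOn_evolutionSum (hm : 0 < m) (hg : MemLp g 2) {x : ℝ}
    (hx : ∑' k, twoSidedMax m g k x ≠ ∞) :
    ContinuousOn (evolutionSum m g x) (Icc (-1) 1) := by
  refine ContinuousOn.add ?_ ?_
  · exact (continuous_shellIntegral_time hm hg (-1) x 1).continuousOn
  · refine continuousOn_tsum (u := fun k => (twoSidedMax m g k x).toReal) (fun k => ?_)
      (ENNReal.summable_toReal hx) fun k t ht => ?_
    · exact ((continuous_shellIntegral_time hm hg _ x _).add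
        (continuous_shellIntegral_time hm (memLp_comp_neg hg) _ (-x) _)).continuousOn
    · exact norm_le_toReal_of_enorm_le (twoSidedMax_ne_top hx k)
        (enorm_twoSidedIntegral_le ht (two_pow_succ_mem k))

end

/-! ### The angular Fourier transform and the pointwise bound of the maximal function -/

theorem stronglyMeasurable_fhat (f : Lp ℂ 2 (volume : Measure ℝ)) : StronglyMeasurable (fhat f) :=
  (Lp.stronglyMeasurable _).comp_measurable (measurable_id.div_const _)

theorem lintegral_comp_div_two_pi (φ : ℝ → ℝ≥0∞) :
    ∫⁻ ξ, φ (ξ / (2 * Real.pi)) = ENNReal.ofReal (2 * Real.pi) * ∫⁻ ξ, φ ξ := by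
  have hpi : 2 * Real.pi ≠ 0 := by positivity
  have h : Measure.map (· * (2 * Real.pi)⁻¹) (volume : Measure ℝ) =
      ENNReal.ofReal (2 * Real.pi) • volume := by
    rw [Real.map_volume_mul_right (inv_ne_zero hpi), inv_inv, abs_of_pos (by positivity)]
  rw [← smul_eq_mul (ENNReal.ofReal _), ← lintegral_smul_measure, ← h,
    (measurableEmbedding_mulRight₀ (inv_ne_zero hpi)).lintegral_map]
  simp only [div_eq_mul_inv]

theorem memLp_fhat (f : Lp ℂ 2 (volume : Measure ℝ)) : MemLp (fhat f) 2 := by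
  refine ⟨(stronglyMeasurable_fhat f).aestronglyMeasurable, ?_⟩
  have h := (Lp.memLp (𝓕 f : Lp ℂ 2 (volume : Measure ℝ))).2
  rw [eLpNorm_lt_top_iff_lintegral_rpow_enorm_lt_top (by norm_num) (by norm_num)] at h ⊢
  have := lintegral_comp_div_two_pi
    fun ξ => ‖(𝓕 f : Lp ℂ 2 (volume : Measure ℝ)) ξ‖ₑ ^ (2 : ℝ≥0∞).toReal
  unfold fhat
  rw [this]
  exact ENNReal.mul_lt_top ENNReal.ofReal_lt_top h

theorem truncatedEvolution_eq (m : ℝ) (f : Lp ℂ 2 (volume : Measure ℝ)) (R x t : ℝ) :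
    truncatedEvolution m f R x t =
      (2 * Real.pi : ℂ)⁻¹ * symmetricIntegral m (fhat f) R x t := rfl

theorem hasEvolutionValue_of_tsum_ne_top {m : ℝ} (hm : 0 < m) (f : Lp ℂ 2 (volume : Measure ℝ))
    {x t : ℝ} (hx : ∑' k, twoSidedMax m (fhat f) k x ≠ ∞) (ht : t ∈ Icc (-1 : ℝ) 1) :
    HasEvolutionValue m f x t ((2 * Real.pi : ℂ)⁻¹ * evolutionSum m (fhat f) x t) :=
  (tendsto_symmetricIntegral hm (memLp_fhat f) hx ht).const_mul _

theorem maximalFunction_le {m : ℝ} (hm : 0 < m) (f : Lp ℂ 2 (volume : Measure ℝ)) (x : ℝ) :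
    maximalFunction m f x ≤
      (∫⁻ ξ in Ioc (-1 : ℝ) 1, ‖fhat f ξ‖ₑ) + ∑' k, twoSidedMax m (fhat f) k x := by
  refine iSup₂_le fun t ht => ?_
  refine limsup_le_of_le (by isBoundedDefault) ?_
  filter_upwards [eventually_ge_atTop 1] with R hR
  rw [truncatedEvolution_eq, enorm_mul]
  have h1 : ‖(2 * Real.pi : ℂ)⁻¹‖ₑ ≤ 1 := by
    rw [← ofReal_norm, ENNReal.ofReal_le_one, norm_inv]
    refine inv_le_one_of_one_le₀ ?_
    rw [norm_mul, Complex.norm_real, Real.norm_of_nonneg Real.pi_pos.le]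
    have := Real.pi_gt_three
    norm_num
    linarith
  refine (mul_le_of_le_one_left zero_le h1).trans ?_
  exact enorm_symmetricIntegral_le hm (memLp_fhat f) ⟨by linarith [ht.1], ht.2.le⟩ hR

/-! ### Interval means as Fourier integrals with the multiplier `sinc(rξ)` -/

theorem sinc_mul_sq_le (u : ℝ) : Real.sinc u ^ 2 ≤ 2 * (1 + u ^ 2)⁻¹ := by
  rw [← div_eq_mul_inv, le_div_iff₀ (by positivity)]
  have h1 : Real.sinc u ^ 2 ≤ 1 := by
    rw [← sq_abs]; exact pow_le_one₀ (abs_nonneg _) (Real.abs_sinc_le_one u)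
  have h2 : Real.sinc u ^ 2 * u ^ 2 ≤ 1 := by
    rcases eq_or_ne u 0 with rfl | hu
    · simp
    · rw [Real.sinc_of_ne_zero hu, div_pow, div_mul_cancel₀ _ (pow_ne_zero 2 hu)]
      exact Real.sin_sq_le_one u
  linarith

theorem memLp_sinc_mul {r : ℝ} (hr : 0 < r) : MemLp (fun ξ => Real.sinc (r * ξ)) 2 := by
  have hc : Continuous fun ξ => Real.sinc (r * ξ) := Real.continuous_sinc.comp (by fun_prop)
  rw [memLp_two_iff_integrable_sq hc.aestronglyMeasurable]
  refine Integrable.mono' (((integrable_inv_one_add_sq.comp_mul_left' hr.ne')).const_mul 2)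
    (hc.pow 2).aestronglyMeasurable (Eventually.of_forall fun ξ => ?_)
  rw [Real.norm_of_nonneg (by positivity)]
  exact sinc_mul_sq_le _

theorem integral_cexp_eq_sinc (x r η : ℝ) :
    ∫ y in (x - r)..(x + r), Complex.exp (2 * Real.pi * Complex.I * η * y) =
      (2 * r * Real.sinc (r * (2 * Real.pi * η)) : ℝ) *
        Complex.exp (Complex.I * ((x * (2 * Real.pi * η) : ℝ) : ℂ)) := by
  rcases eq_or_ne (r * (2 * Real.pi * η)) 0 with h | h
  · have hpi : 2 * Real.pi ≠ 0 := by positivity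
    rcases mul_eq_zero.1 h with hr | hη
    · simp [hr]
    · have : η = 0 := (mul_eq_zero.1 hη).resolve_left hpi
      subst this
      simp only [Complex.ofReal_zero, mul_zero, zero_mul, Complex.exp_zero, Real.sinc_zero,
        mul_one, intervalIntegral.integral_const]
      rw [Complex.real_smul, mul_one]
      congr 1
      ring
  · have hr : r ≠ 0 := left_ne_zero_of_mul h
    have hη : 2 * Real.pi * η ≠ 0 := right_ne_zero_of_mul h
    have hc : (2 * Real.pi * Complex.I * η : ℂ) ≠ 0 := by
      have : ((2 * Real.pi * η : ℝ) : ℂ) ≠ 0 := Complex.ofReal_ne_zero.2 hη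
      push_cast at this
      have h2 := mul_ne_zero this Complex.I_ne_zero
      convert h2 using 1
      ring
    rw [integral_exp_mul_complex hc, Real.sinc_of_ne_zero h, div_eq_iff hc]
    set θ : ℝ := 2 * Real.pi * η with hθ
    have e1 : (2 * Real.pi * Complex.I * η : ℂ) = (θ : ℂ) * Complex.I := by
      rw [hθ]; push_cast; ring
    have hθ' : (θ : ℂ) ≠ 0 := Complex.ofReal_ne_zero.2 hη
    have hr' : (r : ℂ) ≠ 0 := Complex.ofReal_ne_zero.2 hr
    rw [e1]
    push_cast
    rw [show (θ : ℂ) * Complex.I * (x + r) = Complex.I * (x * θ) + (r * θ) * Complex.I by ring,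
      show (θ : ℂ) * Complex.I * (x - r) = Complex.I * (x * θ) + -(r * θ) * Complex.I by ring,
      Complex.exp_add, Complex.exp_add, Complex.sin]
    field_simp
    rw [Complex.I_sq]
    ring

theorem intervalIntegral_integral_cexp_mul {ψ : ℝ → ℂ} (hψ : Integrable ψ) (x : ℝ) {r : ℝ}
    (hr : 0 < r) :
    ∫ y in (x - r)..(x + r), ∫ η : ℝ, Complex.exp (2 * Real.pi * Complex.I * η * y) * ψ η =
      ∫ η, (2 * r * Real.sinc (r * (2 * Real.pi * η)) : ℝ) *
        Complex.exp (Complex.I * ((x * (2 * Real.pi * η) : ℝ) : ℂ)) * ψ η := by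
  have hle : x - r ≤ x + r := by linarith
  rw [intervalIntegral.integral_of_le hle]
  rw [integral_integral_swap]
  · refine integral_congr_ae (Eventually.of_forall fun η => ?_)
    simp only
    rw [integral_mul_const, ← intervalIntegral.integral_of_le hle, integral_cexp_eq_sinc]
  · have : IsFiniteMeasure (volume.restrict (Ioc (x - r) (x + r))) := ⟨by simp⟩
    refine Integrable.mono' (hψ.norm.comp_snd (volume.restrict (Ioc (x - r) (x + r)))) ?_
      (Eventually.of_forall fun p => ?_)
    · have h1 : Continuous fun p : ℝ × ℝ =>
          Complex.exp (2 * Real.pi * Complex.I * p.2 * p.1) := by fun_prop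
      exact h1.aestronglyMeasurable.mul hψ.aestronglyMeasurable.comp_snd
    · simp only [Function.uncurry]
      rw [norm_mul, show (2 * Real.pi * Complex.I * p.2 * p.1 : ℂ) =
        ((2 * Real.pi * p.2 * p.1 : ℝ) : ℂ) * Complex.I by push_cast; ring,
        Complex.norm_exp_ofReal_mul_I, one_mul]

theorem eq_integral_cexp_mul_fourier (φ : 𝓢(ℝ, ℂ)) (y : ℝ) :
    φ y = ∫ η : ℝ, Complex.exp (2 * Real.pi * Complex.I * η * y) * (𝓕 φ : 𝓢(ℝ, ℂ)) η := by
  have h : φ y = (𝓕⁻ (𝓕 φ : 𝓢(ℝ, ℂ)) : 𝓢(ℝ, ℂ)) y := by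
    rw [FourierTransform.fourierInv_fourier_eq]
  rw [h, SchwartzMap.fourierInv_coe, Real.fourierInv_eq']
  refine integral_congr_ae (Eventually.of_forall fun η => ?_)
  simp only [smul_eq_mul]
  congr 2
  simp
  ring

theorem integral_toLp_eq_integral_sinc_mul_fourier (φ : 𝓢(ℝ, ℂ)) (x : ℝ) {r : ℝ} (hr : 0 < r) :
    ∫ y in (x - r)..(x + r), (φ.toLp 2 : ℝ → ℂ) y =
      ∫ η, (2 * r * Real.sinc (r * (2 * Real.pi * η)) : ℝ) *
        Complex.exp (Complex.I * ((x * (2 * Real.pi * η) : ℝ) : ℂ)) *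
          (𝓕 (φ.toLp 2) : Lp ℂ 2 (volume : Measure ℝ)) η := by
  have hle : x - r ≤ x + r := by linarith
  have h1 : ∫ y in (x - r)..(x + r), (φ.toLp 2 : ℝ → ℂ) y = ∫ y in (x - r)..(x + r), φ y := by
    rw [intervalIntegral.integral_of_le hle, intervalIntegral.integral_of_le hle]
    exact integral_congr_ae (ae_restrict_of_ae (φ.coeFn_toLp 2 volume))
  rw [h1, SchwartzMap.toLp_fourier_eq]
  simp_rw [eq_integral_cexp_mul_fourier φ]
  rw [intervalIntegral_integral_cexp_mul ((𝓕 φ : 𝓢(ℝ, ℂ)).integrable (μ := volume)) x hr]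
  refine integral_congr_ae ?_
  filter_upwards [(𝓕 φ : 𝓢(ℝ, ℂ)).coeFn_toLp 2] with η hη
  rw [hη]

/-- The mean of `f ∈ L²(ℝ)` over an interval in terms of its Fourier transform. -/
theorem integral_eq_integral_sinc_mul_fourier (f : Lp ℂ 2 (volume : Measure ℝ)) (x : ℝ) {r : ℝ}
    (hr : 0 < r) :
    ∫ y in (x - r)..(x + r), f y = ∫ η, (2 * r * Real.sinc (r * (2 * Real.pi * η)) : ℝ) *
        Complex.exp (Complex.I * ((x * (2 * Real.pi * η) : ℝ) : ℂ)) *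
          (𝓕 f : Lp ℂ 2 (volume : Measure ℝ)) η := by
  have hpi := Real.pi_pos
  set κ : ℝ → ℂ := fun η => (2 * r * Real.sinc (r * (2 * Real.pi * η)) : ℝ) *
        Complex.exp (Complex.I * ((x * (2 * Real.pi * η) : ℝ) : ℂ)) with hκ
  have hκc : Continuous κ := by
    have := Real.continuous_sinc
    simp only [hκ]
    fun_prop
  have hκ2 : MemLp (fun η => (starRingEnd ℂ) (κ η)) 2 := by
    refine MemLp.of_le (((memLp_sinc_mul (r := r * (2 * Real.pi)) (by positivity))).const_mul
      (2 * r)) (RCLike.continuous_conj.comp hκc).aestronglyMeasurable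
      (Eventually.of_forall fun η => ?_)
    rw [RCLike.norm_conj, norm_mul, mul_comm Complex.I, Complex.norm_exp_ofReal_mul_I, mul_one,
      Complex.norm_real, mul_assoc r]
  set K : Lp ℂ 2 (volume : Measure ℝ) := hκ2.toLp _ with hK
  have hle : x - r ≤ x + r := by linarith
  have hvol : volume (Ioc (x - r) (x + r)) ≠ ∞ := by simp
  have hL : ∀ f : Lp ℂ 2 (volume : Measure ℝ), ∫ y in (x - r)..(x + r), f y =
      inner ℂ (indicatorConstLp 2 measurableSet_Ioc hvol (1 : ℂ)) f := fun f => by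
    rw [L2.inner_indicatorConstLp_one, intervalIntegral.integral_of_le hle]
  have hR : ∀ f : Lp ℂ 2 (volume : Measure ℝ),
      ∫ η, κ η * (𝓕 f : Lp ℂ 2 (volume : Measure ℝ)) η = inner ℂ K (𝓕 f) := fun f => by
    rw [L2.inner_def]
    refine integral_congr_ae ?_
    filter_upwards [hκ2.coeFn_toLp] with η hη
    rw [hK, hη, RCLike.inner_apply, Complex.conj_conj, mul_comm]
  rw [hL, hR]
  -- Both sides are continuous functionals of `f ∈ L²`, inner products with an indicator and with
  -- the `sinc` kernel, so the Schwartz case suffices.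
  have hcl : IsClosed {f : Lp ℂ 2 (volume : Measure ℝ) |
      inner ℂ (indicatorConstLp 2 measurableSet_Ioc hvol (1 : ℂ)) f =
        inner ℂ K (Lp.fourierTransformₗᵢ ℝ ℂ f)} :=
    isClosed_eq (continuous_const.inner continuous_id)
      (continuous_const.inner (Lp.fourierTransformₗᵢ ℝ ℂ).continuous)
  refine isClosed_property (SchwartzMap.denseRange_toLpCLM (F := ℂ) (E := ℝ)
    (μ := volume) (p := 2) ENNReal.ofNat_ne_top) hcl ?_ f
  intro φ
  rw [SchwartzMap.toLpCLM_apply]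
  exact (hL _).symm.trans ((integral_toLp_eq_integral_sinc_mul_fourier φ x hr).trans (hR _))

theorem mean_eq_integral_sinc_mul_fhat (m : ℝ) (f : Lp ℂ 2 (volume : Measure ℝ)) (x : ℝ) {r : ℝ}
    (hr : 0 < r) :
    ((2 * r : ℝ) : ℂ)⁻¹ * ∫ y in (x - r)..(x + r), f y =
      (2 * Real.pi : ℂ)⁻¹ * ∫ ξ, (Real.sinc (r * ξ) : ℂ) * (osc m x 0 ξ * fhat f ξ) := by
  have hpi : 2 * Real.pi ≠ 0 := by positivity
  have h := integral_eq_integral_sinc_mul_fourier f x hr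
  have h2 := Measure.integral_comp_div (fun η : ℝ =>
    (2 * r * Real.sinc (r * (2 * Real.pi * η)) : ℝ) *
        Complex.exp (Complex.I * ((x * (2 * Real.pi * η) : ℝ) : ℂ)) *
          (𝓕 f : Lp ℂ 2 (volume : Measure ℝ)) η) (2 * Real.pi)
  rw [← h, abs_of_pos (by positivity), Complex.real_smul] at h2
  have hr' : (r : ℂ) ≠ 0 := Complex.ofReal_ne_zero.2 hr.ne'
  have hpi' : (Real.pi : ℂ) ≠ 0 := Complex.ofReal_ne_zero.2 Real.pi_ne_zero
  have h3 : ∫ ξ, (Real.sinc (r * ξ) : ℂ) * (osc m x 0 ξ * fhat f ξ) =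
      ((2 * r : ℝ) : ℂ)⁻¹ * (((2 * Real.pi : ℝ) : ℂ) * ∫ y in (x - r)..(x + r), f y) := by
    rw [← h2, ← integral_const_mul]
    refine integral_congr_ae (Eventually.of_forall fun ξ => ?_)
    simp only [osc, fhat, mul_div_cancel₀ _ hpi, zero_mul, add_zero]
    push_cast
    field_simp
  rw [h3]
  push_cast
  field_simp

theorem integrable_sinc_mul {r : ℝ} (hr : 0 < r) {h : ℝ → ℂ} (hh : MemLp h 2) :
    Integrable fun ξ => (Real.sinc (r * ξ) : ℂ) * h ξ :=
  (memLp_sinc_mul hr).ofReal.integrable_mul hh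

/-- Integration by parts against a primitive of an integrable function. -/
theorem integral_mul_eq_sub_integral_deriv_mul_primitive {h : ℝ → ℂ} {w w' : ℝ → ℝ} {a b : ℝ}
    (hab : a ≤ b) (hh : IntervalIntegrable h volume a b)
    (hw : ∀ ξ ∈ Icc a b, HasDerivAt w (w' ξ) ξ) (hw' : ContinuousOn w' (Icc a b)) :
    ∫ ξ in a..b, (w ξ : ℂ) * h ξ =
      w b * (∫ ξ in a..b, h ξ) - ∫ y in a..b, (w' y : ℂ) * ∫ ξ in a..y, h ξ := by
  have hwc : ContinuousOn w (Icc a b) := fun ξ hξ => (hw ξ hξ).continuousAt.continuousWithinAt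
  have hu : uIcc a b = Icc a b := uIcc_of_le hab
  have hi : IntervalIntegrable (fun ξ => (w ξ : ℂ) * h ξ) volume a b :=
    hh.continuousOn_mul (Complex.continuous_ofReal.comp_continuousOn (hu ▸ hwc))
  have hw'i : IntervalIntegrable w' volume a b := (hu ▸ hw' : ContinuousOn w' (uIcc a b)).intervalIntegrable
  have hio : Integrable h (volume.restrict (Ioc a b)) := (intervalIntegrable_iff_integrableOn_Ioc_of_le hab).1 hh
  have hw'o : Integrable (fun y => (w' y : ℂ)) (volume.restrict (Ioc a b)) :=
    ((intervalIntegrable_iff_integrableOn_Ioc_of_le hab).1 hw'i).ofReal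
  -- `h` is merely integrable, so its primitive need not be differentiable everywhere; Fubini on the
  -- triangle `ξ < y` replaces the product rule.
  have key : ∫ ξ in Ioc a b, ∫ y in Ioc a b, (Ioi ξ).indicator (fun y => (w' y : ℂ)) y * h ξ =
      ∫ y in Ioc a b, ∫ ξ in Ioc a b, (Ioi ξ).indicator (fun y => (w' y : ℂ)) y * h ξ := by
    refine integral_integral_swap ?_
    have h1 : Integrable (fun p : ℝ × ℝ => h p.1 * (w' p.2 : ℂ))
        ((volume.restrict (Ioc a b)).prod (volume.restrict (Ioc a b))) := hio.mul_prod hw'o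
    have h2 : MeasurableSet {p : ℝ × ℝ | p.1 < p.2} :=
      measurableSet_lt measurable_fst measurable_snd
    refine (h1.indicator h2).congr (Eventually.of_forall fun p => ?_)
    simp only [Function.uncurry, indicator_apply, mem_Ioi, mem_ofPred_eq]
    split_ifs <;> ring
  have hL : ∀ ξ ∈ Ioc a b, ∫ y in Ioc a b, (Ioi ξ).indicator (fun y => (w' y : ℂ)) y * h ξ =
      ((w b - w ξ : ℝ) : ℂ) * h ξ := by
    intro ξ hξ
    have hsub : Icc ξ b ⊆ Icc a b := Icc_subset_Icc_left hξ.1.le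
    rw [integral_mul_const, setIntegral_indicator measurableSet_Ioi, Ioc_inter_Ioi,
      max_eq_right hξ.1.le, ← intervalIntegral.integral_of_le hξ.2,
      intervalIntegral.integral_ofReal]
    rw [intervalIntegral.integral_eq_sub_of_hasDerivAt (f := w)]
    · intro y hy
      rw [uIcc_of_le hξ.2] at hy
      exact hw y (hsub hy)
    · exact (hw'i.mono_set (by rw [hu, uIcc_of_le hξ.2]; exact hsub))
  have hR : ∀ y ∈ Ioc a b, ∫ ξ in Ioc a b, (Ioi ξ).indicator (fun y => (w' y : ℂ)) y * h ξ =
      (w' y : ℂ) * ∫ ξ in a..y, h ξ := by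
    intro y hy
    have : ∀ ξ, (Ioi ξ).indicator (fun y => (w' y : ℂ)) y * h ξ =
        (w' y : ℂ) * (Iio y).indicator h ξ := fun ξ => by
      simp only [indicator_apply, mem_Ioi, mem_Iio]
      split_ifs <;> ring
    simp_rw [this]
    rw [integral_const_mul, setIntegral_indicator measurableSet_Iio,
      intervalIntegral.integral_of_le hy.1.le, integral_Ioc_eq_integral_Ioo (y := y)]
    congr 2
    congr 1
    ext ξ
    simp only [mem_inter_iff, mem_Ioc, mem_Iio, mem_Ioo]
    exact ⟨fun ⟨⟨h1, _⟩, h3⟩ => ⟨h1, h3⟩, fun ⟨h1, h3⟩ => ⟨⟨h1, h3.le.trans hy.2⟩, h3⟩⟩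
  rw [setIntegral_congr_fun measurableSet_Ioc hL, setIntegral_congr_fun measurableSet_Ioc hR,
    ← intervalIntegral.integral_of_le hab, ← intervalIntegral.integral_of_le hab] at key
  rw [← key]
  have : ∀ ξ, ((w b - w ξ : ℝ) : ℂ) * h ξ = (w b : ℂ) * h ξ - (w ξ : ℂ) * h ξ := fun ξ => by
    push_cast; ring
  simp_rw [this]
  rw [intervalIntegral.integral_sub (hh.const_mul _) hi, intervalIntegral.integral_const_mul]
  ring

/-- The derivative of `sinc(rξ)` is at most `2/ξ` for every `r`, so its variation over a shell is at
most `2`. Integration by parts against the partial integrals of `h` gives `1 + 2`, uniformly in `r`.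
-/
theorem norm_integral_sinc_mul_le {h : ℝ → ℂ} {N r c : ℝ} (hN : 0 < N) (hr : 0 < r)
    (hh : IntervalIntegrable h volume N (2 * N))
    (hc : ∀ R ∈ Icc N (2 * N), ‖∫ ξ in N..R, h ξ‖ ≤ c) :
    ‖∫ ξ in N..(2 * N), (Real.sinc (r * ξ) : ℂ) * h ξ‖ ≤ 3 * c := by
  have hab : N ≤ 2 * N := by linarith
  have hpos : ∀ ξ ∈ Icc N (2 * N), 0 < ξ := fun ξ hξ => hN.trans_le hξ.1
  have hc0 : 0 ≤ c := (norm_nonneg _).trans (hc N ⟨le_rfl, hab⟩)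
  have hsinc : ∀ ξ, 0 < ξ → Real.sinc (r * ξ) = Real.sin (r * ξ) / (r * ξ) := fun ξ hξ =>
    Real.sinc_of_ne_zero (by positivity)
  have hw : ∀ ξ ∈ Icc N (2 * N), HasDerivAt (fun ξ => Real.sinc (r * ξ))
      (Real.cos (r * ξ) / ξ - Real.sin (r * ξ) / (r * ξ) / ξ) ξ := fun ξ hξ => by
    have hξ0 := hpos ξ hξ
    have h1 : HasDerivAt (fun ξ => r * ξ) r ξ := by simpa using (hasDerivAt_id ξ).const_mul r
    have h2 := (h1.sin).div h1 (by positivity)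
    refine (h2.congr_deriv ?_).congr_of_eventuallyEq ?_
    · field_simp
    · filter_upwards [lt_mem_nhds hξ0] with y hy
      exact hsinc y hy
  have hw' : ContinuousOn (fun ξ => Real.cos (r * ξ) / ξ - Real.sin (r * ξ) / (r * ξ) / ξ)
      (Icc N (2 * N)) := by
    refine ContinuousOn.sub (ContinuousOn.div (by fun_prop) continuousOn_id fun ξ hξ => ?_)
      (ContinuousOn.div (ContinuousOn.div (by fun_prop) (by fun_prop) fun ξ hξ => ?_)
        continuousOn_id fun ξ hξ => ?_)
    · exact (hpos ξ hξ).ne'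
    · exact (mul_pos hr (hpos ξ hξ)).ne'
    · exact (hpos ξ hξ).ne'
  rw [integral_mul_eq_sub_integral_deriv_mul_primitive hab hh hw hw']
  refine (norm_sub_le _ _).trans ?_
  have b1 : ‖(Real.sinc (r * (2 * N)) : ℂ) * ∫ ξ in N..(2 * N), h ξ‖ ≤ c := by
    rw [norm_mul, Complex.norm_real]
    exact (mul_le_of_le_one_left (norm_nonneg _) (Real.abs_sinc_le_one _)).trans
      (hc _ ⟨hab, le_rfl⟩)
  have b2 := intervalIntegral.norm_integral_le_of_norm_le_const (a := N) (b := 2 * N)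
    (C := 2 / N * c) (f := fun y => ((Real.cos (r * y) / y - Real.sin (r * y) / (r * y) / y : ℝ) : ℂ) *
      ∫ ξ in N..y, h ξ) fun y hy => by
    rw [uIoc_of_le hab] at hy
    have hy' := Ioc_subset_Icc_self hy
    have hy0 := hpos y hy'
    rw [norm_mul, Complex.norm_real]
    refine mul_le_mul ?_ (hc y hy') (norm_nonneg _) (by positivity)
    rw [← hsinc y hy0]
    calc ‖Real.cos (r * y) / y - Real.sinc (r * y) / y‖ ≤ ‖Real.cos (r * y) / y‖ + ‖Real.sinc (r * y) / y‖ :=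
          norm_sub_le _ _
      _ ≤ 1 / N + 1 / N := by
          rw [norm_div, norm_div, Real.norm_of_nonneg hy0.le]
          gcongr
          · exact Real.abs_cos_le_one _
          · exact hy'.1
          · exact Real.abs_sinc_le_one _
          · exact hy'.1
      _ = 2 / N := by ring
  have b3 : 2 / N * c * |2 * N - N| = 2 * c := by
    rw [show 2 * N - N = N by ring, abs_of_pos hN]
    field_simp
  rw [b3] at b2
  linarith

section

variable {m : ℝ} {g : ℝ → ℂ}

theorem tendsto_intervalIntegral_sinc_mul {h : ℝ → ℂ} {a b : ℝ}
    (hh : IntervalIntegrable h volume a b) :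
    Tendsto (fun r => ∫ ξ in a..b, (Real.sinc (r * ξ) : ℂ) * h ξ) (𝓝[>] (0 : ℝ))
      (𝓝 (∫ ξ in a..b, h ξ)) := by
  have hc : Continuous fun r : ℝ => ∫ ξ in a..b, (Real.sinc (r * ξ) : ℂ) * h ξ := by
    refine intervalIntegral.continuous_of_dominated_interval (bound := fun ξ => ‖h ξ‖)
      (fun r => ?_) ?_ hh.norm ?_
    · have h1 : Continuous fun ξ : ℝ => (Real.sinc (r * ξ) : ℂ) :=
        Complex.continuous_ofReal.comp (Real.continuous_sinc.comp (by fun_prop))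
      exact (intervalIntegrable_iff.1 (hh.continuousOn_mul h1.continuousOn)).aestronglyMeasurable
    · refine fun r => Eventually.of_forall fun ξ _ => ?_
      rw [norm_mul, Complex.norm_real]
      exact mul_le_of_le_one_left (norm_nonneg _) (Real.abs_sinc_le_one _)
    · refine Eventually.of_forall fun ξ _ => ?_
      exact (Complex.continuous_ofReal.comp (Real.continuous_sinc.comp (by fun_prop))).mul
        continuous_const
  have := (hc.tendsto 0).mono_left (nhdsWithin_le_nhds (s := Ioi (0 : ℝ)))
  simpa using this

/-- The smoothed Fourier integrals converge to the sum of the shell integrals. -/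
theorem tendsto_integral_sinc_mul (hm : 0 < m) (hg : MemLp g 2) {x : ℝ}
    (hx : ∑' k, twoSidedMax m g k x ≠ ∞) :
    Tendsto (fun r => ∫ ξ, (Real.sinc (r * ξ) : ℂ) * (osc m x 0 ξ * g ξ)) (𝓝[>] (0 : ℝ))
      (𝓝 (evolutionSum m g x 0)) := by
  have hgn := memLp_comp_neg hg
  have h0 : (0 : ℝ) ∈ Icc (-1 : ℝ) 1 := by norm_num
  set β : ℝ → ℕ → ℂ := fun r k =>
    (∫ ξ in (2 : ℝ) ^ k..2 ^ (k + 1), (Real.sinc (r * ξ) : ℂ) * (osc m x 0 ξ * g ξ)) +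
    ∫ ξ in (2 : ℝ) ^ k..2 ^ (k + 1), (Real.sinc (r * ξ) : ℂ) * (osc m (-x) 0 ξ * g (-ξ)) with hβ
  have hmax : ∀ (g : ℝ → ℂ) (x : ℝ) (k : ℕ) (r : ℝ), MemLp g 2 → 0 < r →
      ‖∫ ξ in (2 : ℝ) ^ k..2 ^ (k + 1), (Real.sinc (r * ξ) : ℂ) * (osc m x 0 ξ * g ξ)‖ ≤
        3 * (shellMax m g (2 ^ k) x).toReal := fun g x k r hg hr => by
    rw [pow_succ']
    exact norm_integral_sinc_mul_le (by positivity) hr (intervalIntegrable_osc_mul hm hg _ _ _ _)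
      fun R hR => norm_le_toReal_of_enorm_le (shellMax_lt_top hg _ _).ne
        (enorm_shellIntegral_le_shellMax h0 hR)
  have hbound : ∀ r, 0 < r → ∀ k, ‖β r k‖ ≤ 3 * (twoSidedMax m g k x).toReal := fun r hr k => by
    rw [twoSidedMax, ENNReal.toReal_add (shellMax_lt_top hg _ _).ne (shellMax_lt_top hgn _ _).ne,
      mul_add]
    exact (norm_add_le _ _).trans (add_le_add (hmax g x k r hg hr) (hmax _ (-x) k r hgn hr))
  have hs : Summable fun k => 3 * (twoSidedMax m g k x).toReal :=
    (ENNReal.summable_toReal hx).mul_left 3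
  have hsplit : ∀ r, 0 < r → ∫ ξ, (Real.sinc (r * ξ) : ℂ) * (osc m x 0 ξ * g ξ) =
      (∫ ξ in (-1 : ℝ)..1, (Real.sinc (r * ξ) : ℂ) * (osc m x 0 ξ * g ξ)) + ∑' k, β r k := by
    intro r hr
    have hosc : MemLp (fun ξ => osc m x 0 ξ * g ξ) 2 := by
      refine MemLp.of_le hg ((continuous_osc_right hm x 0).aestronglyMeasurable.mul
        hg.aestronglyMeasurable) (Eventually.of_forall fun ξ => ?_)
      rw [norm_mul, norm_osc, one_mul]
    have hint := integrable_sinc_mul hr hosc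
    have hii : ∀ a b, IntervalIntegrable
        (fun ξ => (Real.sinc (r * ξ) : ℂ) * (osc m x 0 ξ * g ξ)) volume a b := fun a b =>
      hint.intervalIntegrable
    have hpart : ∀ k : ℕ, ∫ ξ in (-(2 : ℝ) ^ k)..2 ^ k,
        (Real.sinc (r * ξ) : ℂ) * (osc m x 0 ξ * g ξ) =
        (∫ ξ in (-1 : ℝ)..1, (Real.sinc (r * ξ) : ℂ) * (osc m x 0 ξ * g ξ)) +
          ∑ j ∈ Finset.range k, β r j := fun k => by
      induction k with
      | zero => simp
      | succ k ih =>
        rw [integral_symm_eq_add hii (2 ^ k), ih, Finset.sum_range_succ, add_assoc]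
        simp only [hβ, osc_neg, mul_neg, Real.sinc_neg]
    have hp : Tendsto (fun k : ℕ => (2 : ℝ) ^ k) atTop atTop :=
      tendsto_pow_atTop_atTop_of_one_lt one_lt_two
    have l1 := intervalIntegral_tendsto_integral hint (tendsto_neg_atTop_atBot.comp hp) hp
    have l2 : Tendsto (fun k : ℕ => (∫ ξ in (-1 : ℝ)..1, (Real.sinc (r * ξ) : ℂ) *
        (osc m x 0 ξ * g ξ)) + ∑ j ∈ Finset.range k, β r j) atTop (𝓝 ((∫ ξ in (-1 : ℝ)..1,
        (Real.sinc (r * ξ) : ℂ) * (osc m x 0 ξ * g ξ)) + ∑' k, β r k)) :=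
      (Summable.of_norm_bounded hs (hbound r hr)).hasSum.tendsto_sum_nat.const_add _
    exact tendsto_nhds_unique l1 (l2.congr fun k => (hpart k).symm)
  have hlim : Tendsto (fun r => (∫ ξ in (-1 : ℝ)..1, (Real.sinc (r * ξ) : ℂ) *
      (osc m x 0 ξ * g ξ)) + ∑' k, β r k) (𝓝[>] (0 : ℝ)) (𝓝 (evolutionSum m g x 0)) := by
    refine Tendsto.add (tendsto_intervalIntegral_sinc_mul
      (intervalIntegrable_osc_mul hm hg x 0 _ _)) ?_
    -- The majorant `3 twoSidedMax` does not depend on `r`, so the limit `r → 0` may be taken shell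
    -- by shell.
    refine tendsto_tsum_of_dominated_convergence hs (fun k => ?_) ?_
    · exact (tendsto_intervalIntegral_sinc_mul (intervalIntegrable_osc_mul hm hg x 0 _ _)).add
        (tendsto_intervalIntegral_sinc_mul (intervalIntegrable_osc_mul hm hgn (-x) 0 _ _))
    · filter_upwards [self_mem_nhdsWithin] with r hr
      exact hbound r hr
  refine hlim.congr' ?_
  filter_upwards [self_mem_nhdsWithin] with r hr
  exact (hsplit r hr).symm

end

theorem hasPreciseValue_of_tsum_ne_top {m : ℝ} (hm : 0 < m) (f : Lp ℂ 2 (volume : Measure ℝ))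
    {x : ℝ} (hx : ∑' k, twoSidedMax m (fhat f) k x ≠ ∞) :
    HasPreciseValue f x ((2 * Real.pi : ℂ)⁻¹ * evolutionSum m (fhat f) x 0) := by
  refine ((tendsto_integral_sinc_mul hm (memLp_fhat f) hx).const_mul _).congr' ?_
  filter_upwards [self_mem_nhdsWithin] with r hr
  exact (mean_eq_integral_sinc_mul_fhat m f x hr).symm

/-- Pointwise convergence at the points at which the sum of the maximal functions over the dyadic
shells is finite. -/
theorem convergesAt_of_tsum_ne_top {m : ℝ} (hm : 0 < m) (f : Lp ℂ 2 (volume : Measure ℝ))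
    {x : ℝ} (hx : ∑' k, twoSidedMax m (fhat f) k x ≠ ∞) : ConvergesAt m f x := by
  refine ⟨fun t => (2 * Real.pi : ℂ)⁻¹ * evolutionSum m (fhat f) x t, _, ?_,
    hasPreciseValue_of_tsum_ne_top hm f hx, ?_⟩
  · refine eventually_nhdsWithin_of_eventually_nhds ?_
    filter_upwards [Icc_mem_nhds (show (-1 : ℝ) < 0 by norm_num) one_pos] with t ht
    exact hasEvolutionValue_of_tsum_ne_top hm f hx ht
  · refine Tendsto.const_mul _ (Tendsto.mono_left ?_ nhdsWithin_le_nhds)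
    exact (continuousOn_evolutionSum hm (memLp_fhat f) hx).continuousAt
      (Icc_mem_nhds (by norm_num) one_pos)

/-! ### The Sobolev norm and the energy in a shell -/

/-- The integral of `(1 + ξ²)^s |f̂(ξ)|²`. -/
def sobolevIntegral (s : ℝ) (f : Lp ℂ 2 (volume : Measure ℝ)) : ℝ≥0∞ :=
  ∫⁻ ξ : ℝ, ENNReal.ofReal ((1 + ξ ^ 2) ^ s) * ‖fhat f ξ‖ₑ ^ 2

/-- `InHs` says that the distribution `(1 + η²)^{s/2} 𝓕 f` is a function `u ∈ L²`. The inverse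
weight is bounded for `s ≥ 0`, so it may be applied within `L²`, and `L²` embeds injectively into
the tempered distributions. -/
theorem exists_fourier_eq_of_inHs {s : ℝ} (hs : 0 ≤ s) {f : Lp ℂ 2 (volume : Measure ℝ)}
    (hf : InHs s f) : ∃ u : Lp ℂ 2 (volume : Measure ℝ),
      ∀ᵐ η, (𝓕 f : Lp ℂ 2 (volume : Measure ℝ)) η = (((1 + η ^ 2) ^ (-s / 2) : ℝ) : ℂ) * u η := by
  obtain ⟨u, hu⟩ := TemperedDistribution.memSobolev_iff_exists_smulLeftCLM_fourier.1 hf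
  have hg : (fun x : ℝ => Complex.ofReal ((1 + ‖x‖ ^ 2) ^ (-s / 2) : ℝ)).HasTemperateGrowth := by
    fun_prop
  have hgL : MemLp (fun x : ℝ => Complex.ofReal ((1 + ‖x‖ ^ 2) ^ (-s / 2) : ℝ)) ∞ := by
    refine memLp_top_of_bound hg.1.continuous.aestronglyMeasurable 1
      (Eventually.of_forall fun x => ?_)
    rw [Complex.norm_real, Real.norm_of_nonneg (by positivity)]
    refine Real.rpow_le_one_of_one_le_of_nonpos ?_ (by linarith)
    have := sq_nonneg ‖x‖
    linarith
  refine ⟨u, ?_⟩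
  have h1 : ((hgL.toLp _ • u : Lp ℂ 2 (volume : Measure ℝ)) : 𝓢'(ℝ, ℂ)) =
      (𝓕 f : Lp ℂ 2 (volume : Measure ℝ)) := by
    rw [MeasureTheory.Lp.toTemperedDistribution_smul_eq hg hgL, ← hu,
      TemperedDistribution.smulLeftCLM_smulLeftCLM_apply (by fun_prop) (by fun_prop),
      ← MeasureTheory.Lp.fourier_toTemperedDistribution_eq]
    convert TemperedDistribution.smulLeftCLM_const 1 (𝓕 (f : 𝓢'(ℝ, ℂ))) using 1
    · congr
      ext x
      rw [Pi.mul_apply]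
      norm_cast
      rw [← Real.rpow_add (by positivity)]
      ring_nf
      simp
    · simp
  have h2 : (hgL.toLp _ • u : Lp ℂ 2 (volume : Measure ℝ)) = 𝓕 f := by
    have := Lp.ker_toTemperedDistributionCLM_eq_bot (F := ℂ) (μ := (volume : Measure ℝ)) (p := 2)
    exact LinearMap.ker_eq_bot.1 this h1
  rw [← h2]
  filter_upwards [Lp.coeFn_lpSMul (r := 2) (hgL.toLp _) u, hgL.coeFn_toLp] with η h3 h4
  rw [h3, Pi.smul_apply', h4, smul_eq_mul, Real.norm_eq_abs, sq_abs]

/-- The weights `(1 + η²)^s` and `(1 + (2πη)²)^s` of the two normalizations are comparable; the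
factor is `(2π)^{2s}`. -/
theorem sobolevIntegral_ne_top {s : ℝ} (hs : 0 ≤ s) {f : Lp ℂ 2 (volume : Measure ℝ)}
    (hf : InHs s f) : sobolevIntegral s f ≠ ∞ := by
  obtain ⟨u, hu⟩ := exists_fourier_eq_of_inHs hs hf
  have hpi : 1 ≤ 2 * Real.pi := by linarith [Real.pi_gt_three]
  have h := lintegral_comp_div_two_pi fun η =>
    ENNReal.ofReal ((1 + (2 * Real.pi * η) ^ 2) ^ s) *
      ‖(𝓕 f : Lp ℂ 2 (volume : Measure ℝ)) η‖ₑ ^ 2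
  have h' : sobolevIntegral s f = ENNReal.ofReal (2 * Real.pi) *
      ∫⁻ η, ENNReal.ofReal ((1 + (2 * Real.pi * η) ^ 2) ^ s) *
      ‖(𝓕 f : Lp ℂ 2 (volume : Measure ℝ)) η‖ₑ ^ 2 := by
    rw [← h]
    refine lintegral_congr fun ξ => ?_
    rw [mul_div_cancel₀ _ (by positivity : 2 * Real.pi ≠ 0)]
    rfl
  rw [h']
  refine ENNReal.mul_ne_top ENNReal.ofReal_ne_top ?_
  have hu2 : ∫⁻ η, ‖u η‖ₑ ^ 2 < ∞ := by
    have := (Lp.memLp u).2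
    rw [eLpNorm_lt_top_iff_lintegral_rpow_enorm_lt_top (by norm_num) (by norm_num)] at this
    simpa using this
  refine ne_top_of_le_ne_top (ENNReal.mul_ne_top (ENNReal.ofReal_ne_top
    (r := ((2 * Real.pi) ^ 2) ^ s)) hu2.ne) ?_
  rw [← lintegral_const_mul' _ _ ENNReal.ofReal_ne_top]
  refine lintegral_mono_ae ?_
  filter_upwards [hu] with η hη
  rw [hη, enorm_mul, mul_pow _ ‖u η‖ₑ, ← mul_assoc]
  gcongr
  rw [← ofReal_norm, ← ENNReal.ofReal_pow (norm_nonneg _), ← ENNReal.ofReal_mul (by positivity)]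
  apply ENNReal.ofReal_le_ofReal
  rw [Complex.norm_real, Real.norm_of_nonneg (by positivity)]
  have e1 : ((1 + η ^ 2) ^ (-s / 2)) ^ 2 = (1 + η ^ 2) ^ (-s) := by
    rw [← Real.rpow_natCast, ← Real.rpow_mul (by positivity)]
    congr 1
    push_cast
    ring
  rw [e1]
  calc (1 + (2 * Real.pi * η) ^ 2) ^ s * (1 + η ^ 2) ^ (-s)
      ≤ ((2 * Real.pi) ^ 2 * (1 + η ^ 2)) ^ s * (1 + η ^ 2) ^ (-s) := by
        gcongr
        nlinarith
    _ = ((2 * Real.pi) ^ 2) ^ s := by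
        rw [Real.mul_rpow (by positivity) (by positivity), mul_assoc,
          ← Real.rpow_add (by positivity)]
        simp

theorem hsNorm_eq (s : ℝ) (f : Lp ℂ 2 (volume : Measure ℝ)) :
    hsNorm s f = (ENNReal.ofReal (2 * Real.pi)⁻¹ * sobolevIntegral s f) ^ (1 / 2 : ℝ) := rfl

theorem sobolevIntegral_rpow_half (s : ℝ) (f : Lp ℂ 2 (volume : Measure ℝ)) :
    sobolevIntegral s f ^ (1 / 2 : ℝ) =
      ENNReal.ofReal (2 * Real.pi) ^ (1 / 2 : ℝ) * hsNorm s f := by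
  rw [hsNorm_eq, ← ENNReal.mul_rpow_of_nonneg _ _ (by norm_num), ← mul_assoc,
    ← ENNReal.ofReal_mul (by positivity), mul_inv_cancel₀ (by positivity), ENNReal.ofReal_one,
    one_mul]

theorem lintegral_shell_le_sobolevIntegral {s : ℝ} (hs : 0 ≤ s)
    (f : Lp ℂ 2 (volume : Measure ℝ)) {N : ℝ} (hN : 0 < N) {E : Set ℝ} (hE : MeasurableSet E)
    (hEN : ∀ ξ ∈ E, N ≤ |ξ|) :
    ∫⁻ ξ in E, ‖fhat f ξ‖ₑ ^ 2 ≤ ENNReal.ofReal (N ^ (-(2 * s))) * sobolevIntegral s f := by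
  rw [sobolevIntegral, ← lintegral_const_mul' _ _ ENNReal.ofReal_ne_top]
  refine (setLIntegral_mono' hE fun ξ hξ => ?_).trans (setLIntegral_le_lintegral E _)
  rw [← mul_assoc, ← ENNReal.ofReal_mul (by positivity)]
  refine le_mul_of_one_le_left zero_le ?_
  rw [ENNReal.one_le_ofReal, Real.rpow_neg hN.le, inv_mul_eq_div, one_le_div (by positivity),
    Real.rpow_mul hN.le]
  have : N ^ (2 : ℝ) ≤ 1 + ξ ^ 2 := by
    rw [Real.rpow_two, ← sq_abs ξ]
    have := hEN ξ hξ
    nlinarith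
  gcongr

theorem lintegral_shell_fhat_le {s : ℝ} (hs : 0 ≤ s) (f : Lp ℂ 2 (volume : Measure ℝ)) (k : ℕ) :
    ∫⁻ ξ in Ioc ((2 : ℝ) ^ k) (2 * 2 ^ k), ‖fhat f ξ‖ₑ ^ 2 ≤
      ENNReal.ofReal (((2 : ℝ) ^ k) ^ (-(2 * s))) * sobolevIntegral s f :=
  lintegral_shell_le_sobolevIntegral hs f (by positivity) measurableSet_Ioc
    fun _ hξ => hξ.1.le.trans (le_abs_self _)

theorem lintegral_shell_fhat_neg_le {s : ℝ} (hs : 0 ≤ s) (f : Lp ℂ 2 (volume : Measure ℝ))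
    (k : ℕ) :
    ∫⁻ ξ in Ioc ((2 : ℝ) ^ k) (2 * 2 ^ k), ‖fhat f (-ξ)‖ₑ ^ 2 ≤
      ENNReal.ofReal (((2 : ℝ) ^ k) ^ (-(2 * s))) * sobolevIntegral s f := by
  have h : ∫⁻ ξ in Ioc ((2 : ℝ) ^ k) (2 * 2 ^ k), ‖fhat f (-ξ)‖ₑ ^ 2 =
      ∫⁻ ξ in -(Ioc ((2 : ℝ) ^ k) (2 * 2 ^ k)), ‖fhat f ξ‖ₑ ^ 2 := by
    have := (Measure.measurePreserving_neg (volume : Measure ℝ)).setLIntegral_comp_preimage_emb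
      (MeasurableEquiv.neg ℝ).measurableEmbedding (fun ξ => ‖fhat f ξ‖ₑ ^ 2)
      (-(Ioc ((2 : ℝ) ^ k) (2 * 2 ^ k)))
    rw [← this]
    congr 2
    ext ξ
    simp
  rw [h]
  refine lintegral_shell_le_sobolevIntegral hs f (by positivity) measurableSet_Ioc.neg
    fun ξ hξ => ?_
  exact (mem_neg.1 hξ).1.le.trans (neg_le_abs ξ)

theorem lintegral_low_fhat_le {s : ℝ} (hs : 0 ≤ s) (f : Lp ℂ 2 (volume : Measure ℝ)) :
    ∫⁻ ξ in Ioc (-1 : ℝ) 1, ‖fhat f ξ‖ₑ ≤ 2 ^ (1 / 2 : ℝ) * sobolevIntegral s f ^ (1 / 2 : ℝ) := by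
  have h := ENNReal.lintegral_mul_le_Lp_mul_Lq (volume.restrict (Ioc (-1 : ℝ) 1))
    Real.HolderConjugate.two_two (f := fun _ => 1) (g := fun ξ => ‖fhat f ξ‖ₑ)
    aemeasurable_const (stronglyMeasurable_fhat f).enorm.aemeasurable
  simp only [Pi.mul_apply, one_mul, lintegral_const, Measure.restrict_apply_univ,
    Real.volume_Ioc, ENNReal.rpow_two] at h
  refine h.trans ?_
  gcongr
  · norm_num
  · refine (setLIntegral_le_lintegral _ _).trans (lintegral_mono fun ξ => ?_)
    refine le_mul_of_one_le_left zero_le ?_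
    rw [ENNReal.one_le_ofReal]
    exact Real.one_le_rpow (by nlinarith [sq_nonneg ξ]) hs

/-! ### Hausdorff content and a finite Frostman lemma -/

/-- The dyadic interval `[i 2⁻ʲ, (i + 1) 2⁻ʲ)`. -/
def dyadicInterval (j : ℕ) (i : ℤ) : Set ℝ := {x | ⌊x * 2 ^ j⌋ = i}

/-- The Hausdorff content of dimension `β`. -/
def hausdorffContent (β : ℝ) (hβ : 0 < β) : OuterMeasure ℝ :=
  OuterMeasure.ofFunction (fun s => Metric.ediam s ^ β) (by simp [hβ])

theorem hausdorffContent_le {β : ℝ} (hβ : 0 < β) (s : Set ℝ) :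
    hausdorffContent β hβ s ≤ Metric.ediam s ^ β := OuterMeasure.ofFunction_le s

/-- If the sum of `diam^β` over a cover is small, so is each term and hence, as `β > 0`, each
diameter: the fineness of the covers is automatic. -/
theorem hausdorffMeasure_eq_zero_of_content {β : ℝ} (hβ : 0 < β) {s : Set ℝ}
    (hs : hausdorffContent β hβ s = 0) : μH[β] s = 0 := by
  have hex : ∀ n : ℕ, ∃ t : ℕ → Set ℝ, s ⊆ ⋃ i, t i ∧
      ∑' i, Metric.ediam (t i) ^ β < ((n : ℝ≥0∞) + 1)⁻¹ := fun n => by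
    have h : hausdorffContent β hβ s < ((n : ℝ≥0∞) + 1)⁻¹ := by
      rw [hs]; simp
    rw [hausdorffContent, OuterMeasure.ofFunction_apply] at h
    simp only [iInf_lt_iff] at h
    obtain ⟨t, ht, h⟩ := h
    exact ⟨t, ht, h⟩
  choose t ht hlt using hex
  have hlim : Tendsto (fun n : ℕ => ((n : ℝ≥0∞) + 1)⁻¹) atTop (𝓝 0) := by
    have := ENNReal.tendsto_inv_nat_nhds_zero.comp (tendsto_add_atTop_nat 1)
    simpa [Function.comp_def] using this
  have hr : Tendsto (fun n : ℕ => (((n : ℝ≥0∞) + 1)⁻¹) ^ (1 / β)) atTop (𝓝 0) := by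
    have := hlim.ennrpow_const (1 / β)
    rwa [ENNReal.zero_rpow_of_pos (by positivity)] at this
  have h := Measure.hausdorffMeasure_le_liminf_tsum β s _ hr t (Eventually.of_forall fun n i => ?_)
    (Eventually.of_forall ht)
  · refine le_antisymm (h.trans ?_) zero_le
    have h0 : Tendsto (fun n => ∑' i, Metric.ediam (t n i) ^ β) atTop (𝓝 0) :=
      tendsto_of_tendsto_of_tendsto_of_le_of_le tendsto_const_nhds hlim (fun _ => zero_le)
        fun n => (hlt n).le
    exact h0.liminf_eq.le
  · have h1 : Metric.ediam (t n i) ^ β ≤ ((n : ℝ≥0∞) + 1)⁻¹ :=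
      (ENNReal.le_tsum i).trans (hlt n).le
    calc Metric.ediam (t n i) = (Metric.ediam (t n i) ^ β) ^ (1 / β) := by
          rw [← ENNReal.rpow_mul, mul_one_div_cancel hβ.ne', ENNReal.rpow_one]
      _ ≤ _ := by gcongr

theorem mem_dyadicInterval {j : ℕ} {i : ℤ} {x : ℝ} :
    x ∈ dyadicInterval j i ↔ (i : ℝ) ≤ x * 2 ^ j ∧ x * 2 ^ j < i + 1 := Int.floor_eq_iff

theorem measurableSet_dyadicInterval (j : ℕ) (i : ℤ) : MeasurableSet (dyadicInterval j i) :=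
  measurableSet_eq_fun (Int.measurable_floor.comp (measurable_id.mul_const _)) measurable_const

theorem ediam_dyadicInterval_le (j : ℕ) (i : ℤ) :
    Metric.ediam (dyadicInterval j i) ≤ ENNReal.ofReal ((1 / 2) ^ j) := by
  refine Metric.ediam_le fun x hx y hy => ?_
  rw [edist_dist]
  apply ENNReal.ofReal_le_ofReal
  rw [mem_dyadicInterval] at hx hy
  have h2 : (0 : ℝ) < 2 ^ j := by positivity
  rw [Real.dist_eq, one_div, inv_pow, ← one_div, le_div_iff₀ h2]
  have : |x - y| * 2 ^ j = |x * 2 ^ j - y * 2 ^ j| := by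
    rw [← sub_mul, abs_mul, abs_of_pos h2]
  rw [this, abs_le]
  constructor <;> linarith [hx.1, hx.2, hy.1, hy.2]

theorem mem_dyadicInterval_succ_iff {j : ℕ} {i : ℤ} {x : ℝ} :
    x ∈ dyadicInterval j i ↔
      x ∈ dyadicInterval (j + 1) (2 * i) ∨ x ∈ dyadicInterval (j + 1) (2 * i + 1) := by
  simp only [mem_dyadicInterval, pow_succ, ← mul_assoc]
  push_cast
  constructor
  · rintro ⟨h1, h2⟩
    rcases lt_or_ge (x * 2 ^ j * 2) (2 * i + 1) with h | h
    · left; constructor <;> linarith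
    · right; constructor <;> linarith
  · rintro (⟨h1, h2⟩ | ⟨h1, h2⟩) <;> constructor <;> linarith

/-- Dyadic intervals of the same or a finer generation are nested or disjoint. -/
theorem dyadicInterval_subset_or_disjoint {j j' : ℕ} (h : j ≤ j') (i i' : ℤ) :
    dyadicInterval j' i' ⊆ dyadicInterval j i ∨
      Disjoint (dyadicInterval j' i') (dyadicInterval j i) := by
  have hfl : ∀ x : ℝ, ⌊x * 2 ^ j⌋ = ⌊x * 2 ^ j'⌋ / 2 ^ (j' - j) := fun x => by
    have h1 : x * 2 ^ j = x * 2 ^ j' / ((2 ^ (j' - j) : ℕ) : ℝ) := by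
      rw [eq_div_iff (by positivity)]
      push_cast
      rw [mul_assoc, ← pow_add, Nat.add_sub_of_le h]
    rw [h1, Int.floor_div_natCast]
    push_cast
    rfl
  rcases eq_or_ne (i' / 2 ^ (j' - j)) i with h1 | h1
  · left
    intro x hx
    have hx' : ⌊x * 2 ^ j'⌋ = i' := hx
    change ⌊x * 2 ^ j⌋ = i
    rw [hfl, hx', h1]
  · right
    rw [Set.disjoint_left]
    intro x hx hx2
    have hx' : ⌊x * 2 ^ j'⌋ = i' := hx
    have hx2' : ⌊x * 2 ^ j⌋ = i := hx2
    rw [hfl, hx'] at hx2'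
    exact h1 hx2'

/-- A finite version of Frostman's lemma: a measure on `E` which is controlled at the scales
`2⁻ʲ, …, 2⁻ᵏ` and whose mass bounds the Hausdorff content of the part of `E` in a dyadic interval of
length `2⁻ʲ`. -/
theorem exists_measure_dyadic {β : ℝ} (hβ : 0 < β) (E : Set ℝ) (k d : ℕ) :
    ∀ j, j + d = k → ∀ i : ℤ, ∃ μ : Measure ℝ, μ (dyadicInterval j i)ᶜ = 0 ∧ (∀ᵐ x ∂μ, x ∈ E) ∧
      hausdorffContent β hβ (E ∩ dyadicInterval j i) ≤ μ univ ∧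
      ∀ j', j ≤ j' → j' ≤ k → ∀ i', μ (dyadicInterval j' i') ≤
        ENNReal.ofReal ((1 / 2) ^ j') ^ β := by
  induction d with
  | zero =>
    intro j hj i
    rcases (E ∩ dyadicInterval j i).eq_empty_or_nonempty with h | ⟨x, hxE, hx⟩
    · exact ⟨0, by simp, by simp, by rw [h]; simp, by simp⟩
    -- At the finest scale: a point mass of the greatest admissible size at a point of `E`. No
    -- measurability of `E` is needed.
    · refine ⟨ENNReal.ofReal ((1 / 2) ^ j) ^ β • Measure.dirac x, ?_, ?_, ?_, ?_⟩
      · rw [Measure.smul_apply, Measure.dirac_apply' _ (measurableSet_dyadicInterval j i).compl]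
        simp [hx]
      · refine Measure.ae_smul_measure ?_ _
        rw [ae_dirac_eq]
        exact hxE
      · refine (hausdorffContent_le hβ _).trans ?_
        simp only [Measure.smul_apply, measure_univ, smul_eq_mul, mul_one]
        gcongr
        exact (Metric.ediam_mono inter_subset_right).trans (ediam_dyadicInterval_le j i)
      · intro j' h1 h2 i'
        have : j' = j := by omega
        subst this
        rw [Measure.smul_apply, smul_eq_mul]
        exact mul_le_of_le_one_right zero_le prob_le_one
  | succ d ih =>
    intro j hj i
    obtain ⟨μ₁, a1, b1, c1, d1⟩ := ih (j + 1) (by omega) (2 * i)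
    obtain ⟨μ₂, a2, b2, c2, d2⟩ := ih (j + 1) (by omega) (2 * i + 1)
    set μ := μ₁ + μ₂ with hμ
    set T := ENNReal.ofReal ((1 / 2) ^ j) ^ β with hT
    have hTtop : T ≠ ∞ := ENNReal.rpow_ne_top_of_nonneg hβ.le ENNReal.ofReal_ne_top
    have hT0 : T ≠ 0 := by
      refine (ENNReal.rpow_pos ?_ ENNReal.ofReal_ne_top).ne'
      rw [ENNReal.ofReal_pos]
      positivity
    have a : μ (dyadicInterval j i)ᶜ = 0 := by
      rw [hμ, Measure.add_apply, add_eq_zero]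
      refine ⟨measure_mono_null (compl_subset_compl.2 fun x hx => ?_) a1,
        measure_mono_null (compl_subset_compl.2 fun x hx => ?_) a2⟩
      · exact mem_dyadicInterval_succ_iff.2 (Or.inl hx)
      · exact mem_dyadicInterval_succ_iff.2 (Or.inr hx)
    have b : ∀ᵐ x ∂μ, x ∈ E := by
      rw [hμ, ae_add_measure_iff]
      exact ⟨b1, b2⟩
    have c : hausdorffContent β hβ (E ∩ dyadicInterval j i) ≤ μ univ := by
      have : E ∩ dyadicInterval j i = (E ∩ dyadicInterval (j + 1) (2 * i)) ∪
          (E ∩ dyadicInterval (j + 1) (2 * i + 1)) := by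
        ext x
        rw [← inter_union_distrib_left, mem_inter_iff, mem_inter_iff, mem_union,
          mem_dyadicInterval_succ_iff]
      rw [this, hμ, Measure.add_apply]
      exact (measure_union_le _ _).trans (add_le_add c1 c2)
    have dd : ∀ j', j + 1 ≤ j' → j' ≤ k → ∀ i', μ (dyadicInterval j' i') ≤
        ENNReal.ofReal ((1 / 2) ^ j') ^ β := by
      intro j' h1 h2 i'
      rw [hμ, Measure.add_apply]
      -- A finer dyadic interval meets at most one of the two halves, so only one of `μ₁`, `μ₂`
      -- charges it.
      rcases dyadicInterval_subset_or_disjoint h1 (2 * i) i' with h | h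
      · have : μ₂ (dyadicInterval j' i') = 0 := by
          refine measure_mono_null (fun x hx => ?_) a2
          intro hx2
          have e1 : ⌊x * 2 ^ (j + 1)⌋ = 2 * i := h hx
          have e2 : ⌊x * 2 ^ (j + 1)⌋ = 2 * i + 1 := hx2
          omega
        rw [this, add_zero]
        exact d1 j' h1 h2 i'
      · have : μ₁ (dyadicInterval j' i') = 0 :=
          measure_mono_null (fun x hx hx2 => Set.disjoint_left.1 h hx hx2) a1
        rw [this, zero_add]
        exact d2 j' h1 h2 i'
    -- A mass above the threshold `T = 2^{-jβ}` is scaled down to exactly `T`, which still bounds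
    -- the content because the content is at most `diam^β`.
    rcases le_total (μ univ) T with hle | hle
    · refine ⟨μ, a, b, c, fun j' h1 h2 i' => ?_⟩
      rcases eq_or_lt_of_le h1 with rfl | h1
      · exact (measure_mono (subset_univ _)).trans hle
      · exact dd j' h1 h2 i'
    · have hne : μ univ ≠ 0 := fun h => hT0 (le_antisymm (h ▸ hle) zero_le)
      have hc1 : T / μ univ ≤ 1 := ENNReal.div_le_of_le_mul (by rwa [one_mul])
      have hfin : μ univ ≠ ∞ := by
        have e1 : ∀ (ν : Measure ℝ) (i : ℤ), ν (dyadicInterval (j + 1) i)ᶜ = 0 →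
            ν (dyadicInterval (j + 1) i) ≤ ENNReal.ofReal ((1 / 2) ^ (j + 1)) ^ β →
            ν univ ≠ ∞ := fun ν i h0 h1 => by
          have h2 := measure_add_measure_compl (μ := ν) (measurableSet_dyadicInterval (j + 1) i)
          rw [h0, add_zero] at h2
          rw [← h2]
          exact ne_top_of_le_ne_top
            (ENNReal.rpow_ne_top_of_nonneg hβ.le ENNReal.ofReal_ne_top) h1
        rw [hμ, Measure.add_apply]
        exact ENNReal.add_ne_top.2 ⟨e1 μ₁ _ a1 (d1 _ le_rfl (by omega) _),
          e1 μ₂ _ a2 (d2 _ le_rfl (by omega) _)⟩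
      have hmass : T / μ univ * μ univ = T := ENNReal.div_mul_cancel hne hfin
      refine ⟨(T / μ univ) • μ, ?_, Measure.ae_smul_measure b _, ?_, fun j' h1 h2 i' => ?_⟩
      · rw [Measure.smul_apply, a, smul_zero]
      · rw [Measure.smul_apply, smul_eq_mul, hmass, hT]
        refine (hausdorffContent_le hβ _).trans ?_
        gcongr
        exact (Metric.ediam_mono inter_subset_right).trans (ediam_dyadicInterval_le j i)
      · rw [Measure.smul_apply, smul_eq_mul]
        rcases eq_or_lt_of_le h1 with rfl | h1
        · calc T / μ univ * μ (dyadicInterval j i') ≤ T / μ univ * μ univ := by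
                gcongr
                exact subset_univ _
            _ = T := hmass
        · exact (mul_le_of_le_one_left zero_le hc1).trans (dd j' h1 h2 i')

theorem ball_subset_dyadicIntervals (x : ℝ) (j : ℕ) :
    Metric.ball x ((1 / 2) ^ j) ⊆ dyadicInterval j (⌊x * 2 ^ j⌋ - 1) ∪
      (dyadicInterval j ⌊x * 2 ^ j⌋ ∪ dyadicInterval j (⌊x * 2 ^ j⌋ + 1)) := by
  intro y hy
  have h2 : (0 : ℝ) < 2 ^ j := by positivity
  have h1 : |y * 2 ^ j - x * 2 ^ j| < 1 := by
    rw [Metric.mem_ball, Real.dist_eq, one_div, inv_pow, ← one_div, lt_div_iff₀ h2] at hy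
    rwa [← sub_mul, abs_mul, abs_of_pos h2]
  rw [abs_lt] at h1
  have hx1 := Int.floor_le (x * 2 ^ j)
  have hx2 := Int.lt_floor_add_one (x * 2 ^ j)
  simp only [mem_union, mem_dyadicInterval]
  push_cast
  rcases lt_or_ge (y * 2 ^ j) ⌊x * 2 ^ j⌋ with h | h
  · left; constructor <;> linarith
  · right
    rcases lt_or_ge (y * 2 ^ j) (⌊x * 2 ^ j⌋ + 1) with h' | h'
    · left; constructor <;> linarith
    · right; constructor <;> linarith

/-- A finite version of Frostman's lemma. -/
theorem exists_isDimensionalUpTo {β : ℝ} (hβ : 0 < β) (E : Set ℝ) (k : ℕ) (i : ℤ) :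
    ∃ μ : Measure ℝ, IsDimensionalUpTo β 3 k μ ∧ (∀ᵐ x ∂μ, x ∈ E) ∧
      hausdorffContent β hβ (E ∩ dyadicInterval 0 i) ≤ μ univ := by
  obtain ⟨μ, h1, h2, h3, h4⟩ := exists_measure_dyadic hβ E k k 0 (by omega) i
  refine ⟨μ, ⟨?_, fun x j hj => ?_⟩, h2, h3⟩
  · have h5 := measure_add_measure_compl (μ := μ) (measurableSet_dyadicInterval 0 i)
    rw [h1, add_zero] at h5
    rw [← h5]
    refine (h4 0 le_rfl (Nat.zero_le k) i).trans ?_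
    simp
  -- The constant `3` counts the dyadic intervals of length `2⁻ʲ` which cover a ball of radius
  -- `2⁻ʲ`.
  · refine (measure_mono (ball_subset_dyadicIntervals x j)).trans ?_
    refine (measure_union_le _ _).trans (le_trans (add_le_add_right (measure_union_le _ _) _) ?_)
    refine (add_le_add (h4 j (Nat.zero_le j) hj _) (add_le_add (h4 j (Nat.zero_le j) hj _)
      (h4 j (Nat.zero_le j) hj _))).trans (le_of_eq ?_)
    rw [ENNReal.ofReal_rpow_of_nonneg (by positivity) hβ.le]
    push_cast
    ring

/-! ### Two-sided shells and the dimension of the divergence set -/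

/-- Minkowski's inequality for series of nonnegative functions. -/
theorem lintegral_Lp_tsum_le {X : Type*} [MeasurableSpace X] {μ : Measure X} {q : ℝ} (hq : 1 ≤ q)
    {T : ℕ → X → ℝ≥0∞} (hT : ∀ k, Measurable (T k)) :
    (∫⁻ x, (∑' k, T k x) ^ q ∂μ) ^ (1 / q) ≤ ∑' k, (∫⁻ x, T k x ^ q ∂μ) ^ (1 / q) := by
  have hq0 : 0 < q := by linarith
  have hfin : ∀ n, (∫⁻ x, (∑ k ∈ Finset.range n, T k x) ^ q ∂μ) ^ (1 / q) ≤
      ∑ k ∈ Finset.range n, (∫⁻ x, T k x ^ q ∂μ) ^ (1 / q) := fun n => by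
    induction n with
    | zero => simp [hq0]
    | succ n ih =>
      simp_rw [Finset.sum_range_succ]
      exact (ENNReal.lintegral_Lp_add_le
        (Finset.measurable_sum _ fun k _ => hT k).aemeasurable (hT n).aemeasurable hq).trans
        (by gcongr)
  have hmono : Monotone fun n x => (∑ k ∈ Finset.range n, T k x) ^ q := fun n n' h x =>
    ENNReal.rpow_le_rpow (Finset.sum_le_sum_of_subset (Finset.range_mono h)) hq0.le
  have hsup : ∀ x, (∑' k, T k x) ^ q = ⨆ n, (∑ k ∈ Finset.range n, T k x) ^ q := fun x => by
    rw [ENNReal.tsum_eq_iSup_nat]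
    exact (ENNReal.orderIsoRpow q hq0).map_iSup _
  simp_rw [hsup]
  rw [lintegral_iSup (fun n => (Finset.measurable_sum _ fun k _ => hT k).pow_const q) hmono]
  have h1 : (⨆ n, ∫⁻ x, (∑ k ∈ Finset.range n, T k x) ^ q ∂μ) ^ (1 / q) =
      ⨆ n, (∫⁻ x, (∑ k ∈ Finset.range n, T k x) ^ q ∂μ) ^ (1 / q) :=
    (ENNReal.orderIsoRpow (1 / q) (by positivity)).map_iSup _
  rw [h1]
  exact iSup_le fun n => (hfin n).trans (ENNReal.sum_le_tsum _)

theorem IsDimensionalUpTo.map_neg {α : ℝ} {A : ℝ≥0} {k : ℕ} {μ : Measure ℝ}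
    (h : IsDimensionalUpTo α A k μ) : IsDimensionalUpTo α A k (μ.map fun x => -x) := by
  refine ⟨?_, fun x j hj => ?_⟩
  · rw [Measure.map_apply measurable_neg MeasurableSet.univ]
    exact h.measure_univ_le
  · rw [Measure.map_apply measurable_neg Metric.isOpen_ball.measurableSet]
    refine le_trans (le_of_eq ?_) (h.measure_ball_le (-x) j hj)
    congr 1
    ext y
    simp only [mem_preimage, Metric.mem_ball, Real.dist_eq]
    rw [← abs_neg]
    ring_nf

section

variable {m : ℝ}

theorem measurable_twoSidedMax (hm : 0 < m) (f : Lp ℂ 2 (volume : Measure ℝ)) (k : ℕ) :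
    Measurable (twoSidedMax m (fhat f) k) :=
  (measurable_shellMax hm (memLp_fhat f) (by positivity)).add
    ((measurable_shellMax hm (memLp_comp_neg (memLp_fhat f)) (by positivity)).comp measurable_neg)

/-- The bound for one dyadic shell. -/
def shellBound (m a α q s : ℝ) (A : ℝ≥0) (k : ℕ) : ℝ≥0∞ :=
  shellConst m a (2 * α / q) * (A : ℝ≥0∞) ^ (2 / q) *
    ENNReal.ofReal (((2 : ℝ) ^ k) ^ (growth m a - 2 * s))

/-- The maximal estimate over one two-sided dyadic shell. -/
theorem lintegral_twoSidedMax_rpow_le (hm0 : 0 < m) (hm1 : m < 1) {a α q s : ℝ} (ha : 0 < a)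
    (hq : 2 ≤ q) (haα : a < 2 * α / q) (hα : α ≤ 1) (hs : 0 ≤ s)
    (f : Lp ℂ 2 (volume : Measure ℝ)) {A : ℝ≥0} {k : ℕ} {μ : Measure ℝ}
    (hμ : IsDimensionalUpTo α A k μ) :
    (∫⁻ x, twoSidedMax m (fhat f) k x ^ q ∂μ) ^ (1 / q) ≤
      2 * (shellBound m a α q s A k * sobolevIntegral s f) ^ (1 / 2 : ℝ) := by
  have hq0 : 0 < q := by linarith
  have hg := memLp_fhat f
  have hgn := memLp_comp_neg hg
  have hm1' := measurable_shellMax hm0 hg (N := 2 ^ k) (by positivity)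
  have hm2' := measurable_shellMax hm0 hgn (N := 2 ^ k) (by positivity)
  have hnorm : ∀ (Z T : ℝ≥0∞), Z ≤ T ^ (q / 2) → Z ^ (1 / q) ≤ T ^ (1 / 2 : ℝ) := fun Z T h => by
    calc Z ^ (1 / q) ≤ (T ^ (q / 2)) ^ (1 / q) := by gcongr
      _ = T ^ (1 / 2 : ℝ) := by
        rw [← ENNReal.rpow_mul]
        congr 1
        field_simp
  have hN : (0 : ℝ) < 2 ^ k := by positivity
  have hB : ∀ G : ℝ≥0∞, G ≤ ENNReal.ofReal (((2 : ℝ) ^ k) ^ (-(2 * s))) * sobolevIntegral s f →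
      shellConst m a (2 * α / q) * (A : ℝ≥0∞) ^ (2 / q) *
        ENNReal.ofReal (((2 : ℝ) ^ k) ^ growth m a) * G ≤
      shellBound m a α q s A k * sobolevIntegral s f := fun G hG => by
    refine (mul_le_mul_right hG _).trans (le_of_eq ?_)
    rw [shellBound, sub_eq_add_neg, Real.rpow_add hN, ENNReal.ofReal_mul (by positivity)]
    ring
  have e1 := hnorm _ _ ((lintegral_shellMax_rpow_le hm0 hm1 ha hq haα hα hg hμ).trans
    (ENNReal.rpow_le_rpow (hB _ (lintegral_shell_fhat_le hs f k)) (by positivity)))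
  have e2 := hnorm _ _ ((lintegral_shellMax_rpow_le hm0 hm1 ha hq haα hα hgn hμ.map_neg).trans
    (ENNReal.rpow_le_rpow (hB _ (lintegral_shell_fhat_neg_le hs f k)) (by positivity)))
  rw [lintegral_map (hm2'.pow_const q) measurable_neg] at e2
  rw [two_mul]
  exact (ENNReal.lintegral_Lp_add_le hm1'.aemeasurable (hm2'.comp measurable_neg).aemeasurable
    (by linarith)).trans (add_le_add e1 e2)

theorem ofReal_two_pow_rpow (k : ℕ) (b : ℝ) :
    ENNReal.ofReal (((2 : ℝ) ^ k) ^ b) = ENNReal.ofReal ((2 : ℝ) ^ b) ^ k := by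
  rw [← ENNReal.ofReal_pow (by positivity), ← Real.rpow_natCast, ← Real.rpow_natCast,
    ← Real.rpow_mul (by norm_num), ← Real.rpow_mul (by norm_num), mul_comm]

theorem tsum_ofReal_two_rpow_pow_ne_top {b : ℝ} (hb : b < 0) :
    ∑' k : ℕ, ENNReal.ofReal ((2 : ℝ) ^ b) ^ k ≠ ∞ := by
  rw [ENNReal.tsum_geometric]
  refine ENNReal.inv_ne_top.2 (tsub_pos_iff_lt.2 ?_).ne'
  rw [ENNReal.ofReal_lt_one]
  exact Real.rpow_lt_one_of_one_lt_of_neg one_lt_two hb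

theorem tsum_ne_top_of_eventually_le {T c : ℕ → ℝ≥0∞} {K : ℕ} (hT : ∀ k, T k ≠ ∞)
    (hle : ∀ k, K ≤ k → T k ≤ c k) (hc : ∑' k, c k ≠ ∞) : ∑' k, T k ≠ ∞ := by
  rw [← Summable.sum_add_tsum_nat_add' (k := K) ENNReal.summable]
  refine ENNReal.add_ne_top.2 ⟨ENNReal.sum_ne_top.2 fun k _ => hT k, ?_⟩
  refine ne_top_of_le_ne_top hc
    ((ENNReal.tsum_le_tsum fun k => hle (k + K) (Nat.le_add_left _ _)).trans ?_)
  exact ENNReal.tsum_comp_le_tsum_of_injective (add_left_injective K) _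

/-- The Hausdorff content of the set on which the maximal function over a shell is large. -/
theorem hausdorffContent_le_of_lt_twoSidedMax (hm0 : 0 < m) (hm1 : m < 1) {a β s δ : ℝ}
    (ha : 0 < a) (haβ : a < β) (hβ0 : 0 < β) (hβ : β ≤ 1) (hs : 0 ≤ s)
    (f : Lp ℂ 2 (volume : Measure ℝ)) (k : ℕ) (i : ℤ) :
    hausdorffContent β hβ0 ({x | ENNReal.ofReal (((2 : ℝ) ^ k) ^ (-δ)) <
        twoSidedMax m (fhat f) k x} ∩ dyadicInterval 0 i) ≤
      4 * (shellConst m a β * 3) * sobolevIntegral s f *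
        ENNReal.ofReal ((2 : ℝ) ^ (growth m a - 2 * s + 2 * δ)) ^ k := by
  set E := {x | ENNReal.ofReal (((2 : ℝ) ^ k) ^ (-δ)) < twoSidedMax m (fhat f) k x} with hE
  -- The measure depends on the shell and is controlled only down to `2⁻ᵏ`; the shell estimate is
  -- uniform over such measures, and Chebyshev's inequality bounds the mass.
  obtain ⟨μ, hμ, hμE, hcont⟩ := exists_isDimensionalUpTo hβ0 E k i
  refine hcont.trans ?_
  have h2k : (0 : ℝ) < 2 ^ k := by positivity
  have h := lintegral_twoSidedMax_rpow_le (q := 2) hm0 hm1 ha le_rfl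
    (by rwa [mul_div_cancel_left₀ _ two_ne_zero]) hβ hs f hμ
  have h1 : ENNReal.ofReal (((2 : ℝ) ^ k) ^ (-δ)) ^ (2 : ℝ) * μ univ ≤
      ∫⁻ x, twoSidedMax m (fhat f) k x ^ (2 : ℝ) ∂μ := by
    rw [← lintegral_const]
    refine lintegral_mono_ae ?_
    filter_upwards [hμE] with x hx
    exact ENNReal.rpow_le_rpow (le_of_lt hx) (by norm_num)
  have h3 : ∫⁻ x, twoSidedMax m (fhat f) k x ^ (2 : ℝ) ∂μ ≤
      4 * (shellBound m a β 2 s 3 k * sobolevIntegral s f) := by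
    have h4 := ENNReal.rpow_le_rpow h (show (0 : ℝ) ≤ 2 by norm_num)
    rw [ENNReal.mul_rpow_of_nonneg _ _ (by norm_num), ← ENNReal.rpow_mul, ← ENNReal.rpow_mul] at h4
    norm_num at h4
    convert h4 using 1
    simp
  have h5 := h1.trans h3
  have h6 : ENNReal.ofReal (((2 : ℝ) ^ k) ^ (2 * δ)) *
      ENNReal.ofReal (((2 : ℝ) ^ k) ^ (-δ)) ^ (2 : ℝ) = 1 := by
    rw [ENNReal.ofReal_rpow_of_nonneg (by positivity) (by norm_num), ← ENNReal.ofReal_mul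
      (by positivity), ← Real.rpow_mul h2k.le, ← Real.rpow_add h2k]
    rw [show 2 * δ + -δ * 2 = 0 by ring, Real.rpow_zero, ENNReal.ofReal_one]
  calc μ univ = ENNReal.ofReal (((2 : ℝ) ^ k) ^ (2 * δ)) *
        (ENNReal.ofReal (((2 : ℝ) ^ k) ^ (-δ)) ^ (2 : ℝ) * μ univ) := by
        rw [← mul_assoc, h6, one_mul]
    _ ≤ ENNReal.ofReal (((2 : ℝ) ^ k) ^ (2 * δ)) *
        (4 * (shellBound m a β 2 s 3 k * sobolevIntegral s f)) := by gcongr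
    _ = _ := by
        rw [← ofReal_two_pow_rpow, shellBound, Real.rpow_add h2k, ENNReal.ofReal_mul (by positivity),
          mul_div_cancel_left₀ _ (two_ne_zero' ℝ), div_self (two_ne_zero' ℝ), ENNReal.rpow_one]
        push_cast
        ring

/-- Borel–Cantelli for the Hausdorff content. A point that lies in only finitely many of the sets `E
k` has shell maxima eventually at most `2^{-δk}`, a summable sequence, and is a point of
convergence. The content bounds are per unit interval, hence the countable union over `i`. -/
theorem dimH_divergenceSet_le_of_growth_lt (hm0 : 0 < m) (hm1 : m < 1) {a β s : ℝ}
    (ha : 0 < a) (haβ : a < β) (hβ : β ≤ 1) (hs : 0 ≤ s) (hgr : growth m a < 2 * s)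
    {f : Lp ℂ 2 (volume : Measure ℝ)} (hf : InHs s f) :
    dimH (divergenceSet m f) ≤ ENNReal.ofReal β := by
  have hβ0 : 0 < β := ha.trans haβ
  -- With this `δ` both the threshold `2^{-δk}` and the content bound, of exponent `growth m a - 2s
  -- + 2δ = -2δ`, are summable.
  set δ := (2 * s - growth m a) / 4 with hδ
  have hδ0 : 0 < δ := by rw [hδ]; linarith
  set E : ℕ → Set ℝ := fun k => {x | ENNReal.ofReal (((2 : ℝ) ^ k) ^ (-δ)) <
    twoSidedMax m (fhat f) k x} with hE
  have hcover : divergenceSet m f ⊆ ⋃ i : ℤ, limsup (fun k => E k ∩ dyadicInterval 0 i) atTop := by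
    intro x hx
    refine mem_iUnion.2 ⟨⌊x * 2 ^ 0⌋, ?_⟩
    rw [mem_limsup_iff_frequently_mem]
    by_contra hcon
    rw [not_frequently] at hcon
    refine hx (convergesAt_of_tsum_ne_top hm0 f ?_)
    obtain ⟨K, hK⟩ := eventually_atTop.1 hcon
    have hle : ∀ k, K ≤ k → twoSidedMax m (fhat f) k x ≤ ENNReal.ofReal ((2 : ℝ) ^ (-δ)) ^ k :=
      fun k hk => by
        rw [← ofReal_two_pow_rpow]
        by_contra hlt
        exact hK k hk ⟨not_le.1 hlt, rfl⟩
    exact tsum_ne_top_of_eventually_le (fun k => (ENNReal.add_lt_top.2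
      ⟨shellMax_lt_top (memLp_fhat f) _ _, shellMax_lt_top (memLp_comp_neg (memLp_fhat f)) _ _⟩).ne)
      hle (tsum_ofReal_two_rpow_pow_ne_top (neg_lt_zero.2 hδ0))
  refine (dimH_mono hcover).trans ?_
  rw [dimH_iUnion]
  refine iSup_le fun i => ?_
  refine dimH_le_of_hausdorffMeasure_ne_top ?_
  rw [Real.coe_toNNReal _ hβ0.le, hausdorffMeasure_eq_zero_of_content hβ0]
  · exact ENNReal.zero_ne_top
  refine measure_limsup_atTop_eq_zero (ne_top_of_le_ne_top ?_ (ENNReal.tsum_le_tsum fun k =>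
    hausdorffContent_le_of_lt_twoSidedMax hm0 hm1 (δ := δ) ha haβ hβ0 hβ hs f k i))
  rw [ENNReal.tsum_mul_left]
  refine ENNReal.mul_ne_top (ENNReal.mul_ne_top ?_ (sobolevIntegral_ne_top hs hf))
    (tsum_ofReal_two_rpow_pow_ne_top ?_)
  · exact ENNReal.mul_ne_top (by norm_num) (ENNReal.mul_ne_top ENNReal.coe_ne_top (by norm_num))
  · rw [hδ]; linarith

theorem growth_lt_iff (hm1 : m < 1) (a s : ℝ) : growth m a < 2 * s ↔
    max (1 - 2 * s) (1 / 2 + (1 - 4 * s) / (2 * (1 - m))) < a := by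
  have h : 0 < 1 - m := by linarith
  rw [growth, max_lt_iff, max_lt_iff, and_comm]
  refine and_congr ⟨fun h => by linarith, fun h => by linarith⟩ ?_
  rw [show 1 / 2 + (1 - 4 * s) / (2 * (1 - m)) = (1 - m / 2 - 2 * s) / (1 - m) by field_simp; ring,
    div_lt_iff₀ h]
  constructor <;> intro <;> linarith

/-- The bound for the dimension of the divergence set. -/
theorem dimH_divergenceSet_le (hm0 : 0 < m) (hm1 : m < 1) {s : ℝ} (hs1 : m / 4 < s)
    (hs2 : s < 1 / 2) {f : Lp ℂ 2 (volume : Measure ℝ)} (hf : InHs s f) :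
    dimH (divergenceSet m f) ≤
      ENNReal.ofReal (max (1 - 2 * s) (1 / 2 + (1 - 4 * s) / (2 * (1 - m)))) := by
  set β₀ := max (1 - 2 * s) (1 / 2 + (1 - 4 * s) / (2 * (1 - m))) with hβ₀
  have h0 : 0 < β₀ := lt_max_of_lt_left (by linarith)
  -- `growth m 1 = m/2`, so this is where `s > m/4` enters.
  have h1 : β₀ < 1 := by
    rw [hβ₀, ← growth_lt_iff hm1, growth, max_lt_iff]
    constructor <;> linarith
  -- The bound holds for each `β ∈ (β₀, 1]`, with an auxiliary `a` strictly between `β₀` and `β`;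
  -- then `β` decreases to `β₀`.
  refine le_of_forall_gt_imp_ge_of_dense fun c hc => ?_
  obtain ⟨β, hβ1, hβ2, hβc⟩ : ∃ β, β₀ < β ∧ β ≤ 1 ∧ ENNReal.ofReal β ≤ c := by
    rcases eq_or_ne c ∞ with rfl | hctop
    · exact ⟨1, h1, le_rfl, le_top⟩
    · refine ⟨min c.toReal 1, lt_min ?_ h1, min_le_right _ _, ?_⟩
      · exact (ENNReal.ofReal_lt_iff_lt_toReal h0.le hctop).1 hc
      · exact (ENNReal.ofReal_le_ofReal (min_le_left _ _)).trans ENNReal.ofReal_toReal_le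
  obtain ⟨a, ha1, ha2⟩ := exists_between hβ1
  exact (dimH_divergenceSet_le_of_growth_lt hm0 hm1 (h0.trans ha1) ha2 hβ2 (by linarith)
    ((growth_lt_iff hm1 a s).2 ha1) hf).trans hβc

end

/-! ### The maximal estimate -/

section

variable {m : ℝ}

/-- The ball of radius `2` carries the whole mass, whence the factor `2 ≥ 2^α`. -/
theorem IsDimensional.isDimensionalUpTo {α : ℝ} {A : ℝ≥0} {μ : Measure ℝ} (hα : α ≤ 1)
    (h : IsDimensional α A μ) (E : Set ℝ) (k : ℕ) :
    IsDimensionalUpTo α (2 * A) k (μ.restrict E) := by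
  refine ⟨?_, fun x j _ => ?_⟩
  · rw [Measure.restrict_apply_univ]
    calc μ E ≤ μ (Metric.ball 0 2 ∪ (Metric.closedBall (0 : ℝ) 1)ᶜ) := by
          refine measure_mono fun x _ => ?_
          by_cases hx : x ∈ Metric.closedBall (0 : ℝ) 1
          · exact Or.inl (Metric.closedBall_subset_ball (by norm_num) hx)
          · exact Or.inr hx
      _ ≤ μ (Metric.ball 0 2) + 0 := by
          rw [← h.1]
          exact measure_union_le _ _
      _ ≤ A * ENNReal.ofReal (2 ^ α) := by
          rw [add_zero]
          exact h.2 0 2 (by norm_num)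
      _ ≤ A * ENNReal.ofReal 2 := by
          gcongr
          calc (2 : ℝ) ^ α ≤ 2 ^ (1 : ℝ) := Real.rpow_le_rpow_of_exponent_le (by norm_num) hα
            _ = 2 := Real.rpow_one 2
      _ = _ := by
          push_cast
          rw [ENNReal.ofReal_ofNat, mul_comm]
  · refine (Measure.restrict_apply_le _ _).trans ((h.2 x _ (by positivity)).trans ?_)
    gcongr
    rw [two_mul]
    exact le_self_add

theorem growth_eq_two_mul_criticalIndex (m α q : ℝ) :
    growth m (2 * α / q) = 2 * criticalIndex m α q := by
  rw [growth, criticalIndex, mul_max_of_nonneg _ _ (by norm_num)]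
  congr 1 <;> ring

theorem continuous_growth (m : ℝ) : Continuous (growth m) := by
  unfold growth
  fun_prop

/-- As `α/q ≤ 1/2`, the first term is at least `m/4`. Hence only nonnegative `s` matter. -/
theorem criticalIndex_pos {α q : ℝ} (hm0 : 0 < m) (hm1 : m < 1) (hα : α ≤ 1)
    (hq : 2 ≤ q) : 0 < criticalIndex m α q := by
  refine lt_max_of_lt_left ?_
  have : α / q ≤ 1 / 2 := by
    rw [div_le_div_iff₀ (by linarith) (by norm_num)]
    linarith
  rw [mul_div_assoc]
  nlinarith

/-- The potential needs `a` strictly below the dimension `2α/q`; the strict inequality for `s` and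
the continuity of `growth` leave room for this. -/
theorem exists_growth_lt {α q s : ℝ} (hα : 0 < α) (hq : 2 ≤ q)
    (hs : criticalIndex m α q < s) :
    ∃ a, 0 < a ∧ a < 2 * α / q ∧ growth m a < 2 * s := by
  have h0 : 0 < 2 * α / q := by positivity
  have h1 : growth m (2 * α / q) < 2 * s := by
    rw [growth_eq_two_mul_criticalIndex]
    linarith
  have h2 : ∀ᶠ a in 𝓝[<] (2 * α / q), growth m a < 2 * s :=
    nhdsWithin_le_nhds ((continuous_growth m).continuousAt.eventually (gt_mem_nhds h1))
  obtain ⟨a, h3, h4⟩ := (h2.and (Ioo_mem_nhdsLT h0)).exists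
  exact ⟨a, h4.1, h4.2, h3⟩

/-- Minkowski's inequality sums the shell bounds, geometric of ratio `2^{(growth m a - 2s)/2}`, and
Cauchy–Schwarz treats `|ξ| ≤ 1`. The same bound makes the sum of the shell maxima finite almost
everywhere, hence the existence of the values. -/
theorem maximal_estimate (hm0 : 0 < m) (hm1 : m < 1) {α q s : ℝ} (hα0 : 0 < α) (hα : α ≤ 1)
    (hq : 2 ≤ q) (hs : criticalIndex m α q < s) (A : ℝ≥0) :
    ∃ C : ℝ≥0, ∀ μ : Measure ℝ, IsDimensional α A μ →
      ∀ f : Lp ℂ 2 (volume : Measure ℝ), InHs s f →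
        (∀ᵐ x ∂(μ.restrict (Ioo 0 1)), ∀ t ∈ Ioo (0 : ℝ) 1,
          ∃ v : ℂ, HasEvolutionValue m f x t v) ∧
        maximalNorm m q μ f ≤ C * hsNorm s f := by
  have hs0 : 0 ≤ s := ((criticalIndex_pos hm0 hm1 hα hq).trans hs).le
  have hq0 : 0 < q := by linarith
  obtain ⟨a, ha0, ha1, hgr⟩ := exists_growth_lt hα0 hq hs
  set D : ℝ≥0∞ := 2 ^ (1 / 2 : ℝ) * ((2 * A : ℝ≥0) : ℝ≥0∞) ^ (1 / q) +
    ∑' k, 2 * shellBound m a α q s (2 * A) k ^ (1 / 2 : ℝ) with hD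
  have hDtop : D ≠ ∞ := by
    refine ENNReal.add_ne_top.2 ⟨ENNReal.mul_ne_top
      (ENNReal.rpow_ne_top_of_nonneg (by norm_num) (by norm_num))
      (ENNReal.rpow_ne_top_of_nonneg (by positivity) ENNReal.coe_ne_top), ?_⟩
    have h1 : ∀ k, 2 * shellBound m a α q s (2 * A) k ^ (1 / 2 : ℝ) =
        2 * (shellConst m a (2 * α / q) * ((2 * A : ℝ≥0) : ℝ≥0∞) ^ (2 / q)) ^ (1 / 2 : ℝ) *
          ENNReal.ofReal ((2 : ℝ) ^ ((growth m a - 2 * s) * (1 / 2))) ^ k := fun k => by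
      rw [shellBound, ENNReal.mul_rpow_of_nonneg _ _ (by norm_num : (0 : ℝ) ≤ 1 / 2),
        ENNReal.ofReal_rpow_of_nonneg (by positivity) (by norm_num), ← Real.rpow_mul (by positivity),
        ofReal_two_pow_rpow, mul_assoc]
    simp_rw [h1]
    rw [ENNReal.tsum_mul_left]
    refine ENNReal.mul_ne_top (ENNReal.mul_ne_top (by norm_num)
      (ENNReal.rpow_ne_top_of_nonneg (by norm_num) (ENNReal.mul_ne_top ENNReal.coe_ne_top
        (ENNReal.rpow_ne_top_of_nonneg (by positivity) ENNReal.coe_ne_top))))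
      (tsum_ofReal_two_rpow_pow_ne_top ?_)
    linarith
  have hpi : ENNReal.ofReal (2 * Real.pi) ^ (1 / 2 : ℝ) ≠ ∞ :=
    ENNReal.rpow_ne_top_of_nonneg (by norm_num) ENNReal.ofReal_ne_top
  refine ⟨(D * ENNReal.ofReal (2 * Real.pi) ^ (1 / 2 : ℝ)).toNNReal, fun μ hμ f hf => ?_⟩
  set ν := μ.restrict (Ioo 0 1) with hν
  have hdim : ∀ k, IsDimensionalUpTo α (2 * A) k ν := hμ.isDimensionalUpTo hα _
  have hTm : ∀ k, Measurable (twoSidedMax m (fhat f) k) := measurable_twoSidedMax hm0 f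
  have hW := sobolevIntegral_ne_top hs0 hf
  set W := sobolevIntegral s f ^ (1 / 2 : ℝ) with hWdef
  have hWtop : W ≠ ∞ := ENNReal.rpow_ne_top_of_nonneg (by norm_num) hW
  have hsum : (∫⁻ x, (∑' k, twoSidedMax m (fhat f) k x) ^ q ∂ν) ^ (1 / q) ≤
      (∑' k, 2 * shellBound m a α q s (2 * A) k ^ (1 / 2 : ℝ)) * W := by
    refine (lintegral_Lp_tsum_le (by linarith) hTm).trans ?_
    rw [← ENNReal.tsum_mul_right]
    refine ENNReal.tsum_le_tsum fun k => ?_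
    refine (lintegral_twoSidedMax_rpow_le hm0 hm1 ha0 hq ha1 hα hs0 f (hdim k)).trans (le_of_eq ?_)
    rw [ENNReal.mul_rpow_of_nonneg _ _ (by norm_num), ← mul_assoc]
  have hsumtop : ∫⁻ x, (∑' k, twoSidedMax m (fhat f) k x) ^ q ∂ν ≠ ∞ := by
    intro htop
    rw [htop, ENNReal.top_rpow_of_pos (by positivity), top_le_iff] at hsum
    refine ENNReal.mul_ne_top (ne_top_of_le_ne_top hDtop ?_) hWtop hsum
    exact le_add_self
  have hTsm : Measurable fun x => ∑' k, twoSidedMax m (fhat f) k x := Measurable.tsum hTm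
  constructor
  · filter_upwards [ae_lt_top (hTsm.pow_const q) hsumtop] with x hx t ht
    refine ⟨_, hasEvolutionValue_of_tsum_ne_top hm0 f ?_ ⟨by linarith [ht.1], ht.2.le⟩⟩
    intro htop
    rw [htop, ENNReal.top_rpow_of_pos hq0] at hx
    exact lt_irrefl _ hx
  · set L : ℝ≥0∞ := 2 ^ (1 / 2 : ℝ) * W with hL
    calc maximalNorm m q μ f ≤
        (∫⁻ x, (L + ∑' k, twoSidedMax m (fhat f) k x) ^ q ∂ν) ^ (1 / q) := by
          rw [maximalNorm]
          gcongr with x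
          exact (maximalFunction_le hm0 f x).trans
            (add_le_add_left (lintegral_low_fhat_le hs0 f) _)
      _ ≤ (∫⁻ _, L ^ q ∂ν) ^ (1 / q) +
          (∫⁻ x, (∑' k, twoSidedMax m (fhat f) k x) ^ q ∂ν) ^ (1 / q) :=
        ENNReal.lintegral_Lp_add_le (f := fun _ => L) aemeasurable_const hTsm.aemeasurable
          (by linarith)
      _ ≤ L * ((2 * A : ℝ≥0) : ℝ≥0∞) ^ (1 / q) +
          (∑' k, 2 * shellBound m a α q s (2 * A) k ^ (1 / 2 : ℝ)) * W := by
          refine add_le_add ?_ hsum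
          rw [lintegral_const, ENNReal.mul_rpow_of_nonneg _ _ (by positivity), ← ENNReal.rpow_mul,
            mul_one_div_cancel hq0.ne', ENNReal.rpow_one]
          gcongr
          exact (hdim 0).measure_univ_le
      _ = D * W := by rw [hD, hL]; ring
      _ = _ := by
          rw [ENNReal.coe_toNNReal (ENNReal.mul_ne_top hDtop hpi), hWdef,
            sobolevIntegral_rpow_half, mul_assoc]

end

/-! ### Sharpness: the measure and the test functions -/

/-- The image of Lebesgue measure on `(0, 1)` under `y ↦ y^{1/α}`, with density `α x^{α-1}`. -/
def powerMeasure (α : ℝ) : Measure ℝ :=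
  (volume.restrict (Ioo (0 : ℝ) 1)).map fun y => y ^ (1 / α)

theorem powerMeasure_apply (α : ℝ) {S : Set ℝ} (hS : MeasurableSet S) :
    powerMeasure α S = volume ((fun y : ℝ => y ^ (1 / α)) ⁻¹' S ∩ Ioo 0 1) := by
  have hf : Measurable fun y : ℝ => y ^ (1 / α) := by fun_prop
  rw [powerMeasure, Measure.map_apply hf hS, Measure.restrict_apply (hf hS)]

/-- For `α ≤ 1` the map `x ↦ x^α` is subadditive, so it takes the part in `[0, 1]` of a ball of
radius `r` to a set of diameter at most `(2r)^α ≤ 2r^α`. -/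
theorem isDimensional_powerMeasure {α : ℝ} (hα0 : 0 < α) (hα : α ≤ 1) :
    IsDimensional α 2 (powerMeasure α) := by
  constructor
  · rw [powerMeasure_apply α Metric.isClosed_closedBall.measurableSet.compl]
    convert measure_empty (μ := volume)
    refine eq_empty_of_forall_notMem fun y ⟨hy, hy0, hy1⟩ => hy ?_
    rw [Metric.mem_closedBall, dist_zero_right, Real.norm_of_nonneg (Real.rpow_nonneg hy0.le _)]
    exact Real.rpow_le_one hy0.le hy1.le (by positivity)
  · intro x r hr
    rw [powerMeasure_apply α Metric.isOpen_ball.measurableSet]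
    refine (Real.volume_le_diam _).trans (Metric.ediam_le fun y hy z hz => ?_)
    have key : ∀ u v : ℝ, 0 ≤ v → v ≤ u → u - v ≤ 2 * r → u ^ α - v ^ α ≤ 2 * r ^ α := by
      intro u v hv huv huv'
      have h1 := Real.rpow_add_le_add_rpow hv (sub_nonneg.2 huv) hα0.le hα
      rw [add_sub_cancel] at h1
      have h2 : (u - v) ^ α ≤ 2 ^ α * r ^ α := by
        rw [← Real.mul_rpow (by norm_num) hr.le]
        exact Real.rpow_le_rpow (sub_nonneg.2 huv) huv' hα0.le
      have h3 : (2 : ℝ) ^ α ≤ 2 := by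
        simpa using Real.rpow_le_rpow_of_exponent_le (one_le_two (α := ℝ)) hα
      nlinarith [Real.rpow_nonneg hr.le α]
    have hinv : ∀ w ∈ Ioo (0 : ℝ) 1, (w ^ (1 / α)) ^ α = w := fun w hw => by
      rw [← Real.rpow_mul hw.1.le, one_div_mul_cancel hα0.ne', Real.rpow_one]
    have hy' : |y ^ (1 / α) - x| < r := hy.1
    have hz' : |z ^ (1 / α) - x| < r := hz.1
    rw [abs_lt] at hy' hz'
    have hle : |y - z| ≤ 2 * r ^ α := by
      rw [← hinv y hy.2, ← hinv z hz.2, abs_le]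
      have h0y := Real.rpow_nonneg hy.2.1.le (1 / α)
      have h0z := Real.rpow_nonneg hz.2.1.le (1 / α)
      have hpos := Real.rpow_nonneg hr.le α
      rcases le_total (y ^ (1 / α)) (z ^ (1 / α)) with h | h
      · have := key _ _ h0y h (by linarith)
        have := Real.rpow_le_rpow h0y h hα0.le
        constructor <;> linarith
      · have := key _ _ h0z h (by linarith)
        have := Real.rpow_le_rpow h0z h hα0.le
        constructor <;> linarith
    rw [edist_dist, Real.dist_eq]
    refine (ENNReal.ofReal_le_ofReal hle).trans ?_
    rw [ENNReal.ofReal_mul (by norm_num)]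
    simp

theorem ofReal_rpow_le_powerMeasure {α δ : ℝ} (hα0 : 0 < α) (hδ0 : 0 < δ) (hδ1 : δ ≤ 1) :
    ENNReal.ofReal (δ ^ α) ≤ powerMeasure α (Ioo 0 δ) := by
  rw [powerMeasure_apply α measurableSet_Ioo]
  calc ENNReal.ofReal (δ ^ α) = volume (Ioo 0 (δ ^ α)) := by rw [Real.volume_Ioo, sub_zero]
    _ ≤ _ := by
      refine measure_mono fun y hy => ⟨⟨Real.rpow_pos_of_pos hy.1 _, ?_⟩, hy.1,
        hy.2.trans_le (Real.rpow_le_one hδ0.le hδ1 hα0.le)⟩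
      have := Real.rpow_lt_rpow hy.1.le hy.2 (one_div_pos.2 hα0)
      rwa [← Real.rpow_mul hδ0.le, mul_one_div_cancel hα0.ne', Real.rpow_one] at this

/-- `ψ` is a continuous cutoff to the interval of radius `W` about `c`. -/
structure IsCutoff (ψ : ℝ → ℝ) (c W : ℝ) : Prop where
  continuous : Continuous ψ
  nonneg : ∀ ξ, 0 ≤ ψ ξ
  le_one : ∀ ξ, ψ ξ ≤ 1
  eq_one : ∀ ξ, |ξ - c| ≤ W / 2 → ψ ξ = 1
  eq_zero : ∀ ξ, W ≤ |ξ - c| → ψ ξ = 0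

theorem exists_fhat_eq_cutoff (c : ℝ) {W : ℝ} (hW : 0 < W) :
    ∃ (f : 𝓢(ℝ, ℂ)) (ψ : ℝ → ℝ), IsCutoff ψ c W ∧
      fhat (f.toLp 2) =ᵐ[volume] fun ξ => (ψ ξ : ℂ) := by
  let b : ContDiffBump c := ⟨W / 2, W, by positivity, by linarith⟩
  have hpi : (2 * Real.pi) ≠ 0 := by positivity
  have hsupp : HasCompactSupport fun η : ℝ => ((b (2 * Real.pi * η) : ℝ) : ℂ) := by
    have h1 : HasCompactSupport fun η : ℝ => b (2 * Real.pi * η) :=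
      b.hasCompactSupport.comp_homeomorph (Homeomorph.mulLeft₀ (2 * Real.pi) hpi)
    exact h1.comp_left (g := fun r : ℝ => (r : ℂ)) Complex.ofReal_zero
  have hsmooth : ContDiff ℝ ((⊤ : ℕ∞) : WithTop ℕ∞)
      fun η : ℝ => ((b (2 * Real.pi * η) : ℝ) : ℂ) :=
    Complex.ofRealCLM.contDiff.comp (b.contDiff.comp (contDiff_const.mul contDiff_id))
  let φ : 𝓢(ℝ, ℂ) := hsupp.toSchwartzMap hsmooth
  have hφ : ∀ η, φ η = ((b (2 * Real.pi * η) : ℝ) : ℂ) := fun η => rfl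
  refine ⟨(𝓕⁻ φ : 𝓢(ℝ, ℂ)), b, ⟨b.continuous, fun ξ => b.nonneg, fun ξ => b.le_one,
    fun ξ hξ => b.one_of_mem_closedBall hξ, fun ξ hξ => b.zero_of_le_dist hξ⟩, ?_⟩
  have h1 : (𝓕 ((𝓕⁻ φ : 𝓢(ℝ, ℂ)).toLp 2) : Lp ℂ 2 (volume : Measure ℝ)) = φ.toLp 2 := by
    rw [SchwartzMap.toLp_fourier_eq, FourierTransform.fourier_fourierInv_eq]
  have h2 : (φ.toLp 2 : Lp ℂ 2 (volume : Measure ℝ)) =ᵐ[volume] φ :=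
    SchwartzMap.coeFn_toLp _ 2 volume
  have hq : Measure.QuasiMeasurePreserving (fun ξ : ℝ => ξ / (2 * Real.pi)) volume volume := by
    refine ⟨by fun_prop, ?_⟩
    simp_rw [div_eq_mul_inv]
    rw [Real.map_volume_mul_right (inv_ne_zero hpi)]
    exact Measure.smul_absolutelyContinuous
  filter_upwards [hq.ae h2] with ξ hξ
  rw [fhat, h1, hξ, hφ, mul_div_cancel₀ _ hpi]

/-- There is no cancellation: after removal of the constant phase `h` the real part of the integrand
is at least `ψ/2`, because `cos ≥ 1/2` on `[-1, 1]`, and `ψ = 1` on an interval of length `W`. -/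
theorem IsCutoff.le_norm_symmetricIntegral {ψ : ℝ → ℝ} {m c W x t h R : ℝ} (hψ : IsCutoff ψ c W)
    (hm : 0 < m) (hW : 0 < W) (hR : |c| + W ≤ R)
    (hphase : ∀ ξ, |ξ - c| ≤ W → |x * ξ + t * |ξ| ^ m - h| ≤ 1) :
    W / 2 ≤ ‖symmetricIntegral m (fun ξ => (ψ ξ : ℂ)) R x t‖ := by
  have hc := abs_le.1 (le_refl |c|)
  have hcont : Continuous fun ξ =>
      Complex.exp (Complex.I * ((-h : ℝ) : ℂ)) * (osc m x t ξ * (ψ ξ : ℂ)) :=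
    continuous_const.mul ((continuous_osc_right hm x t).mul
      (Complex.continuous_ofReal.comp hψ.continuous))
  have hre : ∀ ξ, (Complex.exp (Complex.I * ((-h : ℝ) : ℂ)) * (osc m x t ξ * (ψ ξ : ℂ))).re =
      Real.cos (x * ξ + t * |ξ| ^ m - h) * ψ ξ := fun ξ => by
    rw [osc, ← mul_assoc, ← Complex.exp_add, ← mul_add, ← Complex.ofReal_add, mul_comm Complex.I,
      Complex.re_mul_ofReal, Complex.exp_ofReal_mul_I_re]
    ring_nf
  have hcos : ∀ ξ, ψ ξ / 2 ≤ Real.cos (x * ξ + t * |ξ| ^ m - h) * ψ ξ := fun ξ => by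
    rcases le_total W |ξ - c| with hξ | hξ
    · rw [hψ.eq_zero ξ hξ]; simp
    · have h1 := Real.one_sub_sq_div_two_le_cos (x := x * ξ + t * |ξ| ^ m - h)
      have h2 := (sq_le_one_iff_abs_le_one _).2 (hphase ξ hξ)
      have := hψ.nonneg ξ
      nlinarith
  have hintψ : ∀ a b, IntervalIntegrable (fun ξ => ψ ξ / 2) volume a b := fun a b =>
    (hψ.continuous.div_const 2).intervalIntegrable a b
  calc W / 2 = ∫ ξ in (c - W / 2)..(c + W / 2), (1 / 2 : ℝ) := by
        rw [intervalIntegral.integral_const, smul_eq_mul]; ring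
    _ = ∫ ξ in (c - W / 2)..(c + W / 2), ψ ξ / 2 := by
        refine intervalIntegral.integral_congr fun ξ hξ => ?_
        rw [uIcc_of_le (by linarith), mem_Icc] at hξ
        rw [hψ.eq_one ξ (abs_le.2 ⟨by linarith, by linarith⟩)]
    _ ≤ ∫ ξ in (-R)..R, ψ ξ / 2 := by
        refine intervalIntegral.integral_mono_interval (by linarith) (by linarith) (by linarith)
          (Eventually.of_forall fun ξ => ?_) (hintψ _ _)
        have := hψ.nonneg ξ
        simp only [Pi.zero_apply]
        positivity
    _ ≤ ∫ ξ in (-R)..R, Real.cos (x * ξ + t * |ξ| ^ m - h) * ψ ξ := by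
        refine intervalIntegral.integral_mono_on (by linarith) (hintψ _ _) ?_ fun ξ _ => hcos ξ
        simp_rw [← hre]
        exact (Complex.continuous_re.comp hcont).intervalIntegrable _ _
    _ = (Complex.exp (Complex.I * ((-h : ℝ) : ℂ)) *
          symmetricIntegral m (fun ξ => (ψ ξ : ℂ)) R x t).re := by
        rw [symmetricIntegral, ← intervalIntegral.integral_const_mul]
        simp_rw [← hre]
        exact Complex.reCLM.intervalIntegral_comp_comm (hcont.intervalIntegrable _ _)
    _ ≤ ‖Complex.exp (Complex.I * ((-h : ℝ) : ℂ)) *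
          symmetricIntegral m (fun ξ => (ψ ξ : ℂ)) R x t‖ := Complex.re_le_norm _
    _ = _ := by rw [norm_mul, mul_comm Complex.I, Complex.norm_exp_ofReal_mul_I, one_mul]

theorem IsCutoff.le_maximalFunction {ψ : ℝ → ℝ} {m c W x t h : ℝ} (hψ : IsCutoff ψ c W)
    {f : Lp ℂ 2 (volume : Measure ℝ)} (hf : fhat f =ᵐ[volume] fun ξ => (ψ ξ : ℂ))
    (hm : 0 < m) (hW : 0 < W) (ht : t ∈ Ioo (0 : ℝ) 1)
    (hphase : ∀ ξ, |ξ - c| ≤ W → |x * ξ + t * |ξ| ^ m - h| ≤ 1) :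
    ENNReal.ofReal ((2 * Real.pi)⁻¹ * (W / 2)) ≤ maximalFunction m f x := by
  refine le_trans ?_ (le_iSup₂_of_le t ht le_rfl)
  refine le_limsup_of_frequently_le' (Eventually.frequently ?_)
  filter_upwards [eventually_ge_atTop (|c| + W)] with R hR
  have h1 := hψ.le_norm_symmetricIntegral hm hW hR hphase
  have h2 : truncatedEvolution m f R x t = (2 * Real.pi : ℂ)⁻¹ *
      symmetricIntegral m (fun ξ => (ψ ξ : ℂ)) R x t := by
    rw [truncatedEvolution_eq, symmetricIntegral, symmetricIntegral]
    congr 1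
    refine intervalIntegral.integral_congr_ae ?_
    filter_upwards [hf] with ξ hξ _
    rw [hξ]
  rw [← ofReal_norm, h2, norm_mul, norm_inv]
  refine ENNReal.ofReal_le_ofReal ?_
  have h3 : ‖(2 * Real.pi : ℂ)‖ = 2 * Real.pi := by
    rw [← Complex.ofReal_ofNat, ← Complex.ofReal_mul, Complex.norm_real, Real.norm_of_nonneg
      (by positivity)]
  rw [h3]
  gcongr

/-- On the support `|ξ| ≤ 2N`, so `1 + ξ² ≤ 5N²`; the factor `2` in the length `2W` of the support
is absorbed by `(2π)⁻¹`. -/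
theorem IsCutoff.hsNorm_le {ψ : ℝ → ℝ} {N W s : ℝ} (hψ : IsCutoff ψ (-N) W)
    {f : Lp ℂ 2 (volume : Measure ℝ)} (hf : fhat f =ᵐ[volume] fun ξ => (ψ ξ : ℂ))
    (hs : 0 ≤ s) (hN : 1 ≤ N) (hW : 0 < W) (hWN : W ≤ N) :
    hsNorm s f ≤ ENNReal.ofReal (5 ^ (s / 2) * (N ^ s * W ^ (1 / 2 : ℝ))) := by
  have h1 : sobolevIntegral s f ≤ ENNReal.ofReal ((5 * N ^ 2) ^ s * (2 * W)) := by
    calc sobolevIntegral s f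
        ≤ ∫⁻ ξ, (Icc (-N - W) (-N + W)).indicator
            (fun _ => ENNReal.ofReal ((5 * N ^ 2) ^ s)) ξ := by
          refine lintegral_mono_ae ?_
          filter_upwards [hf] with ξ hξ
          rw [hξ]
          by_cases hmem : ξ ∈ Icc (-N - W) (-N + W)
          · rw [indicator_of_mem hmem, ← ofReal_norm, Complex.norm_real,
              Real.norm_of_nonneg (hψ.nonneg ξ)]
            have h2 : ENNReal.ofReal (ψ ξ) ^ 2 ≤ 1 :=
              pow_le_one' (ENNReal.ofReal_le_one.2 (hψ.le_one ξ)) 2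
            refine (mul_le_of_le_one_right' h2).trans (ENNReal.ofReal_le_ofReal ?_)
            refine Real.rpow_le_rpow (by positivity) ?_ hs
            nlinarith [hmem.1, hmem.2]
          · have : ψ ξ = 0 := by
              refine hψ.eq_zero ξ (not_lt.1 fun hlt => hmem ?_)
              rw [abs_lt] at hlt
              exact ⟨by linarith, by linarith⟩
            simp [this]
      _ = ENNReal.ofReal ((5 * N ^ 2) ^ s * (2 * W)) := by
          rw [lintegral_indicator measurableSet_Icc, setLIntegral_const, Real.volume_Icc,
            ← ENNReal.ofReal_mul (by positivity)]
          ring_nf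
  rw [hsNorm_eq]
  have h3 : ENNReal.ofReal (2 * Real.pi)⁻¹ * sobolevIntegral s f ≤
      ENNReal.ofReal ((5 * N ^ 2) ^ s * W) := by
    refine (mul_le_mul_right h1 _).trans ?_
    rw [← ENNReal.ofReal_mul (by positivity)]
    refine ENNReal.ofReal_le_ofReal ?_
    have h4 : (2 * Real.pi)⁻¹ * 2 ≤ 1 := by
      rw [mul_inv, mul_comm, ← mul_assoc, mul_inv_cancel₀ (by norm_num), one_mul]
      exact inv_le_one_of_one_le₀ (by linarith [Real.pi_gt_three])
    calc (2 * Real.pi)⁻¹ * ((5 * N ^ 2) ^ s * (2 * W))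
        = ((2 * Real.pi)⁻¹ * 2) * ((5 * N ^ 2) ^ s * W) := by ring
      _ ≤ _ := mul_le_of_le_one_left (by positivity) h4
  refine (ENNReal.rpow_le_rpow h3 (by norm_num)).trans ?_
  rw [ENNReal.ofReal_rpow_of_nonneg (by positivity) (by norm_num)]
  refine ENNReal.ofReal_le_ofReal (le_of_eq ?_)
  have hN0 : 0 ≤ N := by linarith
  rw [Real.mul_rpow (by positivity) hW.le, ← Real.rpow_mul (by positivity),
    Real.mul_rpow (by norm_num) (by positivity), ← Real.rpow_natCast N 2, ← Real.rpow_mul hN0]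
  push_cast
  rw [show s * (1 / 2) = s / 2 by ring, show (2 : ℝ) * (s / 2) = s by ring, mul_assoc]

theorem hsNorm_mono {s s' : ℝ} (h : s ≤ s') (f : Lp ℂ 2 (volume : Measure ℝ)) :
    hsNorm s f ≤ hsNorm s' f := by
  refine ENNReal.rpow_le_rpow (mul_le_mul_right (lintegral_mono fun ξ => ?_) _) (by norm_num)
  gcongr
  nlinarith [sq_nonneg ξ]

theorem le_maximalNorm {m q δ : ℝ} {B : ℝ≥0∞} {μ : Measure ℝ} {f : Lp ℂ 2 (volume : Measure ℝ)}
    (hq : 0 < q) (hδ : δ ≤ 1) (hB : ∀ x ∈ Ioo 0 δ, B ≤ maximalFunction m f x) :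
    B * μ (Ioo 0 δ) ^ (1 / q) ≤ maximalNorm m q μ f := by
  calc B * μ (Ioo 0 δ) ^ (1 / q) = (∫⁻ x in Ioo 0 δ, B ^ q ∂μ) ^ (1 / q) := by
        rw [setLIntegral_const, ENNReal.mul_rpow_of_nonneg _ _ (by positivity),
          ← ENNReal.rpow_mul, mul_one_div_cancel hq.ne', ENNReal.rpow_one]
    _ ≤ (∫⁻ x in Ioo 0 δ, maximalFunction m f x ^ q ∂μ) ^ (1 / q) :=
        ENNReal.rpow_le_rpow (setLIntegral_mono' measurableSet_Ioo fun x hx =>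
          ENNReal.rpow_le_rpow (hB x hx) hq.le) (by positivity)
    _ ≤ _ := ENNReal.rpow_le_rpow (lintegral_mono_set (Ioo_subset_Ioo_right hδ)) (by positivity)

/-- Necessary condition for the maximal estimate, tested on data with frequencies near `-N`. -/
theorem le_of_maximalNorm_le {m α q s C N W δ : ℝ} (hm : 0 < m) (hα : 0 < α) (hq : 0 < q)
    (hs : 0 ≤ s) (hC : 0 ≤ C)
    (hM : ∀ f : 𝓢(ℝ, ℂ), maximalNorm m q (powerMeasure α) (f.toLp 2) ≤
      ENNReal.ofReal C * hsNorm s (f.toLp 2))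
    (hN : 1 ≤ N) (hW : 0 < W) (hWN : W ≤ N) (hδ0 : 0 < δ) (hδ1 : δ ≤ 1)
    (hphase : ∀ x ∈ Ioo 0 δ, ∃ t ∈ Ioo (0 : ℝ) 1, ∃ h : ℝ, ∀ ξ, |ξ + N| ≤ W →
      |x * ξ + t * |ξ| ^ m - h| ≤ 1) :
    W ^ (1 / 2 : ℝ) * δ ^ (α / q) ≤ 4 * Real.pi * C * 5 ^ (s / 2) * N ^ s := by
  obtain ⟨f, ψ, hψ, hf⟩ := exists_fhat_eq_cutoff (-N) hW
  have h1 : ∀ x ∈ Ioo 0 δ, ENNReal.ofReal ((2 * Real.pi)⁻¹ * (W / 2)) ≤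
      maximalFunction m (f.toLp 2) x := fun x hx => by
    obtain ⟨t, ht, h, hp⟩ := hphase x hx
    exact hψ.le_maximalFunction hf hm hW ht fun ξ hξ => hp ξ (by rwa [sub_neg_eq_add] at hξ)
  have h2 := (le_maximalNorm (μ := powerMeasure α) hq hδ1 h1).trans ((hM f).trans
    (mul_le_mul_right (hψ.hsNorm_le hf hs hN hW hWN) _))
  have h3 := (mul_le_mul_right (ENNReal.rpow_le_rpow (ofReal_rpow_le_powerMeasure hα hδ0 hδ1)
    (by positivity : 0 ≤ 1 / q)) (ENNReal.ofReal ((2 * Real.pi)⁻¹ * (W / 2)))).trans h2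
  have hN0 : 0 ≤ N := by linarith
  rw [ENNReal.ofReal_rpow_of_nonneg (by positivity) (by positivity), ← ENNReal.ofReal_mul
    (by positivity), ← ENNReal.ofReal_mul hC, ENNReal.ofReal_le_ofReal_iff (by positivity),
    ← Real.rpow_mul hδ0.le, mul_one_div] at h3
  have hW2 : W = W ^ (1 / 2 : ℝ) * W ^ (1 / 2 : ℝ) := by
    rw [← Real.rpow_add hW]; norm_num
  have hWp : 0 < W ^ (1 / 2 : ℝ) := Real.rpow_pos_of_pos hW _
  -- The lower bound is of size `W δ^{α/q}`, the norm of size `N^s W^{1/2}`.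
  refine le_of_mul_le_mul_left ?_ hWp
  have hpi : (4 * Real.pi) * (2 * Real.pi)⁻¹ = 2 := by
    field_simp
    norm_num
  calc W ^ (1 / 2 : ℝ) * (W ^ (1 / 2 : ℝ) * δ ^ (α / q)) = W * δ ^ (α / q) := by
        rw [← mul_assoc, ← hW2]
    _ = (4 * Real.pi) * ((2 * Real.pi)⁻¹ * (W / 2) * δ ^ (α / q)) := by
        rw [← mul_assoc, ← mul_assoc, hpi]; ring
    _ ≤ (4 * Real.pi) * (C * (5 ^ (s / 2) * (N ^ s * W ^ (1 / 2 : ℝ)))) := by gcongr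
    _ = _ := by ring

/-- The upper bound is Bernoulli's inequality for the exponent `m`. The lower one comes from
Bernoulli for `1 - m` and `(1 + y)^m (1 + y)^{1-m} = 1 + y`. -/
theorem abs_rpow_sub_taylor_le {m y : ℝ} (hm0 : 0 < m) (hm1 : m < 1) (hy : |y| ≤ 1 / 2) :
    |(1 + y) ^ m - (1 + m * y)| ≤ y ^ 2 := by
  obtain ⟨hy1, hy2⟩ := abs_le.1 hy
  have hup := rpow_one_add_le_one_add_mul_self (s := y) (by linarith) hm0.le hm1.le
  have hlow := rpow_one_add_le_one_add_mul_self (s := y) (p := 1 - m) (by linarith)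
    (by linarith) (by linarith)
  have hpos : 0 < 1 + y := by linarith
  have hmul : (1 + y) ^ m * (1 + y) ^ (1 - m) = 1 + y := by
    rw [← Real.rpow_add hpos, add_sub_cancel, Real.rpow_one]
  have hnn := Real.rpow_nonneg hpos.le m
  have h1 : 1 + y ≤ (1 + y) ^ m * (1 + (1 - m) * y) := by
    nlinarith
  have hden : 1 / 2 ≤ 1 + (1 - m) * y := by nlinarith
  have hmm : m * (1 - m) ≤ 1 / 4 := by nlinarith [sq_nonneg (m - 1 / 2)]
  have h2 : 1 + m * y - y ^ 2 ≤ (1 + y) ^ m := by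
    refine le_of_mul_le_mul_right (le_trans ?_ h1) (by linarith : 0 < 1 + (1 - m) * y)
    nlinarith [sq_nonneg y, mul_nonneg (sq_nonneg y) (by linarith : 0 ≤ 1 + (1 - m) * y - 1 / 2),
      mul_nonneg (sq_nonneg y) (by linarith : 0 ≤ 1 / 4 - m * (1 - m))]
  rw [abs_le]
  constructor <;> linarith [sq_nonneg y]

theorem le_of_forall_mul_rpow_le {K a b : ℝ} (hK : 0 < K)
    (h : ∀ N : ℝ, 1 ≤ N → K * N ^ a ≤ N ^ b) : a ≤ b := by
  by_contra! hab
  obtain ⟨N, hN, hN1⟩ := (((tendsto_rpow_atTop (sub_pos.2 hab)).eventually_gt_atTop K⁻¹).and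
    (eventually_ge_atTop 1)).exists
  have hN0 : 0 < N := by linarith
  have h1 := h N hN1
  rw [Real.rpow_sub hN0, lt_div_iff₀ (Real.rpow_pos_of_pos hN0 b), inv_mul_lt_iff₀ hK] at hN
  linarith

/-- Width `W = N/2`, points `x < 1/(4N)` and the time `t = N^{-m}/4`: each of the two terms of the
phase is at most `3/8`. -/
theorem scaling_index_le_of_maximal_estimate {m α q s C : ℝ} (hm0 : 0 < m) (hm1 : m < 1)
    (hα : 0 < α) (hq : 0 < q) (hs : 0 ≤ s) (hC : 0 ≤ C)
    (hM : ∀ f : 𝓢(ℝ, ℂ), maximalNorm m q (powerMeasure α) (f.toLp 2) ≤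
      ENNReal.ofReal C * hsNorm s (f.toLp 2)) :
    1 / 2 - α / q ≤ s := by
  -- `C + 1` replaces `C`, which may vanish, so that `D` can be inverted.
  set D := 4 * Real.pi * (C + 1) * 5 ^ (s / 2) with hD
  have hD0 : 0 < D := by positivity
  have hM' : ∀ f : 𝓢(ℝ, ℂ), maximalNorm m q (powerMeasure α) (f.toLp 2) ≤
      ENNReal.ofReal (C + 1) * hsNorm s (f.toLp 2) := fun f =>
    (hM f).trans (mul_le_mul_left (ENNReal.ofReal_le_ofReal (by linarith)) _)
  refine le_of_forall_mul_rpow_le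
    (K := D⁻¹ * ((1 / 2) ^ (1 / 2 : ℝ) * (1 / 4) ^ (α / q))) (by positivity) fun N hN => ?_
  have hN0 : 0 < N := by linarith
  have hNm : 1 ≤ N ^ m := Real.one_le_rpow hN hm0.le
  have key := le_of_maximalNorm_le (W := N / 2) (δ := 1 / 4 * N⁻¹) hm0 hα hq hs (by linarith) hM' hN
    (by positivity) (by linarith) (by positivity)
    (by nlinarith [inv_le_one_of_one_le₀ hN]) fun x hx => by
      refine ⟨(N ^ m)⁻¹ / 4, ⟨by positivity, by
        have := inv_le_one_of_one_le₀ hNm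
        linarith⟩, 0, fun ξ hξ => ?_⟩
      have hξ' : |ξ| ≤ 3 / 2 * N := by
        have := abs_le.1 hξ
        exact abs_le.2 ⟨by linarith, by linarith⟩
      have h1 : |x * ξ| ≤ 3 / 8 := by
        rw [abs_mul, abs_of_pos hx.1]
        calc x * |ξ| ≤ (1 / 4 * N⁻¹) * (3 / 2 * N) := by
              gcongr
              exact hx.2.le
          _ = 3 / 8 := by field_simp; norm_num
      have h2 : (N ^ m)⁻¹ / 4 * |ξ| ^ m ≤ 3 / 8 := by
        calc (N ^ m)⁻¹ / 4 * |ξ| ^ m ≤ (N ^ m)⁻¹ / 4 * (3 / 2 * N) ^ m := by gcongr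
          _ = (3 / 2) ^ m / 4 := by
              rw [Real.mul_rpow (by norm_num) hN0.le]
              field_simp
          _ ≤ (3 / 2) ^ (1 : ℝ) / 4 := by
              gcongr
              norm_num
          _ = 3 / 8 := by norm_num
      have h3 : 0 ≤ (N ^ m)⁻¹ / 4 * |ξ| ^ m := by positivity
      rw [abs_le] at h1 ⊢
      constructor <;> linarith
  rw [Real.mul_rpow (by norm_num) (by positivity), Real.inv_rpow hN0.le, ← Real.rpow_neg hN0.le,
    div_eq_mul_one_div, Real.mul_rpow hN0.le (by norm_num), ← hD] at key
  rw [mul_assoc, inv_mul_le_iff₀ hD0]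
  refine le_trans (le_of_eq ?_) key
  rw [sub_eq_add_neg, Real.rpow_add hN0]
  ring

/-- For `x, t > 0` the phase can be stationary only at negative `ξ`, hence the data near `-N`. The
time `t = xN^{1-m}/m` makes `-N` stationary, and it is below `1` exactly for `x < mN^{m-1}`. The
remaining quadratic term `tN^m y²`, with `ξ = -N(1 + y)`, stays bounded for `|y| ≲ N^{-m/2}`, that
is, for widths up to `N^{1-m/2}`. -/
theorem dispersive_index_le_of_maximal_estimate {m α q s C : ℝ} (hm0 : 0 < m) (hm1 : m < 1)
    (hα : 0 < α) (hq : 0 < q) (hs : 0 ≤ s) (hC : 0 ≤ C)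
    (hM : ∀ f : 𝓢(ℝ, ℂ), maximalNorm m q (powerMeasure α) (f.toLp 2) ≤
      ENNReal.ofReal C * hsNorm s (f.toLp 2)) :
    1 / 2 - m / 4 - (1 - m) * α / q ≤ s := by
  set D := 4 * Real.pi * (C + 1) * 5 ^ (s / 2) with hD
  have hD0 : 0 < D := by positivity
  have hM' : ∀ f : 𝓢(ℝ, ℂ), maximalNorm m q (powerMeasure α) (f.toLp 2) ≤
      ENNReal.ofReal (C + 1) * hsNorm s (f.toLp 2) := fun f =>
    (hM f).trans (mul_le_mul_left (ENNReal.ofReal_le_ofReal (by linarith)) _)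
  refine le_of_forall_mul_rpow_le
    (K := D⁻¹ * ((1 / 2) ^ (1 / 2 : ℝ) * m ^ (α / q))) (by positivity) fun N hN => ?_
  have hN0 : 0 < N := by linarith
  have hWN : N ^ (1 - m / 2) ≤ N := by
    simpa using Real.rpow_le_rpow_of_exponent_le hN (by linarith : 1 - m / 2 ≤ 1)
  have hδN : N ^ (m - 1) ≤ 1 := Real.rpow_le_one_of_one_le_of_nonpos hN (by linarith)
  have hprod : N ^ (m - 1) * N ^ (1 - m) = 1 := by
    rw [← Real.rpow_add hN0]; simp
  have key := le_of_maximalNorm_le (W := 1 / 2 * N ^ (1 - m / 2)) (δ := m * N ^ (m - 1)) hm0 hα hq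
    hs (by linarith) hM' hN (by positivity) (by linarith) (by positivity)
    (mul_le_one₀ hm1.le (by positivity) hδN) fun x hx => by
      set t := x * N ^ (1 - m) / m with ht
      have ht0 : 0 < t := by have := hx.1; positivity
      have ht1 : t < 1 := by
        rw [ht, div_lt_one hm0]
        calc x * N ^ (1 - m) < m * N ^ (m - 1) * N ^ (1 - m) := by
              gcongr
              exact hx.2
          _ = m := by rw [mul_assoc, hprod, mul_one]
      have hxN : x * N = m * t * N ^ m := by
        have : N ^ (1 - m) * N ^ m = N := by
          rw [← Real.rpow_add hN0]; simp
        rw [ht]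
        field_simp
        rw [mul_assoc, this]
      refine ⟨t, ⟨ht0, ht1⟩, t * N ^ m * (1 - m), fun ξ hξ => ?_⟩
      set y := -(ξ + N) / N with hy
      have hyN : ξ = -(N * (1 + y)) := by rw [hy]; field_simp; ring
      have hy1 : |y| ≤ 1 / 2 * N ^ (-m / 2) := by
        rw [hy, abs_div, abs_neg, abs_of_pos hN0, div_le_iff₀ hN0]
        refine hξ.trans (le_of_eq ?_)
        rw [mul_assoc, ← Real.rpow_add_one hN0.ne']
        ring_nf
      have hNm : N ^ (-m / 2) ≤ 1 := Real.rpow_le_one_of_one_le_of_nonpos hN (by linarith)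
      have hy2 : |y| ≤ 1 / 2 := by linarith
      have hpos : 0 < 1 + y := by linarith [(abs_le.1 hy2).1]
      have hξabs : |ξ| = N * (1 + y) := by rw [hyN, abs_neg, abs_of_pos (by positivity)]
      -- By `hxN` the linear term `xξ` equals `-tN^m m(1 + y)`, which removes the first order Taylor
      -- polynomial of `tN^m(1 + y)^m` up to the constant `tN^m(1 - m)`.
      have hdiff : x * ξ + t * |ξ| ^ m - t * N ^ m * (1 - m) =
          t * (N ^ m * ((1 + y) ^ m - (1 + m * y))) := by
        rw [hξabs, hyN, Real.mul_rpow hN0.le hpos.le]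
        linear_combination (-(1 + y)) * hxN
      rw [hdiff, abs_mul, abs_of_pos ht0, abs_mul, abs_of_pos (by positivity)]
      have hsq : y ^ 2 ≤ 1 / 4 * N ^ (-m) := by
        have h1 : N ^ (-m) = N ^ (-m / 2) * N ^ (-m / 2) := by
          rw [← Real.rpow_add hN0]; ring_nf
        rw [h1, ← sq_abs]
        nlinarith [abs_nonneg y]
      have h2 : N ^ m * N ^ (-m) = 1 := by
        rw [← Real.rpow_add hN0]; simp
      calc t * (N ^ m * |(1 + y) ^ m - (1 + m * y)|)
          ≤ 1 * (N ^ m * (1 / 4 * N ^ (-m))) := by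
            gcongr
            exact (abs_rpow_sub_taylor_le hm0 hm1 hy2).trans hsq
        _ = 1 / 4 * (N ^ m * N ^ (-m)) := by ring
        _ ≤ 1 := by rw [h2]; norm_num
  rw [Real.mul_rpow (by norm_num) (by positivity), Real.mul_rpow hm0.le (by positivity),
    ← Real.rpow_mul hN0.le, ← Real.rpow_mul hN0.le, ← hD] at key
  rw [mul_assoc, inv_mul_le_iff₀ hD0]
  refine le_trans (le_of_eq ?_) key
  rw [show 1 / 2 - m / 4 - (1 - m) * α / q = (1 - m / 2) * (1 / 2) + (m - 1) * (α / q) by ring,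
    Real.rpow_add hN0]
  ring

/-- Negative `s` are covered by passing to `max s 0`: the norm increases with `s`, and the critical
index is positive. -/
theorem criticalIndex_le_of_maximal_estimate {m α q s : ℝ} (hm0 : 0 < m) (hm1 : m < 1)
    (hα0 : 0 < α) (hα : α ≤ 1) (hq : 2 ≤ q) {C : ℝ≥0}
    (hM : ∀ f : 𝓢(ℝ, ℂ), maximalNorm m q (powerMeasure α) (f.toLp 2) ≤
      C * hsNorm s (f.toLp 2)) : criticalIndex m α q ≤ s := by
  have hM' : ∀ f : 𝓢(ℝ, ℂ), maximalNorm m q (powerMeasure α) (f.toLp 2) ≤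
      ENNReal.ofReal C * hsNorm (max s 0) (f.toLp 2) := fun f => by
    rw [ENNReal.ofReal_coe_nnreal]
    exact (hM f).trans (mul_le_mul_right (hsNorm_mono (le_max_left s 0) _) _)
  have hq0 : 0 < q := by linarith
  have h : criticalIndex m α q ≤ max s 0 := max_le
    (dispersive_index_le_of_maximal_estimate hm0 hm1 hα0 hq0 (le_max_right s 0) C.2 hM')
    (scaling_index_le_of_maximal_estimate hm0 hm1 hα0 hq0 (le_max_right s 0) C.2 hM')
  exact (le_max_iff.1 h).resolve_right (criticalIndex_pos hm0 hm1 hα hq).not_ge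

end FractionalSchrodinger
end

theorem theorem1 (m : ℝ) (hm0 : 0 < m) (hm1 : m < 1) :
    -- the dimension of the divergence sets
    (∀ s : ℝ, m / 4 < s → s < 1 / 2 →
      (⨆ (f : Lp ℂ 2 (volume : Measure ℝ)) (_ : FractionalSchrodinger.InHs s f),
        dimH (FractionalSchrodinger.divergenceSet m f)) ≤
      ENNReal.ofReal (max (1 - 2 * s) (1 / 2 + (1 - 4 * s) / (2 * (1 - m))))) ∧
    -- the maximal estimate, with a constant depending only on m, α, q, s and A
    (∀ α q s : ℝ, 0 < α → α ≤ 1 → 2 ≤ q → FractionalSchrodinger.criticalIndex m α q < s →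
      ∀ A : ℝ≥0, ∃ C : ℝ≥0, ∀ μ : Measure ℝ, FractionalSchrodinger.IsDimensional α A μ →
        ∀ f : Lp ℂ 2 (volume : Measure ℝ), FractionalSchrodinger.InHs s f →
          (∀ᵐ x ∂(μ.restrict (Ioo 0 1)), ∀ t ∈ Ioo (0 : ℝ) 1,
            ∃ v : ℂ, FractionalSchrodinger.HasEvolutionValue m f x t v) ∧
          FractionalSchrodinger.maximalNorm m q μ f ≤ C * FractionalSchrodinger.hsNorm s f) ∧
    -- its sharpness in s
    (∀ α q : ℝ, 0 < α → α ≤ 1 → 2 ≤ q →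
      ∃ (A : ℝ≥0) (μ : Measure ℝ), FractionalSchrodinger.IsDimensional α A μ ∧
        ∀ s : ℝ, s < FractionalSchrodinger.criticalIndex m α q →
          ¬ ∃ C : ℝ≥0, ∀ f : 𝓢(ℝ, ℂ),
            FractionalSchrodinger.maximalNorm m q μ (f.toLp 2) ≤
              C * FractionalSchrodinger.hsNorm s (f.toLp 2)) := by
  refine ⟨fun s h1 h2 => iSup₂_le fun f hf =>
      FractionalSchrodinger.dimH_divergenceSet_le hm0 hm1 h1 h2 hf,
    fun α q s hα0 hα hq hs A => FractionalSchrodinger.maximal_estimate hm0 hm1 hα0 hα hq hs A,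
    fun α q hα0 hα hq => ⟨2, FractionalSchrodinger.powerMeasure α,
      FractionalSchrodinger.isDimensional_powerMeasure hα0 hα, ?_⟩⟩
  rintro s hs ⟨C, hC⟩
  exact hs.not_ge (FractionalSchrodinger.criticalIndex_le_of_maximal_estimate hm0 hm1 hα0 hα hq hC)
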